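/- Let $d\ge 3$, $N=2^{\lfloor (d+1)/2\rfloor}$, $m\ge 0$, and let $\alpha_1,\dots,\alpha_d,\beta$ be Hermitian $N\times N$ matrices with $\alpha_j\alpha_k+\alpha_k\alpha_j=2\delta_{jk}\mathbb I$, $\alpha_j\beta+\beta\alpha_j=0$, $\beta^2=\mathbb I$. Write $L^2=L^2(\mathbb R^d;\mathbb C^N)$ with norm $\|\cdot\|$, $H^1=H^1(\mathbb R^d;\mathbb C^N)$, let $|M|$ denote the operator norm of a matrix $M$, and set $|\nabla V|^2=\sum_j|\partial_jV|^2$, $\nabla_{\!A}=\nabla-iA$, and $\{\beta,V\}=\beta V+V\beta$. Let $A\in L^2_{loc}(\mathbb R^d;\mathbb R^d)$ have magnetic field $B=(\partial_jA_k-\partial_kA_j)_{j,k}\in L^2_{loc}$ (distributional derivatives), and assume that $H_m(A)=-i\boldsymbol\alpha\cdot\nabla_{\!A}+m\beta$ is self-adjoint in $L^2$ with domain $H^1$. Let $V:\mathbb R^d\to\mathbb C^{N\times N}$ be such that $V(x)$ is Hermitian for almost every $x$ and $V$ is $H_m(A)$-bounded with relative bound less than one, i.e. there are $0<a<1$ and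 $b>0$ with $\|V\psi\|^2\le a\|H_m(A)\psi\|^2+b\|\psi\|^2$ for all $\psi\in H^1$. Then $H_m(A,V)=H_m(A)+V$ is an operator in $L^2$ with domain $H^1$. Let $x_0\in\mathbb R^d$, and suppose that $V\in C^\infty(\mathbb R^d\setminus\{x_0\})$ and that $V$ is bounded outside any ball containing $x_0$. Assume that there are constants $\varepsilon_1,\varepsilon_2,\varepsilon_3,\varepsilon_4\ge0$ with $$\Big(\tfrac{4d-6}{d-2}\Big)\varepsilon_1+\Big(\tfrac{4}{d-2}\Big)\varepsilon_2\varepsilon_3+2m\varepsilon_4^2+\Big(\tfrac{8d-8}{d-2}\Big)\varepsilon_3+\Big(\tfrac{4d-4}{d-2}\Big)\varepsilon_2\le 2$$ such that $\sup_{x\in\mathbb R^d}|x-x_0||V(x)|\le\varepsilon_3$ and, for every $\psi\in H^1$, $$\int|x-x_0|^2|B|^2|\psi|^2\le\varepsilon_1^2\|\nabla_{\!A}\psi\|^2,\qquad \int|x-x_0|^2|\nabla V|^2|\psi|^2\le\varepsilon_2^2\|\nabla_{\!A}\psi\|^2,$$ and, if $m\ne0$ and $\{\beta,V\}$ is not identically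 zero on $\mathbb R^d\setminus\{x_0\}$, also, for every $\psi\in H^1$, $$\int|x-x_0||\nabla V||\psi|^2\le\varepsilon_4^2\|\nabla_{\!A}\psi\|^2.$$ Then $\sigma_p(H_m(A,V))=\varnothing$, i.e. $H_m(A,V)$ has no eigenvalues. -/

import Mathlib

open MeasureTheory Filter
open scoped ENNReal ContDiff Matrix Matrix.Norms.L2Operator

/-- The underlying space `ℝ^d`, with its Euclidean norm. -/
abbrev Space (d : ℕ) : Type := EuclideanSpace ℝ (Fin d)

/-- The space of spinors `ℂ^N`, with its Hermitian inner product. -/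
abbrev Spinor (N : ℕ) : Type := EuclideanSpace ℂ (Fin N)

/-- The Hilbert space `L²(ℝ^d; ℂ^N)`. -/
abbrev SpinorL2 (d N : ℕ) : Type := Lp (Spinor N) 2 (volume : Measure (Space d))

/-- The number of spinor components `N = 2^⌊(d+1)/2⌋`. -/
abbrev spinorDim (d : ℕ) : ℕ := 2 ^ ((d + 1) / 2)

/-- The `j`-th vector of the standard basis of `ℝ^d`. -/
noncomputable abbrev stdVec {d : ℕ} (j : Fin d) : Space d := EuclideanSpace.single j (1 : ℝ)

/-- The action of a matrix on a spinor. -/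
noncomputable abbrev matAct {N : ℕ} (M : Matrix (Fin N) (Fin N) ℂ) : Spinor N →L[ℂ] Spinor N :=
  Matrix.toEuclideanCLM (n := Fin N) (𝕜 := ℂ) M

/-- Dirac matrices: Hermitian matrices `α₁, …, α_d, β` satisfying the anticommutation relations
`α_j α_k + α_k α_j = 2 δ_jk`, `α_j β + β α_j = 0` and `β² = 1`. -/
structure IsDiracMatrices {d N : ℕ} (α : Fin d → Matrix (Fin N) (Fin N) ℂ)
    (β : Matrix (Fin N) (Fin N) ℂ) : Prop where
  hermitian_alpha : ∀ j, (α j).IsHermitian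
  hermitian_beta : β.IsHermitian
  alpha_alpha : ∀ j k, α j * α k + α k * α j = if j = k then 2 else 0
  alpha_beta : ∀ j, α j * β + β * α j = 0
  beta_beta : β * β = 1

/-- `f ∈ L²_loc(ℝ^d)`. -/
def MemL2Loc {d : ℕ} {F : Type*} [NormedAddCommGroup F] (f : Space d → F) : Prop :=
  ∀ K : Set (Space d), IsCompact K → MemLp f 2 (volume.restrict K)

/-- `B` is the magnetic field `B_jk = ∂_j A_k - ∂_k A_j` of the vector potential `A`, with the
derivatives taken in the sense of distributions. -/
def IsMagneticField {d : ℕ} (A : Space d → Space d)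
    (B : Space d → Matrix (Fin d) (Fin d) ℝ) : Prop :=
  ∀ (j k : Fin d) (φ : Space d → ℝ), ContDiff ℝ ∞ φ → HasCompactSupport φ →
    ∫ x, φ x * B x j k = ∫ x, (A x j * fderiv ℝ φ x (stdVec k) - A x k * fderiv ℝ φ x (stdVec j))

/-- `g` is the weak partial derivative `∂_j ψ`. -/
def HasWeakPartial {d N : ℕ} (j : Fin d) (ψ g : SpinorL2 d N) : Prop :=
  ∀ φ : Space d → ℝ, ContDiff ℝ ∞ φ → HasCompactSupport φ →
    ∫ x, φ x • g x = -∫ x, fderiv ℝ φ x (stdVec j) • ψ x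

theorem SpinorL2.integrable_smul {d N : ℕ} (ψ : SpinorL2 d N) {φ : Space d → ℝ}
    (hφ : Continuous φ) (hc : HasCompactSupport φ) : Integrable (fun x => φ x • ψ x) := by
  have h : LocallyIntegrable (ψ : Space d → Spinor N) volume :=
    (Lp.memLp ψ).locallyIntegrable (by norm_num)
  exact h.integrable_smul_left_of_hasCompactSupport hφ hc

theorem continuous_partial {d : ℕ} (j : Fin d) {φ : Space d → ℝ} (hφ : ContDiff ℝ ∞ φ) :
    Continuous (fun x => fderiv ℝ φ x (stdVec j)) :=
  (hφ.continuous_fderiv (by simp)).clm_apply continuous_const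

theorem HasWeakPartial.add {d N : ℕ} {j : Fin d} {ψ₁ g₁ ψ₂ g₂ : SpinorL2 d N}
    (h₁ : HasWeakPartial j ψ₁ g₁) (h₂ : HasWeakPartial j ψ₂ g₂) :
    HasWeakPartial j (ψ₁ + ψ₂) (g₁ + g₂) := by
  intro φ hφ hc
  have hd := continuous_partial j hφ
  have hdc := hc.fderiv_apply (𝕜 := ℝ) (stdVec j)
  have e₁ : ∫ x, φ x • (g₁ + g₂ : SpinorL2 d N) x = ∫ x, (φ x • g₁ x + φ x • g₂ x) := by
    refine integral_congr_ae ?_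
    filter_upwards [Lp.coeFn_add g₁ g₂] with x hx
    rw [hx, Pi.add_apply, smul_add]
  have e₂ : ∫ x, fderiv ℝ φ x (stdVec j) • (ψ₁ + ψ₂ : SpinorL2 d N) x
      = ∫ x, (fderiv ℝ φ x (stdVec j) • ψ₁ x + fderiv ℝ φ x (stdVec j) • ψ₂ x) := by
    refine integral_congr_ae ?_
    filter_upwards [Lp.coeFn_add ψ₁ ψ₂] with x hx
    rw [hx, Pi.add_apply, smul_add]
  rw [e₁, e₂, integral_add (g₁.integrable_smul hφ.continuous hc)
    (g₂.integrable_smul hφ.continuous hc), integral_add (ψ₁.integrable_smul hd hdc)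
    (ψ₂.integrable_smul hd hdc), h₁ φ hφ hc, h₂ φ hφ hc, neg_add]

theorem HasWeakPartial.smul {d N : ℕ} {j : Fin d} {ψ g : SpinorL2 d N} (c : ℂ)
    (h : HasWeakPartial j ψ g) : HasWeakPartial j (c • ψ) (c • g) := by
  intro φ hφ hc
  have e₁ : ∫ x, φ x • (c • g : SpinorL2 d N) x = ∫ x, c • (φ x • g x) := by
    refine integral_congr_ae ?_
    filter_upwards [Lp.coeFn_smul c g] with x hx
    rw [hx, Pi.smul_apply, smul_comm]
  have e₂ : ∫ x, fderiv ℝ φ x (stdVec j) • (c • ψ : SpinorL2 d N) x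
      = ∫ x, c • (fderiv ℝ φ x (stdVec j) • ψ x) := by
    refine integral_congr_ae ?_
    filter_upwards [Lp.coeFn_smul c ψ] with x hx
    rw [hx, Pi.smul_apply, smul_comm]
  rw [e₁, e₂, integral_smul, integral_smul, h φ hφ hc, smul_neg]

theorem HasWeakPartial.unique {d N : ℕ} {j : Fin d} {ψ g₁ g₂ : SpinorL2 d N}
    (h₁ : HasWeakPartial j ψ g₁) (h₂ : HasWeakPartial j ψ g₂) : g₁ = g₂ := by
  refine Lp.ext (ae_eq_of_integral_contDiff_smul_eq
    ((Lp.memLp g₁).locallyIntegrable (by norm_num))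
    ((Lp.memLp g₂).locallyIntegrable (by norm_num)) ?_)
  intro φ hφ hc
  rw [h₁ φ hφ hc, h₂ φ hφ hc]

theorem HasWeakPartial.zero {d N : ℕ} (j : Fin d) :
    HasWeakPartial j (0 : SpinorL2 d N) 0 := by
  intro φ _ _
  have h := Lp.coeFn_zero (Spinor N) 2 (volume : Measure (Space d))
  rw [integral_eq_zero_of_ae, integral_eq_zero_of_ae, neg_zero]
  · filter_upwards [h] with x hx
    rw [hx]; simp
  · filter_upwards [h] with x hx
    rw [hx]; simp

/-- The Sobolev space `H¹(ℝ^d; ℂ^N)`. -/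
def SobolevH1 (d N : ℕ) : Submodule ℂ (SpinorL2 d N) where
  carrier := {ψ | ∀ j, ∃ g, HasWeakPartial j ψ g}
  add_mem' h₁ h₂ j := by
    obtain ⟨g₁, h₁⟩ := h₁ j
    obtain ⟨g₂, h₂⟩ := h₂ j
    exact ⟨_, h₁.add h₂⟩
  zero_mem' j := ⟨0, HasWeakPartial.zero j⟩
  smul_mem' c _ h j := by
    obtain ⟨g, h⟩ := h j
    exact ⟨_, h.smul c⟩

/-- The weak partial derivative `∂_j : H¹ → L²`. -/
noncomputable def weakPartial {d N : ℕ} (j : Fin d) : SobolevH1 d N →ₗ[ℂ] SpinorL2 d N where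
  toFun ψ := (ψ.2 j).choose
  map_add' ψ₁ ψ₂ := ((ψ₁ + ψ₂).2 j).choose_spec.unique
    ((ψ₁.2 j).choose_spec.add (ψ₂.2 j).choose_spec)
  map_smul' c ψ := ((c • ψ).2 j).choose_spec.unique ((ψ.2 j).choose_spec.smul c)

theorem weakPartial_spec {d N : ℕ} (j : Fin d) (ψ : SobolevH1 d N) :
    HasWeakPartial j (ψ : SpinorL2 d N) (weakPartial j ψ) := (ψ.2 j).choose_spec

/-- The `j`-th component `∂_j ψ - i A_j ψ` of the magnetic gradient of `ψ`. -/
noncomputable def magPartial {d N : ℕ} (A : Space d → Space d) (ψ : SobolevH1 d N) (j : Fin d)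
    (x : Space d) : Spinor N :=
  weakPartial j ψ x - (Complex.I * (A x j : ℂ)) • (ψ : SpinorL2 d N) x

/-- `‖∇_A ψ‖² = ∑_j ∫ |∂_j ψ - i A_j ψ|²`, with values in `[0, ∞]`. -/
noncomputable def magEnergy {d N : ℕ} (A : Space d → Space d) (ψ : SobolevH1 d N) : ℝ≥0∞ :=
  ∑ j, ∫⁻ x, ‖magPartial A ψ j x‖ₑ ^ 2

/-- `∫ w |ψ|²` for a non-negative weight `w`, with values in `[0, ∞]`. -/
noncomputable def weightedMass {d N : ℕ} (w : Space d → ℝ) (ψ : SobolevH1 d N) : ℝ≥0∞ :=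
  ∫⁻ x, ENNReal.ofReal (w x) * ‖(ψ : SpinorL2 d N) x‖ₑ ^ 2

/-- `|∇V|(x) = (∑_j |∂_j V(x)|²)^(1/2)`, where the norm of a matrix is its operator norm. -/
noncomputable def gradNorm {d N : ℕ} (V : Space d → Matrix (Fin N) (Fin N) ℂ)
    (x : Space d) : ℝ :=
  Real.sqrt (∑ j, ‖fderiv ℝ V x (stdVec j)‖ ^ 2)

/-- The function `-i α·∇_A ψ + m β ψ + V ψ`. -/
noncomputable def diracExpr {d N : ℕ} (α : Fin d → Matrix (Fin N) (Fin N) ℂ)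
    (β : Matrix (Fin N) (Fin N) ℂ) (m : ℝ) (A : Space d → Space d)
    (V : Space d → Matrix (Fin N) (Fin N) ℂ) (ψ : SobolevH1 d N) (x : Space d) : Spinor N :=
  -Complex.I • ∑ j, matAct (α j) (magPartial A ψ j x)
    + (m : ℂ) • matAct β ((ψ : SpinorL2 d N) x) + matAct (V x) ((ψ : SpinorL2 d N) x)

theorem diracExpr_add {d N : ℕ} (α : Fin d → Matrix (Fin N) (Fin N) ℂ)
    (β : Matrix (Fin N) (Fin N) ℂ) (m : ℝ) (A : Space d → Space d)
    (V : Space d → Matrix (Fin N) (Fin N) ℂ) (ψ₁ ψ₂ : SobolevH1 d N) :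
    diracExpr α β m A V (ψ₁ + ψ₂) =ᵐ[volume]
      diracExpr α β m A V ψ₁ + diracExpr α β m A V ψ₂ := by
  have h : ∀ᵐ x, ∀ j : Fin d, weakPartial j (ψ₁ + ψ₂) x
      = weakPartial j ψ₁ x + weakPartial j ψ₂ x := by
    rw [ae_all_iff]
    intro j
    rw [map_add]
    exact Lp.coeFn_add _ _
  filter_upwards [h, Lp.coeFn_add (ψ₁ : SpinorL2 d N) ψ₂] with x hx h0
  have hm : ∀ j, magPartial A (ψ₁ + ψ₂) j x = magPartial A ψ₁ j x + magPartial A ψ₂ j x := by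
    intro j
    simp only [magPartial, hx j, Submodule.coe_add, h0, Pi.add_apply, smul_add]
    abel
  simp only [diracExpr, Pi.add_apply, hm, Submodule.coe_add, h0, map_add, smul_add,
    Finset.sum_add_distrib]
  abel

theorem diracExpr_smul {d N : ℕ} (α : Fin d → Matrix (Fin N) (Fin N) ℂ)
    (β : Matrix (Fin N) (Fin N) ℂ) (m : ℝ) (A : Space d → Space d)
    (V : Space d → Matrix (Fin N) (Fin N) ℂ) (c : ℂ) (ψ : SobolevH1 d N) :
    diracExpr α β m A V (c • ψ) =ᵐ[volume] c • diracExpr α β m A V ψ := by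
  have h : ∀ᵐ x, ∀ j : Fin d, weakPartial j (c • ψ) x = c • weakPartial j ψ x := by
    rw [ae_all_iff]
    intro j
    rw [map_smul]
    exact Lp.coeFn_smul _ _
  filter_upwards [h, Lp.coeFn_smul c (ψ : SpinorL2 d N)] with x hx h0
  have hm : ∀ j, magPartial A (c • ψ) j x = c • magPartial A ψ j x := by
    intro j
    simp only [magPartial, hx j, Submodule.coe_smul, h0, Pi.smul_apply, smul_sub]
    rw [smul_comm c]
  simp only [diracExpr, Pi.smul_apply, hm, Submodule.coe_smul, h0, map_smul, smul_add,
    ← Finset.smul_sum]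
  rw [smul_comm c, smul_comm c]

/-- The spinors `ψ ∈ H¹` for which `-i α·∇_A ψ + m β ψ + V ψ` is square integrable. -/
def diracDomain {d N : ℕ} (α : Fin d → Matrix (Fin N) (Fin N) ℂ)
    (β : Matrix (Fin N) (Fin N) ℂ) (m : ℝ) (A : Space d → Space d)
    (V : Space d → Matrix (Fin N) (Fin N) ℂ) : Submodule ℂ (SpinorL2 d N) where
  carrier := {ψ | ∃ h : ψ ∈ SobolevH1 d N, MemLp (diracExpr α β m A V ⟨ψ, h⟩) 2 volume}
  add_mem' := by
    rintro ψ₁ ψ₂ ⟨h₁, m₁⟩ ⟨h₂, m₂⟩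
    exact ⟨add_mem h₁ h₂, (m₁.add m₂).ae_eq (diracExpr_add α β m A V ⟨ψ₁, h₁⟩ ⟨ψ₂, h₂⟩).symm⟩
  zero_mem' := by
    refine ⟨zero_mem _, ?_⟩
    have h := diracExpr_smul α β m A V 0 (0 : SobolevH1 d N)
    rw [zero_smul, zero_smul] at h
    exact MemLp.ae_eq h.symm MemLp.zero
  smul_mem' := by
    rintro c ψ ⟨h, hm⟩
    exact ⟨(SobolevH1 d N).smul_mem c h,
      (hm.const_smul c).ae_eq (diracExpr_smul α β m A V c ⟨ψ, h⟩).symm⟩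

/-- The electromagnetic Dirac operator `H_m(A, V) = -i α·∇_A + m β + V` in `L²(ℝ^d; ℂ^N)`, acting
on the spinors `ψ ∈ H¹` for which `-i α·∇_A ψ + m β ψ + V ψ` is square integrable. -/
noncomputable def diracOp {d N : ℕ} (α : Fin d → Matrix (Fin N) (Fin N) ℂ)
    (β : Matrix (Fin N) (Fin N) ℂ) (m : ℝ) (A : Space d → Space d)
    (V : Space d → Matrix (Fin N) (Fin N) ℂ) : SpinorL2 d N →ₗ.[ℂ] SpinorL2 d N where
  domain := diracDomain α β m A V
  toFun :=
    { toFun := fun ψ => MemLp.toLp (diracExpr α β m A V ⟨ψ.1, ψ.2.1⟩) ψ.2.2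
      map_add' := fun ψ₁ ψ₂ =>
        (MemLp.toLp_congr _ (ψ₁.2.2.add ψ₂.2.2)
          (diracExpr_add α β m A V ⟨ψ₁.1, ψ₁.2.1⟩ ⟨ψ₂.1, ψ₂.2.1⟩)).trans
          (MemLp.toLp_add ψ₁.2.2 ψ₂.2.2)
      map_smul' := fun c ψ =>
        (MemLp.toLp_congr _ (ψ.2.2.const_smul c)
          (diracExpr_smul α β m A V c ⟨ψ.1, ψ.2.1⟩)).trans
          (MemLp.toLp_const_smul c ψ.2.2) }

/-- `V` is relatively bounded with respect to `H_m(A)`, with relative bound less than one: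
`‖Vψ‖² ≤ a ‖H_m(A)ψ‖² + b ‖ψ‖²` for all `ψ ∈ H¹`, with constants `0 < a < 1` and `b > 0`. -/
def IsDiracBounded {d N : ℕ} (α : Fin d → Matrix (Fin N) (Fin N) ℂ)
    (β : Matrix (Fin N) (Fin N) ℂ) (m : ℝ) (A : Space d → Space d)
    (V : Space d → Matrix (Fin N) (Fin N) ℂ) : Prop :=
  ∃ a b : ℝ, 0 < a ∧ a < 1 ∧ 0 < b ∧ ∀ ψ : SobolevH1 d N,
    ∫⁻ x, ‖matAct (V x) ((ψ : SpinorL2 d N) x)‖ₑ ^ 2 ≤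
      ENNReal.ofReal a * ∫⁻ x, ‖diracExpr α β m A (fun _ => 0) ψ x‖ₑ ^ 2
        + ENNReal.ofReal b * ∫⁻ x, ‖(ψ : SpinorL2 d N) x‖ₑ ^ 2

/-- The point spectrum of an operator: the set of its eigenvalues. -/
def pointSpectrum {E : Type*} [AddCommGroup E] [Module ℂ E] (T : E →ₗ.[ℂ] E) : Set ℂ :=
  {μ | ∃ ψ : T.domain, (ψ : E) ≠ 0 ∧ T ψ = μ • (ψ : E)}

/-! ### Mollification in `L²` -/

section Mollify

open Topology Convolution

/-! The proof is a virial argument. Let `ψ ≠ 0` be an eigenfunction with eigenvalue `E`, which is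
real by symmetry, and put `p = α·∇_A ψ`, `w = βψ`, `u = Vψ`, `v = (x - x₀)·∇V ψ`, `b = α·(Bᵀ(x -
x₀))ψ`, `G = ‖∇_A ψ‖`. Dilation about `x₀` gives the virial identity `⟨ψ, v⟩ = ⟨ψ, b⟩ + ⟨ψ, -ip⟩`.
Multiplying by `E` and inserting `Eψ = -ip + mw + u` in each pairing, where anticommutation with `β`
removes `Re⟨w, -ip⟩` and `Re⟨w, b⟩`, leads to (`energy_estimate`) `‖p‖² ≤ ‖v‖‖p‖ + ‖u‖‖v‖ + m Re⟨w,
v⟩ + Re(-i⟨p, b⟩) + ‖u‖‖b‖ + ‖u‖‖p‖`.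

Every term on the right is controlled by `G`: `v`, `b` and the mass term by assumption, and `u`
through `|V| ≤ ε₃/|x - x₀|` and the magnetic Hardy inequality `‖ψ/|x - x₀|‖ ≤ 2/(d-2) G`. The left
side is compared with `G` through the square of the Dirac operator, `‖p‖² = G² + s`, where `s` is
the coupling of the spin to `B` (`integral_inner_cliffordGrad`). If `‖p‖ ≥ G`, the energy estimate
alone contradicts the smallness condition. If `‖p‖ < G`, then `-s + Re(-i⟨p, b⟩)` has to be bounded
with the sharp constant `2 + 1/(d-2)` in front of `ε₁G²`.

That constant is the content of `IsCliffordFamily.spin_estimate`. The spin coupling is a Clifford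
contraction of the skew matrix `B`, bounded by the rank of `B` times `|B|`. In odd dimension the
rank is at most `d - 1`, which is enough. In even dimension the rank may be `d`; the part of `B`
involving the radial direction is therefore split off, leaving rank at most `d - 2`. The radial part
is a pairing of `b` with `α·x̂ ψ/|x - x₀|` and is absorbed in `⟨p, b⟩`. The combined vector is short
exactly when the Hardy inequality is nearly saturated, because then `p` is close to `-(d-2)/2 α·x̂
ψ/|x - x₀|`.

As for regularity, the domain assumption forces `Aψ ∈ L²` for every `ψ ∈ H¹`. By the closed graph
theorem (`H1Tendsto.mul`) multiplication by `A` is then continuous from `H¹` to `L²`, so identities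
proved for mollified spinors extend to `H¹`. Commutators of the magnetic derivatives occur only as
quadratic forms, so no second derivatives of the eigenfunction are needed. The point `x₀` and
infinity are removed by cutoffs with gradient at most `C/|x - x₀|`, whose errors are dominated by
means of Hardy's inequality. -/

theorem lintegral_enorm_sq_eq {X E : Type*} [NormedAddCommGroup E] [MeasurableSpace X]
    {μ : Measure X} (f : X → E) :
    ∫⁻ x, ‖f x‖ₑ ^ 2 ∂μ = eLpNorm f 2 μ ^ 2 := by
  have h := eLpNorm_nnreal_pow_eq_lintegral (f := f) (μ := μ) (p := 2) (by norm_num)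
  have e2 : ((2 : NNReal) : ℝ) = (2 : ℕ) := by norm_num
  rw [e2] at h
  simp only [ENNReal.rpow_natCast] at h
  exact h.symm

variable {d : ℕ} {F : Type*} [NormedAddCommGroup F]

/-- Translations act continuously on `L²`; here the action is the one of `DomAddAct`, examined at
the origin. -/
theorem exists_translate_sub_le (f : Lp F 2 (volume : Measure (Space d))) {ε : ℝ≥0∞} (hε : 0 < ε) :
    ∃ δ > 0, ∀ y : Space d, ‖y‖ < δ → eLpNorm (fun x => f (x - y) - f x) 2 volume ≤ ε := by
  have : Fact ((2 : ℝ≥0∞) ≠ ⊤) := ⟨by norm_num⟩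
  have hc : Continuous fun c : (Space d)ᵈᵃᵃ => c +ᵥ f := continuous_id.vadd continuous_const
  have hc' : Continuous fun y : Space d => DomAddAct.mk (-y) +ᵥ f :=
    hc.comp ((DomAddAct.mkHomeomorph (M := Space d)).continuous.comp continuous_neg)
  have h0 : (DomAddAct.mk (-(0 : Space d)) +ᵥ f) = f := by
    rw [neg_zero]; exact zero_vadd _ f
  have ht := hc'.tendsto 0
  rw [h0] at ht
  have := (EMetric.tendsto_nhds.1 ht) ε hε
  obtain ⟨δ, hδ, hδ'⟩ := Metric.eventually_nhds_iff.1 this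
  refine ⟨δ, hδ, fun y hy => ?_⟩
  have h1 := (hδ' (y := y) (by simpa using hy)).le
  rw [Lp.edist_def] at h1
  refine (eLpNorm_congr_ae ?_).trans_le h1
  filter_upwards [DomAddAct.vadd_Lp_ae_eq (DomAddAct.mk (-y)) f] with x hx
  rw [Pi.sub_apply, hx]
  simp [sub_eq_neg_add]

variable [NormedSpace ℝ F]

/-- A normalised bump is a probability density, so the convolution minus `f` is an average of the
differences `f (x - y) - f x`. Comparing the `L¹` and `L²` norms for this probability measure and
exchanging the integrals reduces the bound to single translations. -/
theorem eLpNorm_mollify_sub_le [CompleteSpace F] (f : Lp F 2 (volume : Measure (Space d)))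
    (ρ : ContDiffBump (0 : Space d)) {ε : ℝ≥0∞}
    (h : ∀ y : Space d, ‖y‖ < ρ.rOut → eLpNorm (fun x => f (x - y) - f x) 2 volume ≤ ε) :
    eLpNorm (fun x => (ρ.normed volume ⋆[ContinuousLinearMap.lsmul ℝ ℝ, volume] f) x - f x) 2
      volume ≤ ε := by
  set w : Space d → NNReal := fun y => (ρ.normed volume y).toNNReal with hw
  have hwm : Measurable w := ρ.continuous_normed.measurable.real_toNNReal
  have hwr : ∀ y, (w y : ℝ) = ρ.normed volume y := fun y =>
    Real.coe_toNNReal _ (ρ.nonneg_normed y)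
  set ν : Measure (Space d) := volume.withDensity (fun y => (w y : ℝ≥0∞)) with hν
  have hprob : IsProbabilityMeasure ν := by
    constructor
    rw [hν, withDensity_apply _ MeasurableSet.univ, Measure.restrict_univ]
    have := ρ.integral_normed (μ := volume)
    have h2 : ∫⁻ y, ENNReal.ofReal (ρ.normed volume y) = 1 := by
      rw [← ofReal_integral_eq_lintegral_ofReal ρ.integrable_normed
        (Eventually.of_forall fun y => ρ.nonneg_normed y), this]; simp
    exact h2
  have hint : LocallyIntegrable (f : Space d → F) volume :=
    (Lp.memLp f).locallyIntegrable (by norm_num)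
  have hex : ∀ x, ConvolutionExistsAt (ρ.normed volume) f x (ContinuousLinearMap.lsmul ℝ ℝ)
      volume := fun x =>
    ρ.hasCompactSupport_normed.convolutionExists_left _ ρ.continuous_normed hint x
  have hfm : StronglyMeasurable (f : Space d → F) := Lp.stronglyMeasurable f
  have key : ∀ x, ‖(ρ.normed volume ⋆[ContinuousLinearMap.lsmul ℝ ℝ, volume] f) x - f x‖ₑ ^ 2
      ≤ ∫⁻ y, ‖f (x - y) - f x‖ₑ ^ 2 ∂ν := by
    intro x
    have e1 : (ρ.normed volume ⋆[ContinuousLinearMap.lsmul ℝ ℝ, volume] f) x - f x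
        = ∫ y, (f (x - y) - f x) ∂ν := by
      rw [hν, integral_withDensity_eq_integral_smul hwm]
      have e2 : ∀ y, w y • (f (x - y) - f x)
          = ρ.normed volume y • f (x - y) - ρ.normed volume y • f x := by
        intro y
        rw [← smul_sub, ← hwr y]; rfl
      simp_rw [e2]
      have e3 : Integrable fun y => ρ.normed volume y • f (x - y) := (hex x).integrable
      rw [integral_sub e3 (ρ.integrable_normed.smul_const _),
        integral_smul_const, ρ.integral_normed, one_smul]
      rfl
    have hm : AEStronglyMeasurable (fun y => f (x - y) - f x) ν :=
      ((hfm.comp_measurable (measurable_const.sub measurable_id)).sub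
        stronglyMeasurable_const).aestronglyMeasurable
    rw [e1, lintegral_enorm_sq_eq]
    gcongr
    calc ‖∫ y, (f (x - y) - f x) ∂ν‖ₑ ≤ ∫⁻ y, ‖f (x - y) - f x‖ₑ ∂ν :=
          enorm_integral_le_lintegral_enorm _
      _ = eLpNorm (fun y => f (x - y) - f x) 1 ν := by rw [eLpNorm_one_eq_lintegral_enorm]
      _ ≤ _ := eLpNorm_le_eLpNorm_of_exponent_le (by norm_num) hm
  have hfin : eLpNorm (fun x => (ρ.normed volume ⋆[ContinuousLinearMap.lsmul ℝ ℝ, volume] f) x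
      - f x) 2 volume ^ 2 ≤ ε ^ 2 := by
    rw [← lintegral_enorm_sq_eq]
    refine (lintegral_mono key).trans ?_
    rw [lintegral_lintegral_swap]
    · have hsupp : ∀ᵐ y ∂ν, ‖y‖ < ρ.rOut := by
        rw [hν, ae_withDensity_iff hwm.coe_nnreal_ennreal]
        refine Eventually.of_forall fun y hy => ?_
        by_contra hcon
        apply hy
        have : y ∉ Function.support (ρ.normed volume) := by
          rw [ρ.support_normed_eq]; simpa using hcon
        rw [Function.notMem_support] at this
        simp [hw, this]
      calc ∫⁻ y, (∫⁻ x, ‖f (x - y) - f x‖ₑ ^ 2 ∂volume) ∂ν ≤ ∫⁻ _, ε ^ 2 ∂ν := by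
            refine lintegral_mono_ae ?_
            filter_upwards [hsupp] with y hy
            rw [lintegral_enorm_sq_eq]
            gcongr
            exact h y hy
        _ = ε ^ 2 := by simp
    · refine Measurable.aemeasurable ?_
      have h1 : StronglyMeasurable fun p : Space d × Space d => f (p.1 - p.2) - f p.1 :=
        (hfm.comp_measurable (measurable_fst.sub measurable_snd)).sub
          (hfm.comp_measurable measurable_fst)
      exact h1.enorm.pow_const 2
  exact (ENNReal.pow_le_pow_left_iff two_ne_zero).1 hfin

/-- A sequence of mollifiers shrinking to the origin. -/
noncomputable def mollifier (d n : ℕ) : ContDiffBump (0 : Space d) where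
  rIn := 1 / (2 * ((n : ℝ) + 1))
  rOut := 1 / ((n : ℝ) + 1)
  rIn_pos := by positivity
  rIn_lt_rOut := by
    apply one_div_lt_one_div_of_lt <;> nlinarith [(Nat.cast_nonneg n : (0 : ℝ) ≤ n)]

/-- The mollification of an `L²` function. -/
noncomputable def mollify (n : ℕ) (f : Lp F 2 (volume : Measure (Space d))) : Space d → F :=
  (mollifier d n).normed volume ⋆[ContinuousLinearMap.lsmul ℝ ℝ, volume] f

theorem tendsto_mollify [CompleteSpace F] (f : Lp F 2 (volume : Measure (Space d))) :
    Tendsto (fun n => eLpNorm (fun x => mollify n f x - f x) 2 volume) atTop (𝓝 0) := by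
  rw [ENNReal.tendsto_nhds_zero]
  intro ε hε
  obtain ⟨δ, hδ, h⟩ := exists_translate_sub_le f hε
  have h1 : Tendsto (fun n : ℕ => 1 / ((n : ℝ) + 1)) atTop (𝓝 0) :=
    tendsto_one_div_add_atTop_nhds_zero_nat
  filter_upwards [h1.eventually_lt_const hδ] with n hn
  exact eLpNorm_mollify_sub_le f _ fun y hy => h y (hy.trans hn)

theorem contDiff_mollify (n : ℕ) (f : Lp F 2 (volume : Measure (Space d))) :
    ContDiff ℝ ∞ (mollify n f) := by
  have hint : LocallyIntegrable (f : Space d → F) volume :=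
    (Lp.memLp f).locallyIntegrable (by norm_num)
  exact (mollifier d n).hasCompactSupport_normed.contDiff_convolution_left _
    (mollifier d n).contDiff_normed hint

theorem memLp_mollify [CompleteSpace F] (n : ℕ) (f : Lp F 2 (volume : Measure (Space d))) :
    MemLp (mollify n f) 2 volume := by
  have hm : AEStronglyMeasurable (mollify n f) volume :=
    (contDiff_mollify n f).continuous.aestronglyMeasurable
  have h1 : MemLp (fun x => mollify n f x - f x) 2 volume := by
    refine ⟨hm.sub (Lp.aestronglyMeasurable f), ?_⟩
    -- The crude bound valid for every translation already suffices for membership in `L²`.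
    have hb : ∀ y : Space d, eLpNorm (fun x => f (x - y) - f x) 2 volume
        ≤ 2 * eLpNorm f 2 volume := by
      intro y
      have hmp : MeasurePreserving (fun x : Space d => x - y) volume volume :=
        measurePreserving_sub_right volume y
      have := eLpNorm_sub_le (μ := volume) (p := 2)
        ((Lp.memLp f).comp_measurePreserving hmp).1 (Lp.memLp f).1 (by norm_num)
      rw [eLpNorm_comp_measurePreserving (Lp.memLp f).1 hmp, ← two_mul] at this
      exact this
    refine (eLpNorm_mollify_sub_le f _ fun y _ => hb y).trans_lt ?_
    exact ENNReal.mul_lt_top (by simp) (Lp.memLp f).2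
  have := h1.add (Lp.memLp f)
  refine this.ae_eq (Eventually.of_forall fun x => ?_)
  simp

end Mollify

/-! ### Density of smooth functions in `H¹` -/

section Density

open Topology Convolution

variable {d N : ℕ}

/-- The derivative falls on the kernel, and `t ↦ ρ (x - t)` is an admissible test function; the sign
from the reflection cancels the sign in the weak derivative. -/
theorem fderiv_mollify {j : Fin d} {ψ g : SpinorL2 d N} (h : HasWeakPartial j ψ g) (n : ℕ)
    (x : Space d) : fderiv ℝ (mollify n ψ) x (stdVec j) = mollify n g x := by
  set ρ := mollifier d n
  have hint : LocallyIntegrable (ψ : Space d → Spinor N) volume :=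
    (Lp.memLp ψ).locallyIntegrable (by norm_num)
  have hρ1 : ContDiff ℝ 1 (ρ.normed volume) := ρ.contDiff_normed
  have hd := ρ.hasCompactSupport_normed.hasFDerivAt_convolution_left
    (ContinuousLinearMap.lsmul ℝ ℝ) (μ := volume) hρ1 hint x
  have hρ : ContDiff ℝ ∞ (ρ.normed volume) := ρ.contDiff_normed
  have e1 : fderiv ℝ (mollify n ψ) x (stdVec j)
      = ∫ t, fderiv ℝ (ρ.normed volume) (x - t) (stdVec j) • ψ t := by
    unfold mollify
    have hex := (ρ.hasCompactSupport_normed (μ := volume)).fderiv (𝕜 := ℝ)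
      |>.convolutionExists_left ((ContinuousLinearMap.lsmul ℝ ℝ).precompL (Space d))
        (hρ1.continuous_fderiv one_ne_zero) hint x
    rw [hd.fderiv, convolution_eq_swap, ContinuousLinearMap.integral_apply hex.integrable_swap]
    rfl
  have e2 : mollify n g x = ∫ t, ρ.normed volume (x - t) • g t := by
    unfold mollify
    rw [convolution_lsmul_swap]
  have hc : HasCompactSupport fun t => ρ.normed volume (x - t) :=
    ρ.hasCompactSupport_normed.comp_homeomorph (Homeomorph.subLeft x)
  have h1 := h (fun t => ρ.normed volume (x - t)) (hρ.comp (contDiff_const.sub contDiff_id)) hc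
  rw [e1, e2, h1, ← integral_neg]
  refine integral_congr_ae (Eventually.of_forall fun t => ?_)
  have h3 : HasFDerivAt (fun t => ρ.normed volume (x - t))
      ((fderiv ℝ (ρ.normed volume) (x - t)).comp (-ContinuousLinearMap.id ℝ (Space d))) t :=
    ((hρ.differentiable (by simp)) (x - t)).hasFDerivAt.comp t ((hasFDerivAt_id t).const_sub x)
  simp [h3.fderiv]

/-- `ψ` has a smooth representative whose classical derivatives are its weak derivatives. -/
def HasSmoothRep (ψ : SobolevH1 d N) : Prop :=
  ∃ u : Space d → Spinor N, ContDiff ℝ ∞ u ∧ (ψ : SpinorL2 d N) =ᵐ[volume] u ∧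
    ∀ j, weakPartial j ψ =ᵐ[volume] fun x => fderiv ℝ u x (stdVec j)

/-- Convergence of a sequence in `H¹`. -/
def H1Tendsto (φ : ℕ → SobolevH1 d N) (ψ : SobolevH1 d N) : Prop :=
  Tendsto (fun n => (φ n : SpinorL2 d N)) atTop (𝓝 (ψ : SpinorL2 d N)) ∧
    ∀ j, Tendsto (fun n => weakPartial j (φ n)) atTop (𝓝 (weakPartial j ψ))

theorem hasWeakPartial_mollify {j : Fin d} {ψ g : SpinorL2 d N} (h : HasWeakPartial j ψ g)
    (n : ℕ) : HasWeakPartial j ((memLp_mollify n ψ).toLp _) ((memLp_mollify n g).toLp _) := by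
  intro φ hφ hc
  have e1 : ∫ x, φ x • ((memLp_mollify n g).toLp _ : SpinorL2 d N) x
      = ∫ x, φ x • fderiv ℝ (mollify n ψ) x (stdVec j) := by
    refine integral_congr_ae ?_
    filter_upwards [(memLp_mollify n g).coeFn_toLp] with x hx
    rw [hx, fderiv_mollify h]
  have e2 : ∫ x, fderiv ℝ φ x (stdVec j) • ((memLp_mollify n ψ).toLp _ : SpinorL2 d N) x
      = ∫ x, fderiv ℝ φ x (stdVec j) • mollify n ψ x := by
    refine integral_congr_ae ?_
    filter_upwards [(memLp_mollify n ψ).coeFn_toLp] with x hx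
    rw [hx]
  have hs := contDiff_mollify n ψ
  have hs' : Continuous fun x => fderiv ℝ (mollify n ψ) x (stdVec j) :=
    (hs.continuous_fderiv (by simp)).clm_apply continuous_const
  rw [e1, e2]
  refine integral_smul_fderiv_eq_neg_fderiv_smul_of_integrable ?_ ?_ ?_ ?_ ?_
  · exact ((continuous_partial j hφ).smul hs.continuous).integrable_of_hasCompactSupport
      ((hc.fderiv_apply (𝕜 := ℝ) (stdVec j)).smul_right)
  · exact (hφ.continuous.smul hs').integrable_of_hasCompactSupport hc.smul_right
  · exact (hφ.continuous.smul hs.continuous).integrable_of_hasCompactSupport hc.smul_right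
  · exact fun x _ => (hφ.differentiable (by simp)) x
  · exact fun x _ => (hs.differentiable (by simp)) x

theorem tendsto_toLp_mollify (f : SpinorL2 d N) :
    Tendsto (fun n => (memLp_mollify n f).toLp (mollify n f)) atTop (𝓝 f) := by
  rw [Lp.tendsto_Lp_iff_tendsto_eLpNorm']
  refine (tendsto_mollify f).congr fun n => eLpNorm_congr_ae ?_
  filter_upwards [(memLp_mollify n f).coeFn_toLp] with x hx
  rw [Pi.sub_apply, hx]

/-- The mollification of an element of `H¹`. -/
noncomputable def mollifyH1 (n : ℕ) (ψ : SobolevH1 d N) : SobolevH1 d N :=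
  ⟨(memLp_mollify n (ψ : SpinorL2 d N)).toLp _,
    fun j => ⟨_, hasWeakPartial_mollify (weakPartial_spec j ψ) n⟩⟩

theorem weakPartial_mollifyH1 (n : ℕ) (ψ : SobolevH1 d N) (j : Fin d) :
    weakPartial j (mollifyH1 n ψ) = (memLp_mollify n (weakPartial j ψ)).toLp _ :=
  (weakPartial_spec j (mollifyH1 n ψ)).unique (hasWeakPartial_mollify (weakPartial_spec j ψ) n)

/-- Mollification commutes with weak derivatives, so a single mollified sequence converges together
with all its partial derivatives. -/
theorem exists_smooth_h1Tendsto (ψ : SobolevH1 d N) :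
    ∃ φ : ℕ → SobolevH1 d N, (∀ n, HasSmoothRep (φ n)) ∧ H1Tendsto φ ψ := by
  refine ⟨fun n => mollifyH1 n ψ, fun n => ⟨mollify n (ψ : SpinorL2 d N), contDiff_mollify _ _,
    (memLp_mollify n (ψ : SpinorL2 d N)).coeFn_toLp, fun j => ?_⟩, tendsto_toLp_mollify _,
    fun j => ?_⟩
  · rw [weakPartial_mollifyH1]
    filter_upwards [(memLp_mollify n (weakPartial j ψ)).coeFn_toLp] with x hx
    rw [hx, fderiv_mollify (weakPartial_spec j ψ)]
  · simp_rw [weakPartial_mollifyH1]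
    exact tendsto_toLp_mollify _

end Density

/-! ### Convergence in `L²` and multiplication operators -/

section L2

open Topology

variable {d N : ℕ}

/-- Convergence in `L²` of functions. -/
structure L2Tendsto (f : ℕ → Space d → Spinor N) (f₀ : Space d → Spinor N) : Prop where
  memLp : ∀ n, MemLp (f n) 2 volume
  memLp_lim : MemLp f₀ 2 volume
  tendsto : Tendsto (fun n => eLpNorm (fun x => f n x - f₀ x) 2 volume) atTop (𝓝 0)

theorem L2Tendsto.of_lp {f : ℕ → SpinorL2 d N} {f₀ : SpinorL2 d N}
    (h : Tendsto f atTop (𝓝 f₀)) : L2Tendsto (fun n => f n) f₀ where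
  memLp _ := Lp.memLp _
  memLp_lim := Lp.memLp _
  tendsto := (Lp.tendsto_Lp_iff_tendsto_eLpNorm' _ _).1 h

theorem L2Tendsto.tendsto_toLp {f : ℕ → Space d → Spinor N} {f₀ : Space d → Spinor N}
    (h : L2Tendsto f f₀) :
    Tendsto (fun n => (h.memLp n).toLp (f n)) atTop (𝓝 (h.memLp_lim.toLp f₀)) := by
  rw [Lp.tendsto_Lp_iff_tendsto_eLpNorm']
  refine h.tendsto.congr fun n => eLpNorm_congr_ae ?_
  filter_upwards [(h.memLp n).coeFn_toLp, h.memLp_lim.coeFn_toLp] with x hx hx'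
  rw [Pi.sub_apply, hx, hx']

theorem L2Tendsto.congr {f g : ℕ → Space d → Spinor N} {f₀ g₀ : Space d → Spinor N}
    (h : L2Tendsto f f₀) (hf : ∀ n, f n =ᵐ[volume] g n) (hf₀ : f₀ =ᵐ[volume] g₀) :
    L2Tendsto g g₀ where
  memLp n := (h.memLp n).ae_eq (hf n)
  memLp_lim := h.memLp_lim.ae_eq hf₀
  tendsto := h.tendsto.congr fun n => eLpNorm_congr_ae <| by
    filter_upwards [hf n, hf₀] with x hx hx'
    rw [hx, hx']

theorem L2Tendsto.add {f g : ℕ → Space d → Spinor N} {f₀ g₀ : Space d → Spinor N}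
    (hf : L2Tendsto f f₀) (hg : L2Tendsto g g₀) :
    L2Tendsto (fun n x => f n x + g n x) (fun x => f₀ x + g₀ x) where
  memLp n := (hf.memLp n).add (hg.memLp n)
  memLp_lim := hf.memLp_lim.add hg.memLp_lim
  tendsto := by
    refine tendsto_of_tendsto_of_tendsto_of_le_of_le tendsto_const_nhds
      (by simpa using hf.tendsto.add hg.tendsto) (fun _ => zero_le) fun n => ?_
    refine le_trans (le_of_eq (eLpNorm_congr_ae (Eventually.of_forall fun x => ?_)))
      (eLpNorm_add_le ((hf.memLp n).sub hf.memLp_lim).1 ((hg.memLp n).sub hg.memLp_lim).1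
        (by norm_num))
    simp only [Pi.add_apply]
    abel

/-- A bounded measurable field of operators on the spinors. -/
structure IsBddField (K : Space d → Spinor N →L[ℂ] Spinor N) : Prop where
  aesm : AEStronglyMeasurable K volume
  bdd : ∃ C : ℝ, ∀ x, ‖K x‖ ≤ C

theorem IsBddField.const (S : Spinor N →L[ℂ] Spinor N) :
    IsBddField (fun _ : Space d => S) :=
  ⟨aestronglyMeasurable_const, ‖S‖, fun _ => le_rfl⟩

theorem AEStronglyMeasurable.field_apply {K : Space d → Spinor N →L[ℂ] Spinor N}
    (hK : AEStronglyMeasurable K volume) {f : Space d → Spinor N}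
    (hf : AEStronglyMeasurable f volume) :
    AEStronglyMeasurable (fun x => K x (f x)) volume :=
  (ContinuousLinearMap.apply ℂ (Spinor N)).flip.aestronglyMeasurable_comp₂ hK hf

theorem IsBddField.memLp {K : Space d → Spinor N →L[ℂ] Spinor N} (hK : IsBddField K)
    {f : Space d → Spinor N} (hf : MemLp f 2 volume) : MemLp (fun x => K x (f x)) 2 volume := by
  obtain ⟨C, hC⟩ := hK.bdd
  refine hf.of_le_mul (c := C) (AEStronglyMeasurable.field_apply hK.aesm hf.1)
    (Eventually.of_forall fun x => ?_)
  exact (K x).le_of_opNorm_le (hC x) _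

theorem L2Tendsto.field {K : Space d → Spinor N →L[ℂ] Spinor N} (hK : IsBddField K)
    {f : ℕ → Space d → Spinor N} {f₀ : Space d → Spinor N}
    (h : L2Tendsto f f₀) : L2Tendsto (fun n x => K x (f n x)) (fun x => K x (f₀ x)) where
  memLp n := hK.memLp (h.memLp n)
  memLp_lim := hK.memLp h.memLp_lim
  tendsto := by
    obtain ⟨C, hC⟩ := hK.bdd
    have h0 : Tendsto (fun n => ENNReal.ofReal C * eLpNorm (fun x => f n x - f₀ x) 2 volume)
        atTop (𝓝 0) := by
      simpa using ENNReal.Tendsto.const_mul h.tendsto (Or.inr (by simp))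
    refine tendsto_of_tendsto_of_tendsto_of_le_of_le tendsto_const_nhds h0 (fun _ => zero_le)
      fun n => ?_
    refine eLpNorm_le_mul_eLpNorm_of_ae_le_mul (Eventually.of_forall fun x => ?_) 2
    rw [← map_sub]
    exact (K x).le_of_opNorm_le (hC x) _

theorem integral_inner_eq {f g : Space d → Spinor N} (hf : MemLp f 2 volume)
    (hg : MemLp g 2 volume) : ∫ x, inner ℂ (f x) (g x) = inner ℂ (hf.toLp f) (hg.toLp g) := by
  rw [L2.inner_def]
  refine integral_congr_ae ?_
  filter_upwards [hf.coeFn_toLp, hg.coeFn_toLp] with x hx hx'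
  rw [hx, hx']

theorem MemLp.integrable_spinor_inner {f g : Space d → Spinor N} (hf : MemLp f 2 volume)
    (hg : MemLp g 2 volume) : Integrable (fun x => inner ℂ (f x) (g x)) volume := by
  refine (L2.integrable_inner (𝕜 := ℂ) (hf.toLp f) (hg.toLp g)).congr ?_
  filter_upwards [hf.coeFn_toLp, hg.coeFn_toLp] with x hx hx'
  rw [hx, hx']

theorem L2Tendsto.integral_inner {f g : ℕ → Space d → Spinor N} {f₀ g₀ : Space d → Spinor N}
    (hf : L2Tendsto f f₀) (hg : L2Tendsto g g₀) :
    Tendsto (fun n => ∫ x, inner ℂ (f n x) (g n x)) atTop (𝓝 (∫ x, inner ℂ (f₀ x) (g₀ x))) := by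
  simp_rw [fun n => integral_inner_eq (hf.memLp n) (hg.memLp n),
    integral_inner_eq hf.memLp_lim hg.memLp_lim]
  exact hf.tendsto_toLp.inner hg.tendsto_toLp

/-! ### Multiplication operators on `H¹` -/

theorem continuous_integral_smul {φ : Space d → ℝ} (hφ : Continuous φ)
    (hc : HasCompactSupport φ) : Continuous fun g : SpinorL2 d N => ∫ x, φ x • g x := by
  have hm : MemLp φ 2 (volume : Measure (Space d)) := hφ.memLp_of_hasCompactSupport hc
  have h := ((ContinuousLinearMap.lsmul ℝ ℝ : ℝ →L[ℝ] Spinor N →L[ℝ] Spinor N).lpPairing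
    (volume : Measure (Space d)) 2 2 (hm.toLp φ)).continuous
  refine h.congr fun g => ?_
  rw [ContinuousLinearMap.lpPairing_eq_integral]
  refine integral_congr_ae ?_
  filter_upwards [hm.coeFn_toLp] with x hx
  rw [hx]; rfl

/-- The graph of the weak gradient, a closed subspace of `L² × (L²)^d`. -/
def gradGraph (d N : ℕ) : Submodule ℂ (SpinorL2 d N × (Fin d → SpinorL2 d N)) where
  carrier := {p | ∀ j, HasWeakPartial j p.1 (p.2 j)}
  add_mem' h₁ h₂ j := (h₁ j).add (h₂ j)
  zero_mem' j := HasWeakPartial.zero j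
  smul_mem' c _ h j := (h j).smul c

theorem isClosed_gradGraph : IsClosed (gradGraph d N : Set (SpinorL2 d N × (Fin d → SpinorL2 d N))) := by
  have : (gradGraph d N : Set (SpinorL2 d N × (Fin d → SpinorL2 d N)))
      = ⋂ j : Fin d, ⋂ φ : Space d → ℝ, ⋂ (_ : ContDiff ℝ ∞ φ), ⋂ (_ : HasCompactSupport φ),
        {p | ∫ x, φ x • p.2 j x = -∫ x, fderiv ℝ φ x (stdVec j) • p.1 x} := by
    ext p
    simp only [Set.mem_iInter]
    rfl
  rw [this]
  refine isClosed_iInter fun j => isClosed_iInter fun φ => isClosed_iInter fun hφ =>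
    isClosed_iInter fun hc => isClosed_eq ?_ ?_
  · exact (continuous_integral_smul hφ.continuous hc).comp
      ((continuous_apply j).comp continuous_snd)
  · exact ((continuous_integral_smul (continuous_partial j hφ)
      (hc.fderiv_apply (𝕜 := ℝ) (stdVec j))).comp continuous_fst).neg

/-- The element of `H¹` given by a point of the graph of the weak gradient. -/
def gradGraph.toH1 (p : gradGraph d N) : SobolevH1 d N := ⟨p.1.1, fun j => ⟨_, p.2 j⟩⟩

/-- Closed graph theorem: a multiplication operator defined on all of `H¹` with values in `L²` is
automatically continuous. The graph of the weak gradient serves as the complete model of `H¹`, since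
`SobolevH1` itself carries the `L²` norm. -/
theorem H1Tendsto.mul {c : Space d → ℂ}
    (hc : ∀ ψ : SobolevH1 d N, MemLp (fun x => c x • (ψ : SpinorL2 d N) x) 2 volume)
    {φ : ℕ → SobolevH1 d N} {ψ : SobolevH1 d N} (h : H1Tendsto φ ψ) :
    L2Tendsto (fun n x => c x • (φ n : SpinorL2 d N) x) (fun x => c x • (ψ : SpinorL2 d N) x) := by
  have : CompleteSpace (gradGraph d N) := isClosed_gradGraph.completeSpace_coe
  let T : gradGraph d N →ₗ[ℂ] SpinorL2 d N :=
    { toFun := fun p => (hc (gradGraph.toH1 p)).toLp _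
      map_add' := fun p q => by
        rw [← MemLp.toLp_add]
        refine MemLp.toLp_congr _ _ ?_
        filter_upwards [Lp.coeFn_add p.1.1 q.1.1] with x hx
        have : ((gradGraph.toH1 (p + q) : SobolevH1 d N) : SpinorL2 d N) x
          = p.1.1 x + q.1.1 x := hx
        rw [this, smul_add]; rfl
      map_smul' := fun a p => by
        rw [RingHom.id_apply, ← MemLp.toLp_const_smul]
        refine MemLp.toLp_congr _ _ ?_
        filter_upwards [Lp.coeFn_smul a p.1.1] with x hx
        have : ((gradGraph.toH1 (a • p) : SobolevH1 d N) : SpinorL2 d N) x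
          = a • p.1.1 x := hx
        rw [this, Pi.smul_apply, smul_comm]; rfl }
  have hT : Continuous T := by
    refine T.continuous_of_seq_closed_graph fun u p y hu hTu => ?_
    have hu1 : Tendsto (fun n => (u n).1.1) atTop (𝓝 p.1.1) :=
      (continuous_fst.comp continuous_subtype_val).tendsto p |>.comp hu
    -- Two successive subsequences make both the spinors and their images converge almost
    -- everywhere, which identifies the limit of the images pointwise.
    obtain ⟨ns, hns, hae⟩ := (tendstoInMeasure_of_tendsto_Lp hu1).exists_seq_tendsto_ae
    have hTu' := hTu.comp hns.tendsto_atTop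
    obtain ⟨ms, hms, hae'⟩ := (tendstoInMeasure_of_tendsto_Lp hTu').exists_seq_tendsto_ae
    have hco : ∀ᵐ x, ∀ n, T (u n) x = c x • (u n).1.1 x :=
      ae_all_iff.2 fun n => (hc (gradGraph.toH1 (u n))).coeFn_toLp
    refine Lp.ext ?_
    filter_upwards [hae, hae', hco, (hc (gradGraph.toH1 p)).coeFn_toLp] with x h1 h2 h3 h4
    have h5 : Tendsto (fun i => c x • (u (ns (ms i))).1.1 x) atTop (𝓝 (c x • p.1.1 x)) :=
      ((h1.comp hms.tendsto_atTop).const_smul (c x))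
    have h6 : Tendsto (fun i => c x • (u (ns (ms i))).1.1 x) atTop (𝓝 (y x)) :=
      h2.congr fun i => h3 _
    rw [tendsto_nhds_unique h6 h5]
    exact h4.symm
  let pt : SobolevH1 d N → gradGraph d N := fun ψ =>
    ⟨((ψ : SpinorL2 d N), fun j => weakPartial j ψ), fun j => weakPartial_spec j ψ⟩
  have hpt : Tendsto (fun n => pt (φ n)) atTop (𝓝 (pt ψ)) := by
    rw [tendsto_subtype_rng]
    exact h.1.prodMk_nhds (tendsto_pi_nhds.2 h.2)
  have := L2Tendsto.of_lp ((hT.tendsto _).comp hpt)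
  exact this.congr (fun n => (hc (φ n)).coeFn_toLp) (hc ψ).coeFn_toLp

end L2

/-! ### Integration by parts with the magnetic gradient -/

section Magnetic

open Topology

variable {d N : ℕ}

/-- Multiplication by the components of `A` maps `H¹` into `L²`. -/
def MulH1 (A : Space d → Space d) (N : ℕ) : Prop :=
  ∀ (ψ : SobolevH1 d N) (j : Fin d),
    MemLp (fun x => (A x j : ℂ) • (ψ : SpinorL2 d N) x) 2 volume

theorem MulH1.memLp_magPartial {A : Space d → Space d} (hA : MulH1 A N) (ψ : SobolevH1 d N)
    (j : Fin d) : MemLp (magPartial A ψ j) 2 volume := by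
  have h := (Lp.memLp (weakPartial j ψ)).sub ((hA ψ j).const_smul Complex.I)
  refine h.ae_eq (Eventually.of_forall fun x => ?_)
  simp [magPartial, mul_smul]

theorem H1Tendsto.magPartial {A : Space d → Space d} (hA : MulH1 A N)
    {φ : ℕ → SobolevH1 d N} {ψ : SobolevH1 d N} (h : H1Tendsto φ ψ) (j : Fin d) :
    L2Tendsto (fun n => magPartial A (φ n) j) (magPartial A ψ j) := by
  have h1 := L2Tendsto.of_lp (h.2 j)
  have h2 : L2Tendsto _ _ := (h.mul (c := fun x => (A x j : ℂ)) fun ψ => hA ψ j).field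
    (IsBddField.const (-Complex.I • ContinuousLinearMap.id ℂ (Spinor N)))
  refine (h1.add h2).congr (fun n => Eventually.of_forall fun x => ?_)
    (Eventually.of_forall fun x => ?_) <;>
  simp [_root_.magPartial, mul_smul, sub_eq_add_neg]

/-- Fields of operators that are `C¹` and bounded together with their derivatives. -/
structure IsBddC1Field (M : Space d → Spinor N →L[ℂ] Spinor N) : Prop where
  contDiff : ContDiff ℝ 1 M
  bdd : ∃ C : ℝ, ∀ x, ‖M x‖ ≤ C
  bdd_deriv : ∀ j : Fin d, ∃ C : ℝ, ∀ x, ‖fderiv ℝ M x (stdVec j)‖ ≤ C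

theorem IsBddC1Field.isBddField {M : Space d → Spinor N →L[ℂ] Spinor N} (h : IsBddC1Field M) :
    IsBddField M :=
  ⟨h.contDiff.continuous.aestronglyMeasurable, h.bdd⟩

theorem IsBddC1Field.isBddField_deriv {M : Space d → Spinor N →L[ℂ] Spinor N}
    (h : IsBddC1Field M) (j : Fin d) : IsBddField fun x => fderiv ℝ M x (stdVec j) :=
  ⟨((h.contDiff.continuous_fderiv one_ne_zero).clm_apply
    continuous_const).aestronglyMeasurable, h.bdd_deriv j⟩

theorem HasFDerivAt.field_apply {M : Space d → Spinor N →L[ℂ] Spinor N} {u : Space d → Spinor N}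
    {x : Space d} (hM : DifferentiableAt ℝ M x) (hu : DifferentiableAt ℝ u x) :
    ∃ L : Space d →L[ℝ] Spinor N, HasFDerivAt (fun x => M x (u x)) L x ∧
      ∀ v, L v = M x (fderiv ℝ u x v) + fderiv ℝ M x v (u x) := by
  have h1 : HasFDerivAt
      (fun x => ContinuousLinearMap.restrictScalarsL ℂ (Spinor N) (Spinor N) ℝ ℝ (M x)) _ x :=
    (ContinuousLinearMap.restrictScalarsL ℂ (Spinor N) (Spinor N) ℝ ℝ).hasFDerivAt.comp x
      hM.hasFDerivAt
  exact ⟨_, h1.clm_apply hu.hasFDerivAt, fun v => rfl⟩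

/-- Integration of `∂_j ⟨u, M u⟩`. All terms of the product rule are integrable because `M` and its
derivatives are bounded, so compact support is not needed. -/
theorem integral_inner_field_weakPartial_of_smooth {M : Space d → Spinor N →L[ℂ] Spinor N}
    (hM : IsBddC1Field M) {ψ : SobolevH1 d N} (hψ : HasSmoothRep ψ) (j : Fin d) :
    (∫ x, inner ℂ ((ψ : SpinorL2 d N) x) (M x (weakPartial j ψ x)))
      + ∫ x, inner ℂ (weakPartial j ψ x) (M x ((ψ : SpinorL2 d N) x))
    = -∫ x, inner ℂ ((ψ : SpinorL2 d N) x)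
        (fderiv ℝ M x (stdVec j) ((ψ : SpinorL2 d N) x)) := by
  obtain ⟨u, hu, e0, e1⟩ := hψ
  have m0 : MemLp u 2 volume := (Lp.memLp (ψ : SpinorL2 d N)).ae_eq e0
  have m1 : MemLp (fun x => fderiv ℝ u x (stdVec j)) 2 volume :=
    (Lp.memLp (weakPartial j ψ)).ae_eq (e1 j)
  have i1 := MemLp.integrable_spinor_inner m0 (hM.isBddField.memLp m1)
  have i2 := MemLp.integrable_spinor_inner m1 (hM.isBddField.memLp m0)
  have i3 := MemLp.integrable_spinor_inner m0 ((hM.isBddField_deriv j).memLp m0)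
  have i4 := MemLp.integrable_spinor_inner m0 (hM.isBddField.memLp m0)
  have t1 : ∫ x, inner ℂ ((ψ : SpinorL2 d N) x) (M x (weakPartial j ψ x))
      = ∫ x, inner ℂ (u x) (M x (fderiv ℝ u x (stdVec j))) := by
    refine integral_congr_ae ?_
    filter_upwards [e0, e1 j] with x h h'
    rw [h, h']
  have t2 : ∫ x, inner ℂ (weakPartial j ψ x) (M x ((ψ : SpinorL2 d N) x))
      = ∫ x, inner ℂ (fderiv ℝ u x (stdVec j)) (M x (u x)) := by
    refine integral_congr_ae ?_
    filter_upwards [e0, e1 j] with x h h'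
    rw [h, h']
  have t3 : ∫ x, inner ℂ ((ψ : SpinorL2 d N) x)
        (fderiv ℝ M x (stdVec j) ((ψ : SpinorL2 d N) x))
      = ∫ x, inner ℂ (u x) (fderiv ℝ M x (stdVec j) (u x)) := by
    refine integral_congr_ae ?_
    filter_upwards [e0] with x h
    rw [h]
  rw [t1, t2, t3]
  have hMd : ∀ x, DifferentiableAt ℝ M x := hM.contDiff.differentiable one_ne_zero
  have hud : ∀ x, DifferentiableAt ℝ u x := hu.differentiable (by simp)
  choose L hL hLv using fun x => HasFDerivAt.field_apply (hMd x) (hud x)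
  have hb : IsBoundedBilinearMap ℝ (fun p : Spinor N × Spinor N => inner ℂ p.1 p.2) :=
    isBoundedBilinearMap_inner
  have key := integral_bilinear_hasFDerivAt_right_eq_neg_left_of_integrable (μ := volume)
    (B := hb.toContinuousLinearMap) (f := u) (f' := fderiv ℝ u) (g := fun x => M x (u x))
    (g' := L) (v := stdVec j) i2 (by
      refine (i1.add i3).congr (Eventually.of_forall fun x => ?_)
      change _ = inner ℂ (u x) (L x (stdVec j))
      rw [hLv, inner_add_right]; rfl) i4
    (fun x _ => (hud x).hasFDerivAt) (fun x _ => hL x)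
  change ∫ x, inner ℂ (u x) (L x (stdVec j)) = -∫ x, inner ℂ (fderiv ℝ u x (stdVec j)) (M x (u x))
    at key
  simp_rw [hLv, inner_add_right] at key
  rw [integral_add i1 i3] at key
  linear_combination key

theorem integral_inner_field_weakPartial {M : Space d → Spinor N →L[ℂ] Spinor N}
    (hM : IsBddC1Field M) (ψ : SobolevH1 d N) (j : Fin d) :
    (∫ x, inner ℂ ((ψ : SpinorL2 d N) x) (M x (weakPartial j ψ x)))
      + ∫ x, inner ℂ (weakPartial j ψ x) (M x ((ψ : SpinorL2 d N) x))
    = -∫ x, inner ℂ ((ψ : SpinorL2 d N) x)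
        (fderiv ℝ M x (stdVec j) ((ψ : SpinorL2 d N) x)) := by
  obtain ⟨φ, hs, hφ⟩ := exists_smooth_h1Tendsto ψ
  have h0 := L2Tendsto.of_lp hφ.1
  have h1 := L2Tendsto.of_lp (hφ.2 j)
  refine tendsto_nhds_unique
    ((h0.integral_inner (h1.field hM.isBddField)).add
      (h1.integral_inner (h0.field hM.isBddField))) ?_
  refine (h0.integral_inner (h0.field (hM.isBddField_deriv j))).neg.congr fun n => ?_
  rw [integral_inner_field_weakPartial_of_smooth hM (hs n) j]

/-- Since `A_j` is real, the contributions of `-i A_j` to the two pairings cancel pointwise, and the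
formula is the one without magnetic field. -/
theorem integral_inner_field_magPartial {A : Space d → Space d} (hA : MulH1 A N)
    {M : Space d → Spinor N →L[ℂ] Spinor N}
    (hM : IsBddC1Field M) (ψ : SobolevH1 d N) (j : Fin d) :
    (∫ x, inner ℂ ((ψ : SpinorL2 d N) x) (M x (magPartial A ψ j x)))
      + ∫ x, inner ℂ (magPartial A ψ j x) (M x ((ψ : SpinorL2 d N) x))
    = -∫ x, inner ℂ ((ψ : SpinorL2 d N) x)
        (fderiv ℝ M x (stdVec j) ((ψ : SpinorL2 d N) x)) := by
  rw [← integral_inner_field_weakPartial hM]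
  have m0 := Lp.memLp (ψ : SpinorL2 d N)
  have m1 := Lp.memLp (weakPartial j ψ)
  have m2 := hA.memLp_magPartial ψ j
  rw [← integral_add (MemLp.integrable_spinor_inner m0 (hM.isBddField.memLp m2))
    (MemLp.integrable_spinor_inner m2 (hM.isBddField.memLp m0)),
    ← integral_add (MemLp.integrable_spinor_inner m0 (hM.isBddField.memLp m1))
    (MemLp.integrable_spinor_inner m1 (hM.isBddField.memLp m0))]
  refine integral_congr_ae (Eventually.of_forall fun x => ?_)
  simp only [magPartial, map_sub, map_smul, inner_sub_right, inner_sub_left, inner_smul_left,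
    inner_smul_right, map_mul, Complex.conj_I, Complex.conj_ofReal]
  ring

end Magnetic

/-! ### The commutator of the components of the magnetic gradient -/

section Commutator

open Topology

variable {d N : ℕ}

theorem MemL2Loc.locallyIntegrable {F : Type*} [NormedAddCommGroup F] {f : Space d → F}
    (hf : MemL2Loc f) : LocallyIntegrable f volume := by
  rw [locallyIntegrable_iff]
  intro K hK
  have : IsFiniteMeasure (volume.restrict K) := ⟨by
    rw [Measure.restrict_apply_univ]; exact hK.measure_lt_top⟩
  exact (hf K hK).integrable (by norm_num)

theorem MemL2Loc.locallyIntegrable_apply {A : Space d → Space d} (hA : MemL2Loc A) (j : Fin d) :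
    LocallyIntegrable (fun x => A x j) volume := by
  rw [locallyIntegrable_iff]
  intro K hK
  exact (EuclideanSpace.proj (𝕜 := ℝ) j).integrable_comp
    ((locallyIntegrable_iff.1 hA.locallyIntegrable) K hK)

/-- The `(j, k)` entry of a matrix, as a continuous linear map. -/
noncomputable def entryCLM (j k : Fin d) : Matrix (Fin d) (Fin d) ℝ →L[ℝ] ℝ :=
  (Matrix.entryLinearMap ℝ ℝ j k).toContinuousLinearMap

theorem MemL2Loc.locallyIntegrable_entry {B : Space d → Matrix (Fin d) (Fin d) ℝ}
    (hB : MemL2Loc B) (j k : Fin d) : LocallyIntegrable (fun x => B x j k) volume := by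
  rw [locallyIntegrable_iff]
  intro K hK
  exact (entryCLM j k).integrable_comp ((locallyIntegrable_iff.1 hB.locallyIntegrable) K hK)

/-- The definition of `B` tests with real functions; it is applied to the real and the imaginary
part of `Φ`. -/
theorem IsMagneticField.integral_complex {A : Space d → Space d} (hA : MemL2Loc A)
    {B : Space d → Matrix (Fin d) (Fin d) ℝ} (hB : MemL2Loc B) (hAB : IsMagneticField A B)
    (j k : Fin d) {Φ : Space d → ℂ} (hΦ : ContDiff ℝ ∞ Φ) (hc : HasCompactSupport Φ) :
    ∫ x, (B x j k : ℂ) * Φ x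
      = ∫ x, ((A x j : ℂ) * fderiv ℝ Φ x (stdVec k) - (A x k : ℂ) * fderiv ℝ Φ x (stdVec j)) := by
  have hd : ∀ i, Continuous fun x => fderiv ℝ Φ x (stdVec i) := fun i =>
    (hΦ.continuous_fderiv (by simp)).clm_apply continuous_const
  have hdc : ∀ i : Fin d, HasCompactSupport fun x => fderiv ℝ Φ x (stdVec i) := fun i =>
    hc.fderiv_apply (𝕜 := ℝ) (stdVec i)
  have iB : Integrable (fun x => (B x j k : ℂ) * Φ x) := by
    have := (hB.locallyIntegrable_entry j k).integrable_smul_right_of_hasCompactSupport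
      hΦ.continuous hc
    exact this.congr (Eventually.of_forall fun x => by simp)
  have iA : ∀ a b, Integrable (fun x => (A x a : ℂ) * fderiv ℝ Φ x (stdVec b)) := by
    intro a b
    have := (hA.locallyIntegrable_apply a).integrable_smul_right_of_hasCompactSupport
      (hd b) (hdc b)
    exact this.congr (Eventually.of_forall fun x => by simp)
  have hdiff : ∀ x, DifferentiableAt ℝ Φ x := hΦ.differentiable (by simp)
  have part : ∀ L : ℂ →L[ℝ] ℝ, (∀ (r : ℝ) z, L (r * z) = r * L z) →
      L (∫ x, (B x j k : ℂ) * Φ x) = L (∫ x, ((A x j : ℂ) * fderiv ℝ Φ x (stdVec k)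
        - (A x k : ℂ) * fderiv ℝ Φ x (stdVec j))) := by
    intro L hL
    have iA' : Integrable fun x => (A x j : ℂ) * fderiv ℝ Φ x (stdVec k)
        - (A x k : ℂ) * fderiv ℝ Φ x (stdVec j) := (iA j k).sub (iA k j)
    rw [← L.integral_comp_comm iB, ← L.integral_comp_comm iA']
    have := hAB j k (fun x => L (Φ x)) (L.contDiff.comp hΦ) (hc.comp_left (map_zero L))
    have e : ∀ x, fderiv ℝ (fun x => L (Φ x)) x = L.comp (fderiv ℝ Φ x) := fun x =>
      (L.hasFDerivAt.comp x (hdiff x).hasFDerivAt).fderiv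
    simp_rw [e] at this
    simp_rw [map_sub, hL]
    simp_rw [mul_comm (B _ j k)]
    exact this
  apply Complex.ext
  · exact part Complex.reCLM (fun r z => by simp)
  · exact part Complex.imCLM (fun r z => by simp)

theorem integral_fderiv_eq_zero {Φ : Space d → ℂ} (hΦ : ContDiff ℝ 1 Φ)
    (hc : HasCompactSupport Φ) (v : Space d) : ∫ x, fderiv ℝ Φ x v = 0 := by
  have hd : Continuous fun x => fderiv ℝ Φ x v :=
    (hΦ.continuous_fderiv one_ne_zero).clm_apply continuous_const
  have := integral_mul_fderiv_eq_neg_fderiv_mul_of_integrable (μ := (volume : Measure (Space d)))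
    (f := fun _ : Space d => (1 : ℂ)) (g := Φ) (v := v) (by simp)
    (by simpa using hd.integrable_of_hasCompactSupport (hc.fderiv_apply (𝕜 := ℝ) v))
    (by simpa using hΦ.continuous.integrable_of_hasCompactSupport hc)
    (fun x _ => by fun_prop) (fun x _ => (hΦ.differentiable one_ne_zero) x)
  simpa using this

theorem fderiv_inner_spinor {u v : Space d → Spinor N} {x : Space d}
    (hu : DifferentiableAt ℝ u x) (hv : DifferentiableAt ℝ v x) (e : Space d) :
    fderiv ℝ (fun x => (inner ℂ (u x) (v x) : ℂ)) x e
      = inner ℂ (u x) (fderiv ℝ v x e) + inner ℂ (fderiv ℝ u x e) (v x) := by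
  rw [fderiv_inner_apply ℂ hu hv]

theorem fderiv_clm_comp_apply {u : Space d → Spinor N} (S : Spinor N →L[ℂ] Spinor N) {x : Space d}
    (hu : DifferentiableAt ℝ u x) :
    fderiv ℝ (fun x => S (u x)) x = (S.restrictScalars ℝ).comp (fderiv ℝ u x) :=
  ((S.restrictScalars ℝ).hasFDerivAt.comp x hu.hasFDerivAt).fderiv

/-- The integrals of `∂_j (w⟨u, S ∂_k u⟩)` and `∂_k (w⟨u, S ∂_j u⟩)` vanish, and in their difference
the second derivatives of `u` cancel by symmetry. The terms linear in `A` assemble into `A_j ∂_k Φ -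
A_k ∂_j Φ` with `Φ = w⟨u, S u⟩`, which the definition of `B` turns into `B_jk Φ`; the terms
quadratic in `A` cancel. -/
theorem integral_commutator_of_smooth {A : Space d → Space d} (hA : MemL2Loc A)
    {B : Space d → Matrix (Fin d) (Fin d) ℝ} (hB : MemL2Loc B) (hAB : IsMagneticField A B)
    {w : Space d → ℝ} (hw : ContDiff ℝ ∞ w) (hwc : HasCompactSupport w)
    (S : Spinor N →L[ℂ] Spinor N) (j k : Fin d) {u : Space d → Spinor N} (hu : ContDiff ℝ ∞ u)
    {D : Fin d → Space d → Spinor N}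
    (hD : ∀ i x, D i x = fderiv ℝ u x (stdVec i) - (Complex.I * (A x i : ℂ)) • u x) :
    ∫ x, ((w x : ℂ) * inner ℂ (D j x) (S (D k x)) - (w x : ℂ) * inner ℂ (D k x) (S (D j x))
      - Complex.I * ((w x * B x j k : ℝ) : ℂ) * inner ℂ (u x) (S (u x))
      + (fderiv ℝ w x (stdVec j) : ℂ) * inner ℂ (u x) (S (D k x))
      - (fderiv ℝ w x (stdVec k) : ℂ) * inner ℂ (u x) (S (D j x))) = 0 := by
  have hSu : ContDiff ℝ ∞ fun x => S (u x) := (S.restrictScalars ℝ).contDiff.comp hu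
  have hwC : ContDiff ℝ ∞ fun x => (w x : ℂ) := Complex.ofRealCLM.contDiff.comp hw
  have hwCc : HasCompactSupport fun x => (w x : ℂ) := hwc.comp_left Complex.ofReal_zero
  have hdu : ∀ i, ContDiff ℝ ∞ fun x => fderiv ℝ u x (stdVec i) := fun i =>
    (hu.fderiv_right (m := ∞) (by simp)).clm_apply contDiff_const
  have hSdu : ∀ i, ContDiff ℝ ∞ fun x => S (fderiv ℝ u x (stdVec i)) := fun i =>
    (S.restrictScalars ℝ).contDiff.comp (hdu i)
  have du : ∀ x, DifferentiableAt ℝ u x := hu.differentiable (by simp)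
  have ddu : ∀ i x, DifferentiableAt ℝ (fun x => fderiv ℝ u x (stdVec i)) x := fun i =>
    (hdu i).differentiable (by simp)
  have dSu : ∀ x, DifferentiableAt ℝ (fun x => S (u x)) x := hSu.differentiable (by simp)
  have dSdu : ∀ i x, DifferentiableAt ℝ (fun x => S (fderiv ℝ u x (stdVec i))) x := fun i =>
    (hSdu i).differentiable (by simp)
  have dw : ∀ x, DifferentiableAt ℝ w x := hw.differentiable (by simp)
  have dwC : ∀ x, DifferentiableAt ℝ (fun x => (w x : ℂ)) x := hwC.differentiable (by simp)
  have fw : ∀ x e, fderiv ℝ (fun x => (w x : ℂ)) x e = (fderiv ℝ w x e : ℂ) := fun x e => by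
    have : HasFDerivAt (fun x => (w x : ℂ)) (Complex.ofRealCLM.comp (fderiv ℝ w x)) x :=
      Complex.ofRealCLM.hasFDerivAt.comp x (dw x).hasFDerivAt
    rw [this.fderiv]; rfl
  have hF : ContDiff ℝ ∞ fun x => (inner ℂ (u x) (S (u x)) : ℂ) := hu.inner ℂ hSu
  have hq : ∀ i, ContDiff ℝ ∞ fun x => (inner ℂ (u x) (S (fderiv ℝ u x (stdVec i))) : ℂ) :=
    fun i => hu.inner ℂ (hSdu i)
  have fF : ∀ x e, fderiv ℝ (fun x => (w x : ℂ) * inner ℂ (u x) (S (u x))) x e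
      = w x * (inner ℂ (u x) (S (fderiv ℝ u x e)) + inner ℂ (fderiv ℝ u x e) (S (u x)))
        + (fderiv ℝ w x e : ℂ) * inner ℂ (u x) (S (u x)) := by
    intro x e
    rw [fderiv_fun_mul (dwC x) (hF.differentiable (by simp) x)]
    simp only [add_apply, smul_apply, smul_eq_mul, fw]
    rw [fderiv_inner_spinor (du x) (dSu x), fderiv_clm_comp_apply S (du x)]
    simp only [ContinuousLinearMap.comp_apply, ContinuousLinearMap.coe_restrictScalars']
    ring
  have fq : ∀ i x e, fderiv ℝ (fun x => (w x : ℂ) * inner ℂ (u x) (S (fderiv ℝ u x (stdVec i)))) x e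
      = w x * (inner ℂ (u x) (S (fderiv ℝ (fun x => fderiv ℝ u x (stdVec i)) x e))
          + inner ℂ (fderiv ℝ u x e) (S (fderiv ℝ u x (stdVec i))))
        + (fderiv ℝ w x e : ℂ) * inner ℂ (u x) (S (fderiv ℝ u x (stdVec i))) := by
    intro i x e
    rw [fderiv_fun_mul (dwC x) ((hq i).differentiable (by simp) x)]
    simp only [add_apply, smul_apply, smul_eq_mul, fw]
    rw [fderiv_inner_spinor (du x) (dSdu i x), fderiv_clm_comp_apply S (ddu i x)]
    simp only [ContinuousLinearMap.comp_apply, ContinuousLinearMap.coe_restrictScalars']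
    ring
  have hsymm : ∀ x, fderiv ℝ (fun x => fderiv ℝ u x (stdVec k)) x (stdVec j)
      = fderiv ℝ (fun x => fderiv ℝ u x (stdVec j)) x (stdVec k) := by
    intro x
    have hd2 : DifferentiableAt ℝ (fderiv ℝ u) x :=
      (hu.fderiv_right (m := ∞) (by simp)).differentiable (by simp) x
    have e1 : ∀ a b : Space d, fderiv ℝ (fun x => fderiv ℝ u x a) x b
        = fderiv ℝ (fderiv ℝ u) x b a := by
      intro a b
      rw [fderiv_clm_apply hd2 (differentiableAt_const a)]
      simp
    rw [e1, e1]
    exact (hu.contDiffAt.isSymmSndFDerivAt (by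
      rw [minSmoothness_of_isRCLikeNormedField]
      exact WithTop.coe_le_coe.2 (le_top : (2 : ℕ∞) ≤ ⊤))).eq _ _
  have cF : HasCompactSupport fun x => (w x : ℂ) * inner ℂ (u x) (S (u x)) := hwCc.mul_right
  have cq : ∀ i, HasCompactSupport
      fun x => (w x : ℂ) * inner ℂ (u x) (S (fderiv ℝ u x (stdVec i))) := fun i => hwCc.mul_right
  have hwF := hwC.mul hF
  have hwq := fun i => hwC.mul (hq i)
  have z1 := integral_fderiv_eq_zero ((hwq k).of_le (by simp)) (cq k) (stdVec j)
  have z2 := integral_fderiv_eq_zero ((hwq j).of_le (by simp)) (cq j) (stdVec k)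
  have z3 := hAB.integral_complex hA hB j k hwF cF
  have hdcont : ∀ {Φ : Space d → ℂ}, ContDiff ℝ ∞ Φ → ∀ e, Continuous fun x => fderiv ℝ Φ x e :=
    fun hΦ e => (hΦ.continuous_fderiv (by simp)).clm_apply continuous_const
  have i1 := (hdcont (hwq k) (stdVec j)).integrable_of_hasCompactSupport (μ := volume)
    ((cq k).fderiv_apply (𝕜 := ℝ) (stdVec j))
  have i2 := (hdcont (hwq j) (stdVec k)).integrable_of_hasCompactSupport (μ := volume)
    ((cq j).fderiv_apply (𝕜 := ℝ) (stdVec k))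
  have iB : Integrable fun x => (B x j k : ℂ) * ((w x : ℂ) * inner ℂ (u x) (S (u x))) := by
    have := (hB.locallyIntegrable_entry j k).integrable_smul_right_of_hasCompactSupport
      hwF.continuous cF
    exact this.congr (Eventually.of_forall fun x => by simp)
  have iA : ∀ a b, Integrable (fun x => (A x a : ℂ) *
      fderiv ℝ (fun x => (w x : ℂ) * inner ℂ (u x) (S (u x))) x (stdVec b)) := by
    intro a b
    have := (hA.locallyIntegrable_apply a).integrable_smul_right_of_hasCompactSupport
      (hdcont hwF (stdVec b)) (cF.fderiv_apply (𝕜 := ℝ) (stdVec b))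
    exact this.congr (Eventually.of_forall fun x => by simp)
  have total : ∫ x, ((fderiv ℝ (fun x => (w x : ℂ) * inner ℂ (u x)
        (S (fderiv ℝ u x (stdVec k)))) x (stdVec j)
      - fderiv ℝ (fun x => (w x : ℂ) * inner ℂ (u x) (S (fderiv ℝ u x (stdVec j)))) x (stdVec k))
      + Complex.I * (((A x j : ℂ) *
          fderiv ℝ (fun x => (w x : ℂ) * inner ℂ (u x) (S (u x))) x (stdVec k)
        - (A x k : ℂ) * fderiv ℝ (fun x => (w x : ℂ) * inner ℂ (u x) (S (u x))) x (stdVec j))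
        - (B x j k : ℂ) * ((w x : ℂ) * inner ℂ (u x) (S (u x))))) = 0 := by
    have h := integral_add' (i1.sub i2) ((((iA j k).sub (iA k j)).sub iB).const_mul Complex.I)
    rw [integral_sub' i1 i2, integral_const_mul, integral_sub' ((iA j k).sub (iA k j)) iB, z1, z2,
      z3] at h
    refine h.trans ?_
    simp only [Pi.sub_apply]
    simp
  rw [← total]
  refine integral_congr_ae (Eventually.of_forall fun x => ?_)
  simp only [fF, fq, hD, hsymm, map_sub, map_smul, inner_sub_left, inner_sub_right,
    inner_smul_left, inner_smul_right, map_mul, Complex.conj_I, Complex.conj_ofReal,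
    Complex.ofReal_mul]
  ring

/-- Density of smooth spinors: every term is an `L²` pairing continuous along `H¹` convergence. For
the field term this is the closed graph theorem applied to multiplication by `w B_jk`, which is why
`hwB` is required for all of `H¹`. -/
theorem integral_commutator {A : Space d → Space d} (hA : MemL2Loc A) (hmul : MulH1 A N)
    {B : Space d → Matrix (Fin d) (Fin d) ℝ} (hB : MemL2Loc B) (hAB : IsMagneticField A B)
    {w : Space d → ℝ} (hw : ContDiff ℝ ∞ w) (hwc : HasCompactSupport w)
    (S : Spinor N →L[ℂ] Spinor N) (j k : Fin d)
    (hwB : ∀ ψ : SobolevH1 d N,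
      MemLp (fun x => ((w x * B x j k : ℝ) : ℂ) • (ψ : SpinorL2 d N) x) 2 volume)
    (ψ : SobolevH1 d N) :
    (∫ x, (w x : ℂ) * inner ℂ (magPartial A ψ j x) (S (magPartial A ψ k x)))
      - (∫ x, (w x : ℂ) * inner ℂ (magPartial A ψ k x) (S (magPartial A ψ j x)))
    = Complex.I * (∫ x, ((w x * B x j k : ℝ) : ℂ) *
          inner ℂ ((ψ : SpinorL2 d N) x) (S ((ψ : SpinorL2 d N) x)))
      - (∫ x, (fderiv ℝ w x (stdVec j) : ℂ) *
          inner ℂ ((ψ : SpinorL2 d N) x) (S (magPartial A ψ k x)))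
      + ∫ x, (fderiv ℝ w x (stdVec k) : ℂ) *
          inner ℂ ((ψ : SpinorL2 d N) x) (S (magPartial A ψ j x)) := by
  have field : ∀ {f : Space d → ℝ}, Continuous f → HasCompactSupport f →
      IsBddField fun x => (f x : ℂ) • S := by
    intro f hf hc
    obtain ⟨C, hC⟩ := hf.bounded_above_of_compact_support hc
    refine ⟨(Continuous.smul (Complex.continuous_ofReal.comp hf)
      continuous_const).aestronglyMeasurable, C * ‖S‖, fun x => ?_⟩
    rw [norm_smul, Complex.norm_real]
    exact mul_le_mul_of_nonneg_right (hC x) (norm_nonneg _)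
  have fw := field hw.continuous hwc
  have fdw := fun i => field (continuous_partial i hw) (hwc.fderiv_apply (𝕜 := ℝ) (stdVec i))
  have rw1 : ∀ (c : ℂ) (a b : Spinor N), c * inner ℂ a (S b) = inner ℂ a ((c • S) b) := by
    intro c a b
    rw [smul_apply, inner_smul_right]
  have rw2 : ∀ (c : ℂ) (a b : Spinor N), c * inner ℂ a (S b) = inner ℂ a (S (c • b)) := by
    intro c a b
    rw [map_smul, inner_smul_right]
  obtain ⟨φ, hs, hφ⟩ := exists_smooth_h1Tendsto ψ
  have l0 := L2Tendsto.of_lp hφ.1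
  have lD := fun i => hφ.magPartial hmul i
  have lB := hφ.mul hwB
  have t1 := (lD j).integral_inner ((lD k).field fw)
  have t2 := (lD k).integral_inner ((lD j).field fw)
  have t3 := l0.integral_inner (lB.field (IsBddField.const S))
  have t4 := l0.integral_inner ((lD k).field (fdw j))
  have t5 := l0.integral_inner ((lD j).field (fdw k))
  simp only [← rw1, ← rw2] at t1 t2 t3 t4 t5
  refine tendsto_nhds_unique (t1.sub t2) ?_
  refine (((t3.const_mul Complex.I).sub t4).add t5).congr fun n => ?_
  obtain ⟨u, hu, e0, e1⟩ := hs n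
  have mD := fun i => hmul.memLp_magPartial (φ n) i
  have m0 := Lp.memLp (φ n : SpinorL2 d N)
  have i1 := MemLp.integrable_spinor_inner (mD j) (fw.memLp (mD k))
  have i2 := MemLp.integrable_spinor_inner (mD k) (fw.memLp (mD j))
  have i3 := MemLp.integrable_spinor_inner m0 ((IsBddField.const S).memLp (hwB (φ n)))
  have i4 := MemLp.integrable_spinor_inner m0 ((fdw j).memLp (mD k))
  have i5 := MemLp.integrable_spinor_inner m0 ((fdw k).memLp (mD j))
  simp only [← rw1, ← rw2] at i1 i2 i3 i4 i5
  have hz := integral_commutator_of_smooth hA hB hAB hw hwc S j k hu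
    (D := fun i x => fderiv ℝ u x (stdVec i) - (Complex.I * (A x i : ℂ)) • u x) fun i x => rfl
  have hcong : ∫ x, ((w x : ℂ) * inner ℂ (magPartial A (φ n) j x) (S (magPartial A (φ n) k x))
      - (w x : ℂ) * inner ℂ (magPartial A (φ n) k x) (S (magPartial A (φ n) j x))
      - Complex.I * (((w x * B x j k : ℝ) : ℂ) *
          inner ℂ ((φ n : SpinorL2 d N) x) (S ((φ n : SpinorL2 d N) x)))
      + (fderiv ℝ w x (stdVec j) : ℂ) * inner ℂ ((φ n : SpinorL2 d N) x)
          (S (magPartial A (φ n) k x))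
      - (fderiv ℝ w x (stdVec k) : ℂ) * inner ℂ ((φ n : SpinorL2 d N) x)
          (S (magPartial A (φ n) j x))) = 0 := by
    rw [← hz]
    refine integral_congr_ae ?_
    filter_upwards [e0, e1 j, e1 k] with x h0 hj hk
    simp only [magPartial, h0, hj, hk, mul_assoc]
  have h := integral_sub' (((i1.sub i2).sub (i3.const_mul Complex.I)).add i4) i5
  rw [integral_add' ((i1.sub i2).sub (i3.const_mul _)) i4,
    integral_sub' (i1.sub i2) (i3.const_mul _), integral_sub' i1 i2, integral_const_mul] at h
  have h' := hcong.symm.trans h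
  linear_combination h'

end Commutator

/-! ### The Hardy inequality for the magnetic gradient -/

section Hardy

open Topology

variable {d N : ℕ}

/-- `‖∇_A ψ‖²` as a real number. -/
noncomputable def gradSq (A : Space d → Space d) (ψ : SobolevH1 d N) : ℝ :=
  ∑ j, ∫ x, ‖magPartial A ψ j x‖ ^ 2

theorem MemLp.integrable_norm_sq {f : Space d → Spinor N} (hf : MemLp f 2 volume) :
    Integrable (fun x => ‖f x‖ ^ 2) volume :=
  (memLp_two_iff_integrable_sq_norm hf.1).1 hf

theorem MemLp.lintegral_enorm_sq {f : Space d → Spinor N} (hf : MemLp f 2 volume) :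
    ∫⁻ x, ‖f x‖ₑ ^ 2 = ENNReal.ofReal (∫ x, ‖f x‖ ^ 2) := by
  rw [ofReal_integral_eq_lintegral_ofReal (MemLp.integrable_norm_sq hf)
    (Eventually.of_forall fun x => by positivity)]
  refine lintegral_congr fun x => ?_
  rw [ENNReal.ofReal_pow (norm_nonneg _), ofReal_norm]

theorem memLp_two_of_lintegral_le {f : Space d → Spinor N} (hf : AEStronglyMeasurable f volume)
    {C : ℝ} (h : ∫⁻ x, ‖f x‖ₑ ^ 2 ≤ ENNReal.ofReal C) : MemLp f 2 volume := by
  refine ⟨hf, ?_⟩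
  rw [lintegral_enorm_sq_eq] at h
  by_contra hcon
  rw [not_lt, top_le_iff] at hcon
  rw [hcon] at h
  simp at h

theorem integral_norm_sq_le {f : Space d → Spinor N} (hf : MemLp f 2 volume)
    {C : ℝ} (hC : 0 ≤ C) (h : ∫⁻ x, ‖f x‖ₑ ^ 2 ≤ ENNReal.ofReal C) : ∫ x, ‖f x‖ ^ 2 ≤ C := by
  rw [MemLp.lintegral_enorm_sq hf] at h
  exact (ENNReal.ofReal_le_ofReal_iff hC).1 h

theorem magEnergy_eq {A : Space d → Space d} (hA : MulH1 A N) (ψ : SobolevH1 d N) :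
    magEnergy A ψ = ENNReal.ofReal (gradSq A ψ) := by
  unfold magEnergy gradSq
  rw [ENNReal.ofReal_sum_of_nonneg fun j _ => integral_nonneg fun x => by positivity]
  exact Finset.sum_congr rfl fun j _ => MemLp.lintegral_enorm_sq (hA.memLp_magPartial ψ j)

theorem gradSq_nonneg (A : Space d → Space d) (ψ : SobolevH1 d N) : 0 ≤ gradSq A ψ :=
  Finset.sum_nonneg fun _ _ => integral_nonneg fun _ => by positivity

/-- The scalar field `f` acting on spinors. -/
noncomputable def scalarField (f : Space d → ℝ) (x : Space d) : Spinor N →L[ℂ] Spinor N :=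
  (f x) • ContinuousLinearMap.id ℂ (Spinor N)

theorem fderiv_scalarField {f : Space d → ℝ} {x : Space d} (hf : DifferentiableAt ℝ f x)
    (v : Space d) : fderiv ℝ (scalarField f : Space d → Spinor N →L[ℂ] Spinor N) x v
      = (fderiv ℝ f x v) • ContinuousLinearMap.id ℂ (Spinor N) := by
  have := (hf.hasFDerivAt.smul_const (ContinuousLinearMap.id ℂ (Spinor N))).fderiv
  change fderiv ℝ (fun y => f y • ContinuousLinearMap.id ℂ (Spinor N)) x v = _
  rw [this]; rfl

/-- For a real scalar field the two pairings in the integration by parts have the same real part,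
whence the factor 2. -/
theorem integral_re_inner_magPartial {A : Space d → Space d} (hA : MulH1 A N) {f : Space d → ℝ}
    (hf : ContDiff ℝ 1 f) (hb : ∃ C, ∀ x, |f x| ≤ C)
    (hb' : ∀ j : Fin d, ∃ C, ∀ x, |fderiv ℝ f x (stdVec j)| ≤ C)
    (ψ : SobolevH1 d N) (j : Fin d) :
    2 * ∫ x, f x * (inner ℂ ((ψ : SpinorL2 d N) x) (magPartial A ψ j x)).re
      = -∫ x, fderiv ℝ f x (stdVec j) * ‖(ψ : SpinorL2 d N) x‖ ^ 2 := by
  have hM : IsBddC1Field (scalarField f : Space d → Spinor N →L[ℂ] Spinor N) := by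
    have hid : ‖ContinuousLinearMap.id ℂ (Spinor N)‖ ≤ 1 := ContinuousLinearMap.norm_id_le
    refine ⟨hf.smul contDiff_const, ?_, fun i => ?_⟩
    · obtain ⟨C, hC⟩ := hb
      refine ⟨C, fun x => ?_⟩
      rw [scalarField, norm_smul, Real.norm_eq_abs]
      exact (mul_le_of_le_one_right (abs_nonneg _) hid).trans (hC x)
    · obtain ⟨C, hC⟩ := hb' i
      refine ⟨C, fun x => ?_⟩
      rw [fderiv_scalarField (hf.differentiable one_ne_zero x), norm_smul, Real.norm_eq_abs]
      exact (mul_le_of_le_one_right (abs_nonneg _) hid).trans (hC x)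
  have h := congrArg Complex.re (integral_inner_field_magPartial hA hM ψ j)
  have m0 := Lp.memLp (ψ : SpinorL2 d N)
  have m2 := hA.memLp_magPartial ψ j
  have i1 := MemLp.integrable_spinor_inner m0 (hM.isBddField.memLp m2)
  have i2 := MemLp.integrable_spinor_inner m2 (hM.isBddField.memLp m0)
  have i3 := MemLp.integrable_spinor_inner m0 ((hM.isBddField_deriv j).memLp m0)
  have re_int : ∀ {F : Space d → ℂ}, Integrable F → (∫ x, F x).re = ∫ x, (F x).re := fun hF =>
    (Complex.reCLM.integral_comp_comm hF).symm
  rw [Complex.add_re, Complex.neg_re, re_int i1, re_int i2, re_int i3] at h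
  have hreal : ∀ (c : ℝ) (a b : Spinor N), (inner ℂ a (c • b)).re = c * (inner ℂ a b).re := by
    intro c a b
    rw [← Complex.coe_smul, inner_smul_right, Complex.re_ofReal_mul]
  have e1 : ∫ x, (inner ℂ ((ψ : SpinorL2 d N) x) (scalarField f x (magPartial A ψ j x))).re
      = ∫ x, f x * (inner ℂ ((ψ : SpinorL2 d N) x) (magPartial A ψ j x)).re :=
    integral_congr_ae (Eventually.of_forall fun x => hreal _ _ _)
  have e2 : ∫ x, (inner ℂ (magPartial A ψ j x) (scalarField f x ((ψ : SpinorL2 d N) x))).re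
      = ∫ x, f x * (inner ℂ ((ψ : SpinorL2 d N) x) (magPartial A ψ j x)).re := by
    refine integral_congr_ae (Eventually.of_forall fun x => ?_)
    refine (hreal _ _ _).trans ?_
    congr 1
    exact inner_re_symm (𝕜 := ℂ) _ _
  have e3 : ∫ x, (inner ℂ ((ψ : SpinorL2 d N) x) (fderiv ℝ (scalarField f : Space d →
        Spinor N →L[ℂ] Spinor N) x (stdVec j) ((ψ : SpinorL2 d N) x))).re
      = ∫ x, fderiv ℝ f x (stdVec j) * ‖(ψ : SpinorL2 d N) x‖ ^ 2 := by
    refine integral_congr_ae (Eventually.of_forall fun x => ?_)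
    simp only
    rw [fderiv_scalarField (hf.differentiable one_ne_zero x)]
    refine (hreal _ _ _).trans ?_
    congr 1
    exact inner_self_eq_norm_sq (𝕜 := ℂ) _
  rw [e1, e2, e3] at h
  linarith

/-- The components of the regularised vector field `(x - x₀) / (|x - x₀|² + δ)`. -/
noncomputable def hardyField (x₀ : Space d) (δ : ℝ) (j : Fin d) (x : Space d) : ℝ :=
  (x - x₀) j * (‖x - x₀‖ ^ 2 + δ)⁻¹

/-- The `j`-th coordinate, as a continuous linear map. -/
noncomputable def coordCLM (j : Fin d) : Space d →L[ℝ] ℝ := EuclideanSpace.proj (𝕜 := ℝ) j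

theorem coordCLM_apply (j : Fin d) (x : Space d) : coordCLM j x = x j := rfl

theorem hasFDerivAt_hardyField (x₀ : Space d) {δ : ℝ} (hδ : 0 < δ) (j : Fin d) (x : Space d) :
    ∃ L : Space d →L[ℝ] ℝ, HasFDerivAt (hardyField x₀ δ j) L x ∧ ∀ i, L (stdVec i) =
      (if i = j then 1 else 0) * (‖x - x₀‖ ^ 2 + δ)⁻¹
        - 2 * (x - x₀) i * (x - x₀) j * ((‖x - x₀‖ ^ 2 + δ)⁻¹) ^ 2 := by
  have hq : ‖x - x₀‖ ^ 2 + δ ≠ 0 := by positivity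
  have h1 : HasFDerivAt (fun x : Space d => (x - x₀) j)
      (coordCLM j) x :=
    (coordCLM j).hasFDerivAt.comp x
      ((hasFDerivAt_id x).sub_const x₀)
  have h2 : HasFDerivAt (fun x : Space d => ‖x - x₀‖ ^ 2 + δ)
      (2 • (innerSL ℝ (x - x₀)).comp (ContinuousLinearMap.id ℝ (Space d))) x :=
    (((hasFDerivAt_id x).sub_const x₀).norm_sq).add_const δ
  have h3 := (hasDerivAt_inv hq).comp_hasFDerivAt x h2
  refine ⟨_, h1.mul h3, fun i => ?_⟩
  have e1 : (stdVec i : Space d) j = if i = j then 1 else 0 := by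
    simp [eq_comm]
  have e2 : inner ℝ (x - x₀) (stdVec i) = (x - x₀) i := by
    simp [EuclideanSpace.inner_single_right]
  simp only [add_apply, smul_apply, ContinuousLinearMap.comp_apply, innerSL_apply_apply,
    ContinuousLinearMap.id_apply, e2, coordCLM_apply, e1, smul_eq_mul, nsmul_eq_mul]
  field_simp
  ring

theorem abs_coord_le (z : Space d) (j : Fin d) : |z j| ≤ ‖z‖ := by
  simpa using PiLp.norm_apply_le z j

theorem contDiff_hardyField (x₀ : Space d) {δ : ℝ} (hδ : 0 < δ) (j : Fin d) :
    ContDiff ℝ 1 (hardyField x₀ δ j) := by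
  have h1 : ContDiff ℝ 1 (fun x : Space d => (x - x₀) j) :=
    (coordCLM j).contDiff.comp (contDiff_id.sub contDiff_const)
  have h2 : ContDiff ℝ 1 (fun x : Space d => ‖x - x₀‖ ^ 2 + δ) :=
    ((contDiff_id.sub contDiff_const).norm_sq ℝ).add contDiff_const
  exact h1.mul (h2.inv fun x => by positivity)

theorem abs_hardyField_le (x₀ : Space d) {δ : ℝ} (hδ : 0 < δ) (j : Fin d) (x : Space d) :
    |hardyField x₀ δ j x| ≤ 1 + δ⁻¹ := by
  have hq : 0 < ‖x - x₀‖ ^ 2 + δ := by positivity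
  rw [hardyField, abs_mul, abs_of_pos (inv_pos.2 hq), ← div_eq_mul_inv, div_le_iff₀ hq]
  refine (abs_coord_le _ j).trans ?_
  have h1 : δ⁻¹ * δ = 1 := inv_mul_cancel₀ hδ.ne'
  have h2 : 0 ≤ δ⁻¹ * ‖x - x₀‖ ^ 2 := by positivity
  nlinarith [sq_nonneg (‖x - x₀‖ - 1), sq_nonneg ‖x - x₀‖]

theorem abs_fderiv_hardyField_le (x₀ : Space d) {δ : ℝ} (hδ : 0 < δ) (j i : Fin d) (x : Space d) :
    |fderiv ℝ (hardyField x₀ δ j) x (stdVec i)| ≤ 3 * δ⁻¹ := by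
  obtain ⟨L, hL, hLi⟩ := hasFDerivAt_hardyField x₀ hδ j x
  rw [hL.fderiv, hLi]
  have hq : 0 < ‖x - x₀‖ ^ 2 + δ := by positivity
  have hp : 0 < (‖x - x₀‖ ^ 2 + δ)⁻¹ := inv_pos.2 hq
  have h1 : (‖x - x₀‖ ^ 2 + δ)⁻¹ ≤ δ⁻¹ := inv_anti₀ hδ (by nlinarith [sq_nonneg ‖x - x₀‖])
  have h2 : ‖x - x₀‖ ^ 2 * (‖x - x₀‖ ^ 2 + δ)⁻¹ ≤ 1 := by
    rw [← div_eq_mul_inv, div_le_one hq]; linarith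
  have h3 : |(x - x₀) i * (x - x₀) j| ≤ ‖x - x₀‖ ^ 2 := by
    rw [abs_mul, sq]
    exact mul_le_mul (abs_coord_le _ _) (abs_coord_le _ _) (abs_nonneg _) (norm_nonneg _)
  set p := (‖x - x₀‖ ^ 2 + δ)⁻¹
  have h4 : |2 * (x - x₀) i * (x - x₀) j * p ^ 2| ≤ 2 * p := by
    have : 2 * (x - x₀) i * (x - x₀) j * p ^ 2 = 2 * p * p * ((x - x₀) i * (x - x₀) j) := by ring
    rw [this, abs_mul, abs_of_pos (by positivity : 0 < 2 * p * p)]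
    nlinarith [mul_le_mul_of_nonneg_left h3 (by positivity : 0 ≤ 2 * p * p)]
  have h5 : |(if i = j then 1 else 0) * p| ≤ p := by
    split_ifs
    · rw [one_mul, abs_of_pos hp]
    · rw [zero_mul, abs_zero]; exact hp.le
  calc _ ≤ _ := abs_sub _ _
    _ ≤ p + 2 * p := add_le_add h5 h4
    _ ≤ 3 * δ⁻¹ := by linarith

theorem Integrable.continuous_bdd_mul {W g : Space d → ℝ} (hW : Integrable W volume)
    (hg : Continuous g) {C : ℝ} (hC : ∀ x, |g x| ≤ C) : Integrable (fun x => g x * W x) volume :=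
  hW.bdd_mul hg.aestronglyMeasurable (Eventually.of_forall hC)

/-- The right side contains the divergence of the regularised radial field. -/
theorem hardyField_identity {A : Space d → Space d} (hA : MulH1 A N) (x₀ : Space d) {δ : ℝ}
    (hδ : 0 < δ) (ψ : SobolevH1 d N) :
    2 * ∑ j, ∫ x, hardyField x₀ δ j x * (inner ℂ ((ψ : SpinorL2 d N) x) (magPartial A ψ j x)).re
      = -∫ x, (d * (‖x - x₀‖ ^ 2 + δ)⁻¹ - 2 * ‖x - x₀‖ ^ 2 * ((‖x - x₀‖ ^ 2 + δ)⁻¹) ^ 2)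
          * ‖(ψ : SpinorL2 d N) x‖ ^ 2 := by
  have hW := MemLp.integrable_norm_sq (Lp.memLp (ψ : SpinorL2 d N))
  rw [Finset.mul_sum]
  have h1 : ∀ j, 2 * ∫ x, hardyField x₀ δ j x *
      (inner ℂ ((ψ : SpinorL2 d N) x) (magPartial A ψ j x)).re
      = -∫ x, fderiv ℝ (hardyField x₀ δ j) x (stdVec j) * ‖(ψ : SpinorL2 d N) x‖ ^ 2 := fun j =>
    integral_re_inner_magPartial hA (contDiff_hardyField x₀ hδ j) ⟨_, abs_hardyField_le x₀ hδ j⟩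
      (fun i => ⟨_, abs_fderiv_hardyField_le x₀ hδ j i⟩) ψ j
  rw [Finset.sum_congr rfl fun j _ => h1 j, Finset.sum_neg_distrib,
    ← integral_finsetSum _ fun j _ => Integrable.continuous_bdd_mul hW
      (((contDiff_hardyField x₀ hδ j).continuous_fderiv one_ne_zero).clm_apply continuous_const)
      (abs_fderiv_hardyField_le x₀ hδ j j)]
  congr 1
  refine integral_congr_ae (Eventually.of_forall fun x => ?_)
  simp only
  rw [← Finset.sum_mul]
  congr 1
  have h2 : ∀ j, fderiv ℝ (hardyField x₀ δ j) x (stdVec j) = (‖x - x₀‖ ^ 2 + δ)⁻¹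
      - 2 * ((‖x - x₀‖ ^ 2 + δ)⁻¹) ^ 2 * (x - x₀) j ^ 2 := by
    intro j
    obtain ⟨L, hL, hLi⟩ := hasFDerivAt_hardyField x₀ hδ j x
    rw [hL.fderiv, hLi, if_pos rfl]
    ring
  simp_rw [h2]
  rw [Finset.sum_sub_distrib, ← Finset.mul_sum, EuclideanSpace.real_norm_sq_eq (x - x₀)]
  simp
  ring

theorem norm_add_smul_sq (a b : Spinor N) (s : ℝ) :
    ‖b + s • a‖ ^ 2 = ‖b‖ ^ 2 + 2 * s * (inner ℂ a b).re + s ^ 2 * ‖a‖ ^ 2 := by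
  have h := norm_add_sq (𝕜 := ℂ) b (s • a)
  rw [h, norm_smul, mul_pow, Real.norm_eq_abs, sq_abs, ← Complex.coe_smul, inner_smul_right]
  have h2 : (inner ℂ b a : ℂ).re = (inner ℂ a b).re := inner_re_symm (𝕜 := ℂ) _ _
  change ‖b‖ ^ 2 + 2 * ((s : ℂ) * inner ℂ b a).re + _ = _
  rw [Complex.re_ofReal_mul, h2]
  ring

/-- Expand `0 ≤ ∑_j ∫ |∇_j ψ + c F_j ψ|²` with the optimal `c = (d-2)/2`, where `F` is the
regularised radial field. The cross term is given by the divergence identity, and `|x|²/(|x|²+δ)² ≤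
1/(|x|²+δ)` leaves the coefficient `2c² + 2c - (2c + c²) = c²`. -/
theorem hardy_regularised {A : Space d → Space d} (hA : MulH1 A N) (x₀ : Space d) {δ : ℝ}
    (hδ : 0 < δ) (hd : 2 ≤ d) (ψ : SobolevH1 d N) :
    (((d : ℝ) - 2) / 2) ^ 2 * ∫ x, (‖x - x₀‖ ^ 2 + δ)⁻¹ * ‖(ψ : SpinorL2 d N) x‖ ^ 2
      ≤ gradSq A ψ := by
  have hW := MemLp.integrable_norm_sq (Lp.memLp (ψ : SpinorL2 d N))
  have mD := fun j => hA.memLp_magPartial ψ j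
  have iD := fun j => MemLp.integrable_norm_sq (mD j)
  set c : ℝ := ((d : ℝ) - 2) / 2 with hc
  have hc0 : 0 ≤ c := by
    have : (2 : ℝ) ≤ d := by exact_mod_cast hd
    rw [hc]; linarith
  have hfc : ∀ j, Continuous (hardyField x₀ δ j) := fun j => (contDiff_hardyField x₀ hδ j).continuous
  have hqc : Continuous fun x : Space d => (‖x - x₀‖ ^ 2 + δ)⁻¹ :=
    (((continuous_id.sub continuous_const).norm.pow 2).add continuous_const).inv₀
      fun x => by change ‖x - x₀‖ ^ 2 + _ ≠ 0; positivity
  have hrc : Continuous fun x : Space d => ‖x - x₀‖ ^ 2 :=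
    (continuous_id.sub continuous_const).norm.pow 2
  have hq1 : ∀ x : Space d, |(‖x - x₀‖ ^ 2 + δ)⁻¹| ≤ δ⁻¹ := fun x => by
    rw [abs_of_pos (by positivity)]
    exact inv_anti₀ hδ (by nlinarith [sq_nonneg ‖x - x₀‖])
  have hrq : ∀ x : Space d, ‖x - x₀‖ ^ 2 * (‖x - x₀‖ ^ 2 + δ)⁻¹ ≤ 1 := fun x => by
    rw [← div_eq_mul_inv, div_le_one (by positivity)]; linarith
  have ire : ∀ j, Integrable fun x => hardyField x₀ δ j x *
      (inner ℂ ((ψ : SpinorL2 d N) x) (magPartial A ψ j x)).re := fun j =>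
    Integrable.continuous_bdd_mul
      (MemLp.integrable_spinor_inner (Lp.memLp (ψ : SpinorL2 d N)) (mD j)).re (hfc j)
      (abs_hardyField_le x₀ hδ j)
  have if2 : ∀ j, Integrable fun x => hardyField x₀ δ j x ^ 2 * ‖(ψ : SpinorL2 d N) x‖ ^ 2 :=
    fun j => Integrable.continuous_bdd_mul hW ((hfc j).pow 2) (C := (1 + δ⁻¹) ^ 2) fun x => by
      rw [abs_pow]
      exact pow_le_pow_left₀ (abs_nonneg _) (abs_hardyField_le x₀ hδ j x) 2
  have iq : Integrable fun x => (‖x - x₀‖ ^ 2 + δ)⁻¹ * ‖(ψ : SpinorL2 d N) x‖ ^ 2 :=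
    Integrable.continuous_bdd_mul hW hqc hq1
  have irq : Integrable fun x => ‖x - x₀‖ ^ 2 * ((‖x - x₀‖ ^ 2 + δ)⁻¹) ^ 2
      * ‖(ψ : SpinorL2 d N) x‖ ^ 2 :=
    Integrable.continuous_bdd_mul hW (hrc.mul (hqc.pow 2)) (C := δ⁻¹) fun x => by
      rw [abs_of_nonneg (by positivity), sq (‖x - x₀‖ ^ 2 + δ)⁻¹, ← mul_assoc]
      refine (mul_le_of_le_one_left (by positivity) (hrq x)).trans ?_
      exact (le_abs_self _).trans (hq1 x)
  have hsum : ∀ x, ∑ j, hardyField x₀ δ j x ^ 2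
      = ‖x - x₀‖ ^ 2 * ((‖x - x₀‖ ^ 2 + δ)⁻¹) ^ 2 := by
    intro x
    simp only [hardyField, mul_pow]
    rw [← Finset.sum_mul, ← EuclideanSpace.real_norm_sq_eq (x - x₀)]
  have hpos : 0 ≤ ∑ j, ∫ x, ‖magPartial A ψ j x + (c * hardyField x₀ δ j x) •
      (ψ : SpinorL2 d N) x‖ ^ 2 :=
    Finset.sum_nonneg fun j _ => integral_nonneg fun x => by positivity
  have hexp : ∀ j, ∫ x, ‖magPartial A ψ j x + (c * hardyField x₀ δ j x) •
      (ψ : SpinorL2 d N) x‖ ^ 2 = (∫ x, ‖magPartial A ψ j x‖ ^ 2)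
      + 2 * c * (∫ x, hardyField x₀ δ j x *
          (inner ℂ ((ψ : SpinorL2 d N) x) (magPartial A ψ j x)).re)
      + c ^ 2 * ∫ x, hardyField x₀ δ j x ^ 2 * ‖(ψ : SpinorL2 d N) x‖ ^ 2 := by
    intro j
    rw [← integral_const_mul, ← integral_const_mul,
      ← integral_add (iD j) ((ire j).const_mul _),
      ← integral_add ((iD j).fun_add ((ire j).const_mul _)) ((if2 j).const_mul _)]
    refine integral_congr_ae (Eventually.of_forall fun x => ?_)
    simp only
    rw [norm_add_smul_sq]
    ring
  rw [Finset.sum_congr rfl fun j _ => hexp j, Finset.sum_add_distrib, Finset.sum_add_distrib,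
    ← Finset.mul_sum, ← Finset.mul_sum, ← integral_finsetSum _ fun j _ => if2 j] at hpos
  have hid := hardyField_identity hA x₀ hδ ψ
  have hlast : ∫ x, ∑ j, hardyField x₀ δ j x ^ 2 * ‖(ψ : SpinorL2 d N) x‖ ^ 2
      = ∫ x, ‖x - x₀‖ ^ 2 * ((‖x - x₀‖ ^ 2 + δ)⁻¹) ^ 2 * ‖(ψ : SpinorL2 d N) x‖ ^ 2 := by
    refine integral_congr_ae (Eventually.of_forall fun x => ?_)
    simp only
    rw [← Finset.sum_mul, hsum]
  have hmid : ∫ x, (d * (‖x - x₀‖ ^ 2 + δ)⁻¹ - 2 * ‖x - x₀‖ ^ 2 * ((‖x - x₀‖ ^ 2 + δ)⁻¹) ^ 2)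
          * ‖(ψ : SpinorL2 d N) x‖ ^ 2
      = d * (∫ x, (‖x - x₀‖ ^ 2 + δ)⁻¹ * ‖(ψ : SpinorL2 d N) x‖ ^ 2)
        - 2 * ∫ x, ‖x - x₀‖ ^ 2 * ((‖x - x₀‖ ^ 2 + δ)⁻¹) ^ 2 * ‖(ψ : SpinorL2 d N) x‖ ^ 2 := by
    rw [← integral_const_mul, ← integral_const_mul,
      ← integral_sub (iq.const_mul _) (irq.const_mul _)]
    refine integral_congr_ae (Eventually.of_forall fun x => ?_)
    simp only
    ring
  have hle : ∫ x, ‖x - x₀‖ ^ 2 * ((‖x - x₀‖ ^ 2 + δ)⁻¹) ^ 2 * ‖(ψ : SpinorL2 d N) x‖ ^ 2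
      ≤ ∫ x, (‖x - x₀‖ ^ 2 + δ)⁻¹ * ‖(ψ : SpinorL2 d N) x‖ ^ 2 := by
    refine integral_mono irq iq fun x => ?_
    simp only
    refine mul_le_mul_of_nonneg_right ?_ (by positivity)
    rw [sq (‖x - x₀‖ ^ 2 + δ)⁻¹, ← mul_assoc]
    exact mul_le_of_le_one_left (by positivity) (hrq x)
  rw [hmid] at hid
  rw [hlast] at hpos
  have hd' : (d : ℝ) = 2 * c + 2 := by rw [hc]; ring
  rw [hd'] at hid
  unfold gradSq
  set H := ∫ x, (‖x - x₀‖ ^ 2 + δ)⁻¹ * ‖(ψ : SpinorL2 d N) x‖ ^ 2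
  set R := ∫ x, ‖x - x₀‖ ^ 2 * ((‖x - x₀‖ ^ 2 + δ)⁻¹) ^ 2 * ‖(ψ : SpinorL2 d N) x‖ ^ 2
  set Z := ∑ j, ∫ x, hardyField x₀ δ j x *
    (inner ℂ ((ψ : SpinorL2 d N) x) (magPartial A ψ j x)).re
  nlinarith [mul_le_mul_of_nonneg_left hle (by positivity : 0 ≤ c ^ 2 + 2 * c)]

/-- The spinor `ψ / |x - x₀|`. -/
noncomputable def hardyQuot (x₀ : Space d) (ψ : SobolevH1 d N) (x : Space d) : Spinor N :=
  ‖x - x₀‖⁻¹ • (ψ : SpinorL2 d N) x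

theorem aestronglyMeasurable_hardyQuot (x₀ : Space d) (ψ : SobolevH1 d N) :
    AEStronglyMeasurable (hardyQuot x₀ ψ) volume :=
  ((measurable_id.sub_const x₀).norm.inv.aestronglyMeasurable).smul
    (Lp.aestronglyMeasurable (ψ : SpinorL2 d N))

theorem ae_ne_point (hd : 1 ≤ d) (x₀ : Space d) : ∀ᵐ x : Space d, x ≠ x₀ := by
  have : Nontrivial (Space d) := by
    have : Nonempty (Fin d) := ⟨⟨0, hd⟩⟩
    infer_instance
  exact Measure.ae_ne volume x₀

/-- Fatou's lemma as `δ → 0`. The statement uses `∫⁻` because the square integrability of `ψ/|x -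
x₀|` is itself a conclusion here. -/
theorem hardy_lintegral {A : Space d → Space d} (hA : MulH1 A N) (x₀ : Space d)
    (hd : 3 ≤ d) (ψ : SobolevH1 d N) :
    ∫⁻ x, ‖hardyQuot x₀ ψ x‖ₑ ^ 2
      ≤ ENNReal.ofReal (gradSq A ψ / (((d : ℝ) - 2) / 2) ^ 2) := by
  have hdr : (3 : ℝ) ≤ d := by exact_mod_cast hd
  have hc0 : 0 < (((d : ℝ) - 2) / 2) ^ 2 := by
    have : 0 < ((d : ℝ) - 2) / 2 := by linarith
    positivity
  have hW := MemLp.integrable_norm_sq (Lp.memLp (ψ : SpinorL2 d N))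
  set δ : ℕ → ℝ := fun n => 1 / ((n : ℝ) + 1) with hδ
  have hδ0 : ∀ n, 0 < δ n := fun n => by rw [hδ]; positivity
  have hδt : Tendsto δ atTop (𝓝 0) := tendsto_one_div_add_atTop_nhds_zero_nat
  have key : ∀ n, ∫⁻ x, ENNReal.ofReal ((‖x - x₀‖ ^ 2 + δ n)⁻¹ * ‖(ψ : SpinorL2 d N) x‖ ^ 2)
      ≤ ENNReal.ofReal (gradSq A ψ / (((d : ℝ) - 2) / 2) ^ 2) := by
    intro n
    have hn := hδ0 n
    have hqc : Continuous fun x : Space d => (‖x - x₀‖ ^ 2 + δ n)⁻¹ :=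
      (((continuous_id.sub continuous_const).norm.pow 2).add continuous_const).inv₀
        fun x => by change ‖x - x₀‖ ^ 2 + _ ≠ 0; positivity
    have hq1 : ∀ x : Space d, |(‖x - x₀‖ ^ 2 + δ n)⁻¹| ≤ (δ n)⁻¹ := fun x => by
      rw [abs_of_pos (by positivity)]
      exact inv_anti₀ hn (by nlinarith [sq_nonneg ‖x - x₀‖])
    rw [← ofReal_integral_eq_lintegral_ofReal (Integrable.continuous_bdd_mul hW hqc hq1)
      (Eventually.of_forall fun x => by positivity)]
    refine ENNReal.ofReal_le_ofReal ?_
    rw [le_div_iff₀ hc0, mul_comm]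
    exact hardy_regularised hA x₀ hn (by omega) ψ
  calc ∫⁻ x, ‖hardyQuot x₀ ψ x‖ₑ ^ 2
      ≤ ∫⁻ x, liminf (fun n => ENNReal.ofReal
          ((‖x - x₀‖ ^ 2 + δ n)⁻¹ * ‖(ψ : SpinorL2 d N) x‖ ^ 2)) atTop := by
        refine lintegral_mono_ae ?_
        filter_upwards [ae_ne_point (by omega) x₀] with x hx
        have hr : ‖x - x₀‖ ≠ 0 := by simpa [sub_eq_zero] using hx
        have ht : Tendsto (fun n => ENNReal.ofReal
            ((‖x - x₀‖ ^ 2 + δ n)⁻¹ * ‖(ψ : SpinorL2 d N) x‖ ^ 2)) atTop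
            (𝓝 (ENNReal.ofReal ((‖x - x₀‖ ^ 2 + 0)⁻¹ * ‖(ψ : SpinorL2 d N) x‖ ^ 2))) := by
          refine ENNReal.tendsto_ofReal (Tendsto.mul_const _ (Tendsto.inv₀ ?_ (by positivity)))
          exact hδt.const_add _
        rw [ht.liminf_eq, hardyQuot, ← ofReal_norm, ← ENNReal.ofReal_pow (norm_nonneg _),
          norm_smul, mul_pow, add_zero]
        simp
    _ ≤ liminf (fun n => ∫⁻ x, ENNReal.ofReal
          ((‖x - x₀‖ ^ 2 + δ n)⁻¹ * ‖(ψ : SpinorL2 d N) x‖ ^ 2)) atTop := by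
        refine lintegral_liminf_le' fun n => ?_
        refine AEMeasurable.ennreal_ofReal (AEMeasurable.mul ?_ ?_)
        · exact ((((measurable_id.sub_const x₀).norm.pow_const 2).add_const _).inv).aemeasurable
        · exact (Lp.aestronglyMeasurable (ψ : SpinorL2 d N)).norm.aemeasurable.pow_const 2
    _ ≤ _ := by
        refine (liminf_le_liminf (Eventually.of_forall key)).trans ?_
        simp

theorem memLp_hardyQuot {A : Space d → Space d} (hA : MulH1 A N) (x₀ : Space d)
    (hd : 3 ≤ d) (ψ : SobolevH1 d N) : MemLp (hardyQuot x₀ ψ) 2 volume :=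
  memLp_two_of_lintegral_le (aestronglyMeasurable_hardyQuot x₀ ψ) (hardy_lintegral hA x₀ hd ψ)

/-- The **Hardy inequality** for the magnetic gradient. -/
theorem hardy_inequality {A : Space d → Space d} (hA : MulH1 A N) (x₀ : Space d)
    (hd : 3 ≤ d) (ψ : SobolevH1 d N) :
    (((d : ℝ) - 2) / 2) ^ 2 * ∫ x, ‖hardyQuot x₀ ψ x‖ ^ 2 ≤ gradSq A ψ := by
  have hdr : (3 : ℝ) ≤ d := by exact_mod_cast hd
  have hc0 : 0 < (((d : ℝ) - 2) / 2) ^ 2 := by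
    have : 0 < ((d : ℝ) - 2) / 2 := by linarith
    positivity
  have := integral_norm_sq_le (memLp_hardyQuot hA x₀ hd ψ)
    (div_nonneg (gradSq_nonneg A ψ) hc0.le) (hardy_lintegral hA x₀ hd ψ)
  rwa [le_div_iff₀ hc0, mul_comm] at this

/-- The virial identity `∑_j Re ∫ ⟨x_j ψ / |x|², ∂_j ψ⟩ = -(d - 2)/2 ∫ |ψ|² / |x|²`. -/
theorem hardy_identity {A : Space d → Space d} (hA : MulH1 A N) (x₀ : Space d)
    (hd : 3 ≤ d) (ψ : SobolevH1 d N) :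
    ∑ j, ∫ x, ‖x - x₀‖⁻¹ * (x - x₀) j * (inner ℂ (hardyQuot x₀ ψ x) (magPartial A ψ j x)).re
      = -(((d : ℝ) - 2) / 2) * ∫ x, ‖hardyQuot x₀ ψ x‖ ^ 2 := by
  have mY := memLp_hardyQuot hA x₀ hd ψ
  have iY := MemLp.integrable_norm_sq mY
  have mD := fun j => hA.memLp_magPartial ψ j
  have m0 := Lp.memLp (ψ : SpinorL2 d N)
  set δ : ℕ → ℝ := fun n => 1 / ((n : ℝ) + 1) with hδ
  have hδ0 : ∀ n, 0 < δ n := fun n => by rw [hδ]; positivity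
  have hδt : Tendsto δ atTop (𝓝 0) := tendsto_one_div_add_atTop_nhds_zero_nat
  have hinv : ∀ x : Space d, x ≠ x₀ → Tendsto (fun n => (‖x - x₀‖ ^ 2 + δ n)⁻¹) atTop
      (𝓝 ((‖x - x₀‖ ^ 2)⁻¹)) := by
    intro x hx
    have hr : ‖x - x₀‖ ≠ 0 := by simpa [sub_eq_zero] using hx
    have := (hδt.const_add (‖x - x₀‖ ^ 2)).inv₀ (by rw [add_zero]; positivity)
    simpa using this
  have hinvle : ∀ (x : Space d) n, x ≠ x₀ → (‖x - x₀‖ ^ 2 + δ n)⁻¹ ≤ (‖x - x₀‖ ^ 2)⁻¹ := by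
    intro x n hx
    have hr : 0 < ‖x - x₀‖ := by simpa [sub_eq_zero] using hx
    exact inv_anti₀ (by positivity) (by linarith [hδ0 n])
  have hre : ∀ x (b : Spinor N), x ≠ x₀ → (inner ℂ (hardyQuot x₀ ψ x) b).re
      = ‖x - x₀‖⁻¹ * (inner ℂ ((ψ : SpinorL2 d N) x) b).re := by
    intro x b _
    rw [hardyQuot, ← Complex.coe_smul, inner_smul_left, Complex.conj_ofReal,
      Complex.re_ofReal_mul]
  -- The regularised field is bounded by `1/|x - x₀|` uniformly in `δ`, so the product of `ψ/|x -
  -- x₀|` and `∇_j ψ`, both now in `L²`, dominates.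
  have t1 : ∀ j, Tendsto (fun n => ∫ x, hardyField x₀ (δ n) j x *
      (inner ℂ ((ψ : SpinorL2 d N) x) (magPartial A ψ j x)).re) atTop
      (𝓝 (∫ x, ‖x - x₀‖⁻¹ * (x - x₀) j *
        (inner ℂ (hardyQuot x₀ ψ x) (magPartial A ψ j x)).re)) := by
    intro j
    refine tendsto_integral_of_dominated_convergence
      (fun x => ‖inner ℂ (hardyQuot x₀ ψ x) (magPartial A ψ j x)‖) (fun n => ?_)
      (MemLp.integrable_spinor_inner mY (mD j)).norm (fun n => ?_) ?_
    · exact (contDiff_hardyField x₀ (hδ0 n) j).continuous.aestronglyMeasurable.mul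
        (MemLp.integrable_spinor_inner m0 (mD j)).re.1
    · filter_upwards [ae_ne_point (by omega) x₀] with x hx
      have hr : 0 < ‖x - x₀‖ := by simpa [sub_eq_zero] using hx
      have e1 : (inner ℂ ((ψ : SpinorL2 d N) x) (magPartial A ψ j x)).re
          = ‖x - x₀‖ * (inner ℂ (hardyQuot x₀ ψ x) (magPartial A ψ j x)).re := by
        rw [hre x _ hx]; field_simp
      rw [e1, Real.norm_eq_abs, ← mul_assoc, abs_mul]
      refine (mul_le_of_le_one_left (abs_nonneg _) ?_).trans (Complex.abs_re_le_norm _)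
      rw [hardyField, abs_mul, abs_mul, abs_of_pos hr,
        abs_of_pos (by have := hδ0 n; positivity : 0 < (‖x - x₀‖ ^ 2 + δ n)⁻¹)]
      calc |(x - x₀) j| * (‖x - x₀‖ ^ 2 + δ n)⁻¹ * ‖x - x₀‖
          ≤ ‖x - x₀‖ * (‖x - x₀‖ ^ 2)⁻¹ * ‖x - x₀‖ := by
            have h1 := abs_coord_le (x - x₀) j
            have h2 := hinvle x n hx
            have h3 : 0 ≤ (‖x - x₀‖ ^ 2 + δ n)⁻¹ := by have := hδ0 n; positivity
            gcongr
        _ = 1 := by field_simp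
    · filter_upwards [ae_ne_point (by omega) x₀] with x hx
      have hr : 0 < ‖x - x₀‖ := by simpa [sub_eq_zero] using hx
      rw [hre x _ hx]
      have e : ‖x - x₀‖⁻¹ * (x - x₀) j * (‖x - x₀‖⁻¹ *
          (inner ℂ ((ψ : SpinorL2 d N) x) (magPartial A ψ j x)).re)
          = (x - x₀) j * (‖x - x₀‖ ^ 2)⁻¹ *
            (inner ℂ ((ψ : SpinorL2 d N) x) (magPartial A ψ j x)).re := by
        field_simp
      rw [e]
      exact ((hinv x hx).const_mul _).mul_const _
  -- The divergence tends to `(d - 2)/|x - x₀|²`, and its absolute value is at most `(d + 2)/|x -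
  -- x₀|²` for all `δ`.
  have t2 : Tendsto (fun n => ∫ x, (d * (‖x - x₀‖ ^ 2 + δ n)⁻¹
        - 2 * ‖x - x₀‖ ^ 2 * ((‖x - x₀‖ ^ 2 + δ n)⁻¹) ^ 2) * ‖(ψ : SpinorL2 d N) x‖ ^ 2) atTop
      (𝓝 (∫ x, ((d : ℝ) - 2) * ‖hardyQuot x₀ ψ x‖ ^ 2)) := by
    have hY : ∀ x, ‖hardyQuot x₀ ψ x‖ ^ 2
        = (‖x - x₀‖ ^ 2)⁻¹ * ‖(ψ : SpinorL2 d N) x‖ ^ 2 := by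
      intro x
      rw [hardyQuot, norm_smul, mul_pow]
      simp
    refine tendsto_integral_of_dominated_convergence
      (fun x => ((d : ℝ) + 2) * ‖hardyQuot x₀ ψ x‖ ^ 2) (fun n => ?_)
      (iY.const_mul _) (fun n => ?_) ?_
    · have hm : Measurable fun x : Space d => (‖x - x₀‖ ^ 2 + δ n)⁻¹ :=
        (((measurable_id.sub_const x₀).norm.pow_const 2).add_const _).inv
      have hm2 : Measurable fun x : Space d => 2 * ‖x - x₀‖ ^ 2 :=
        ((measurable_id.sub_const x₀).norm.pow_const 2).const_mul 2
      exact ((hm.const_mul _).sub (hm2.mul (hm.pow_const 2))).aestronglyMeasurable.mul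
        (MemLp.integrable_norm_sq m0).1
    · filter_upwards [ae_ne_point (by omega) x₀] with x hx
      have hr : 0 < ‖x - x₀‖ := by simpa [sub_eq_zero] using hx
      rw [hY, ← mul_assoc, norm_mul, Real.norm_eq_abs, Real.norm_eq_abs,
        abs_of_nonneg (by positivity : 0 ≤ ‖(ψ : SpinorL2 d N) x‖ ^ 2)]
      refine mul_le_mul_of_nonneg_right ?_ (by positivity)
      have h2 := hinvle x n hx
      have h3 : 0 ≤ (‖x - x₀‖ ^ 2 + δ n)⁻¹ := by have := hδ0 n; positivity
      have h4 : ‖x - x₀‖ ^ 2 * (‖x - x₀‖ ^ 2)⁻¹ = 1 := by field_simp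
      have hs : 0 < ‖x - x₀‖ ^ 2 := by positivity
      set s := ‖x - x₀‖ ^ 2
      set p := (s + δ n)⁻¹
      set q := s⁻¹
      have h5 : s * p ≤ 1 := by nlinarith
      have h6 : s * p ^ 2 ≤ q := by nlinarith
      have h7 : 0 ≤ s * p ^ 2 := by positivity
      have h8 : (0 : ℝ) ≤ d := Nat.cast_nonneg d
      rw [abs_le]
      constructor <;> nlinarith [mul_le_mul_of_nonneg_left h2 h8, mul_nonneg h8 h3]
    · filter_upwards [ae_ne_point (by omega) x₀] with x hx
      have hr : 0 < ‖x - x₀‖ := by simpa [sub_eq_zero] using hx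
      have e : ((d : ℝ) - 2) * ‖hardyQuot x₀ ψ x‖ ^ 2 = (d * (‖x - x₀‖ ^ 2)⁻¹
        - 2 * ‖x - x₀‖ ^ 2 * ((‖x - x₀‖ ^ 2)⁻¹) ^ 2) * ‖(ψ : SpinorL2 d N) x‖ ^ 2 := by
        rw [hY]; field_simp
      rw [e]
      exact (((hinv x hx).const_mul _).sub (((hinv x hx).pow 2).const_mul _)).mul_const _
  have h1 := (tendsto_finsetSum Finset.univ fun j _ => t1 j).const_mul 2
  have h2 := t2.neg
  have h3 := tendsto_nhds_unique (h1.congr fun n => hardyField_identity hA x₀ (hδ0 n) ψ) h2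
  rw [integral_const_mul] at h3
  linarith

end Hardy

/-! ### Cutoffs away from a point and from infinity -/

section Cutoff

open Topology

variable {d : ℕ}

/-- A sequence of smooth cutoffs vanishing near `x₀` and near infinity, exhausting the complement
of `x₀`, whose gradients are bounded by a multiple of `1 / |x - x₀|`. -/
structure IsCutoffSeq (x₀ : Space d) (η : ℕ → Space d → ℝ) : Prop where
  contDiff : ∀ n, ContDiff ℝ ∞ (η n)
  hasCompactSupport : ∀ n, HasCompactSupport (η n)
  notMem_tsupport : ∀ n, x₀ ∉ tsupport (η n)
  abs_le_one : ∀ n x, |η n x| ≤ 1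
  bdd_deriv : ∃ C, ∀ n x j, ‖x - x₀‖ * |fderiv ℝ (η n) x (stdVec j)| ≤ C
  eventually_eq_one : ∀ x, x ≠ x₀ → ∀ᶠ n in atTop, η n =ᶠ[𝓝 x] fun _ => 1

/-- A fixed smooth bump function. -/
noncomputable def unitBump (d : ℕ) : ContDiffBump (0 : Space d) := ⟨1, 2, one_pos, one_lt_two⟩

/-- The bump function rescaled by the factor `s` about the point `x₀`. -/
noncomputable def scaledBump (x₀ : Space d) (s : ℝ) (x : Space d) : ℝ :=
  unitBump d (s • (x - x₀))

theorem contDiff_scaledBump (x₀ : Space d) (s : ℝ) : ContDiff ℝ ∞ (scaledBump x₀ s) :=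
  (unitBump d).contDiff.comp ((contDiff_id.sub contDiff_const).const_smul s)

theorem fderiv_scaledBump (x₀ : Space d) (s : ℝ) (x v : Space d) :
    fderiv ℝ (scaledBump x₀ s) x v = s * fderiv ℝ (unitBump d) (s • (x - x₀)) v := by
  have h1 : HasFDerivAt (fun x : Space d => s • (x - x₀))
      (s • ContinuousLinearMap.id ℝ (Space d)) x :=
    ((hasFDerivAt_id x).sub_const x₀).const_smul s
  have h2 := ((unitBump d).contDiff (n := 1)).differentiable one_ne_zero (s • (x - x₀))
  have h3 : HasFDerivAt (scaledBump x₀ s) _ x := h2.hasFDerivAt.comp x h1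
  rw [h3.fderiv]
  simp

/-- The quantity `|y| |∇χ(y)|` is invariant under dilations, so one bound serves all scales, both at
the inner and at the outer edge of the cutoffs. -/
theorem exists_scaledBump_bound (d : ℕ) : ∃ C : ℝ, 0 ≤ C ∧ ∀ (x₀ : Space d) (s : ℝ), 0 < s →
    ∀ (x : Space d) (j : Fin d), ‖x - x₀‖ * |fderiv ℝ (scaledBump x₀ s) x (stdVec j)| ≤ C := by
  have hcf : Continuous fun y : Space d => ‖y‖ • fderiv ℝ (unitBump d) y :=
    continuous_norm.smul (((unitBump d).contDiff (n := 1)).continuous_fderiv one_ne_zero)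
  have hcs : HasCompactSupport fun y : Space d => ‖y‖ • fderiv ℝ (unitBump d) y :=
    ((unitBump d).hasCompactSupport.fderiv (𝕜 := ℝ)).mono fun y hy => by
      rw [Function.mem_support] at hy ⊢
      exact fun h => hy (by rw [h, smul_zero])
  obtain ⟨C, hC⟩ := hcf.bounded_above_of_compact_support hcs
  refine ⟨C, (norm_nonneg _).trans (hC 0), fun x₀ s hs x j => ?_⟩
  refine le_trans ?_ (hC (s • (x - x₀)))
  rw [fderiv_scaledBump, norm_smul, norm_norm, norm_smul, abs_mul, Real.norm_eq_abs, abs_of_pos hs]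
  have h1 : |fderiv ℝ (unitBump d) (s • (x - x₀)) (stdVec j)|
      ≤ ‖fderiv ℝ (unitBump d) (s • (x - x₀))‖ := by
    have := (fderiv ℝ (unitBump d) (s • (x - x₀))).le_opNorm (stdVec j)
    simpa using this
  calc ‖x - x₀‖ * (s * |fderiv ℝ (unitBump d) (s • (x - x₀)) (stdVec j)|)
      = s * ‖x - x₀‖ * |fderiv ℝ (unitBump d) (s • (x - x₀)) (stdVec j)| := by ring
    _ ≤ _ := by gcongr

theorem scaledBump_eq_one {x₀ x : Space d} {s : ℝ} (hs : 0 < s) (h : s * ‖x - x₀‖ ≤ 1) :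
    scaledBump x₀ s x = 1 := by
  apply (unitBump d).one_of_mem_closedBall
  rw [mem_closedBall_zero_iff, norm_smul, Real.norm_eq_abs, abs_of_pos hs]
  exact h

theorem scaledBump_eq_zero {x₀ x : Space d} {s : ℝ} (hs : 0 < s) (h : 2 ≤ s * ‖x - x₀‖) :
    scaledBump x₀ s x = 0 := by
  apply (unitBump d).zero_of_le_dist
  rw [dist_zero_right, norm_smul, Real.norm_eq_abs, abs_of_pos hs]
  exact h

/-- The standard cutoff sequence. -/
noncomputable def cutoff (x₀ : Space d) (n : ℕ) (x : Space d) : ℝ :=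
  scaledBump x₀ (1 / ((n : ℝ) + 1)) x * (1 - scaledBump x₀ ((n : ℝ) + 1) x)

theorem isCutoffSeq_cutoff (x₀ : Space d) : IsCutoffSeq x₀ (cutoff x₀) := by
  have hp : ∀ n : ℕ, (0 : ℝ) < (n : ℝ) + 1 := fun n => by positivity
  have hp' : ∀ n : ℕ, (0 : ℝ) < 1 / ((n : ℝ) + 1) := fun n => by positivity
  have hnn : ∀ s x, 0 ≤ scaledBump x₀ s x := fun s x => (unitBump d).nonneg
  have hle : ∀ s x, scaledBump x₀ s x ≤ 1 := fun s x => (unitBump d).le_one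
  constructor
  · exact fun n => (contDiff_scaledBump _ _).mul (contDiff_const.sub (contDiff_scaledBump _ _))
  · intro n
    refine HasCompactSupport.of_support_subset_isCompact
      (isCompact_closedBall x₀ (2 * ((n : ℝ) + 1))) fun x hx => ?_
    by_contra hcon
    apply hx
    rw [Metric.mem_closedBall, not_le, dist_eq_norm] at hcon
    rw [cutoff, scaledBump_eq_zero (hp' n), zero_mul]
    rw [one_div, inv_mul_eq_div, le_div_iff₀ (hp n)]
    exact hcon.le
  · intro n
    rw [notMem_tsupport_iff_eventuallyEq]
    have : ∀ᶠ x in 𝓝 x₀, ‖x - x₀‖ < 1 / ((n : ℝ) + 1) := by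
      filter_upwards [Metric.ball_mem_nhds x₀ (hp' n)] with x hx
      rwa [Metric.mem_ball, dist_eq_norm] at hx
    filter_upwards [this] with x hx
    rw [cutoff, scaledBump_eq_one (s := (n : ℝ) + 1) (hp n), sub_self, mul_zero]
    · rfl
    · rw [lt_div_iff₀ (hp n)] at hx
      linarith
  · intro n x
    rw [cutoff, abs_mul, abs_of_nonneg (hnn _ _), abs_of_nonneg (sub_nonneg.2 (hle _ _))]
    exact mul_le_one₀ (hle _ _) (sub_nonneg.2 (hle _ _)) (by linarith [hnn ((n : ℝ) + 1) x])
  · obtain ⟨C, hC0, hC⟩ := exists_scaledBump_bound d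
    refine ⟨C + C, fun n x j => ?_⟩
    have h1 := (contDiff_scaledBump x₀ (1 / ((n : ℝ) + 1))).differentiable (by simp) x
    have h2 := (contDiff_scaledBump x₀ ((n : ℝ) + 1)).differentiable (by simp) x
    have h3 : HasFDerivAt (cutoff x₀ n) _ x := h1.hasFDerivAt.mul (h2.hasFDerivAt.const_sub 1)
    rw [h3.fderiv]
    simp only [add_apply, smul_apply, neg_apply, smul_eq_mul]
    have b1 := hC x₀ _ (hp' n) x j
    have b2 := hC x₀ _ (hp n) x j
    set p := fderiv ℝ (scaledBump x₀ (1 / ((n : ℝ) + 1))) x (stdVec j)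
    set q := fderiv ℝ (scaledBump x₀ ((n : ℝ) + 1)) x (stdVec j)
    set a := scaledBump x₀ (1 / ((n : ℝ) + 1)) x
    set b := scaledBump x₀ ((n : ℝ) + 1) x
    have ha : |a| ≤ 1 := by rw [abs_of_nonneg (hnn _ _)]; exact hle _ _
    have hb : |1 - b| ≤ 1 := by
      rw [abs_of_nonneg (sub_nonneg.2 (hle _ _))]; linarith [hnn ((n : ℝ) + 1) x]
    have h4 : |a * -q + (1 - b) * p| ≤ |q| + |p| := by
      refine (abs_add_le _ _).trans (add_le_add ?_ ?_)
      · rw [abs_mul, abs_neg]; exact mul_le_of_le_one_left (abs_nonneg _) ha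
      · rw [abs_mul]; exact mul_le_of_le_one_left (abs_nonneg _) hb
    calc ‖x - x₀‖ * |a * -q + (1 - b) * p| ≤ ‖x - x₀‖ * (|q| + |p|) := by gcongr
      _ ≤ C + C := by rw [mul_add]; exact add_le_add b2 b1
  · intro x hx
    have hr : 0 < ‖x - x₀‖ := by simpa [sub_eq_zero] using hx
    have hcont : Continuous fun y : Space d => ‖y - x₀‖ := (continuous_id.sub continuous_const).norm
    have t1 : Tendsto (fun n : ℕ => (n : ℝ) + 1) atTop atTop :=
      tendsto_atTop_add_const_right _ _ tendsto_natCast_atTop_atTop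
    filter_upwards [t1.eventually_gt_atTop ‖x - x₀‖, t1.eventually_gt_atTop (2 / ‖x - x₀‖)]
      with n h1 h2
    rw [div_lt_iff₀ hr] at h2
    have e1 : ∀ᶠ y in 𝓝 x, ‖y - x₀‖ < (n : ℝ) + 1 :=
      hcont.continuousAt.eventually_lt_const h1
    have e2 : ∀ᶠ y in 𝓝 x, 2 < ((n : ℝ) + 1) * ‖y - x₀‖ :=
      (hcont.const_mul _ |>.continuousAt).eventually_const_lt h2
    filter_upwards [e1, e2] with y hy1 hy2
    rw [cutoff, scaledBump_eq_one (hp' n), scaledBump_eq_zero (hp n) hy2.le]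
    · simp
    · rw [one_div, inv_mul_eq_div, div_le_one (hp n)]
      exact hy1.le

end Cutoff

/-! ### Virial identities -/

section Virial

open Topology

variable {d N : ℕ}

theorem integral_inner_const_magPartial {A : Space d → Space d} (hA : MulH1 A N)
    (S : Spinor N →L[ℂ] Spinor N) (ψ : SobolevH1 d N) (j : Fin d) :
    (∫ x, inner ℂ ((ψ : SpinorL2 d N) x) (S (magPartial A ψ j x)))
      + ∫ x, inner ℂ (magPartial A ψ j x) (S ((ψ : SpinorL2 d N) x)) = 0 := by
  have hM : IsBddC1Field (fun _ : Space d => S) :=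
    ⟨contDiff_const, ⟨‖S‖, fun _ => le_rfl⟩, fun j => ⟨0, fun x => by simp⟩⟩
  rw [integral_inner_field_magPartial hA hM]
  simp

/-- The magnetic field satisfies `|x - x₀| |B| ψ ∈ L²` for all `ψ ∈ H¹`. -/
def FieldMulH1 (x₀ : Space d) (B : Space d → Matrix (Fin d) (Fin d) ℝ) (N : ℕ) : Prop :=
  ∀ ψ : SobolevH1 d N,
    MemLp (fun x => (‖x - x₀‖ * ‖B x‖) • (ψ : SpinorL2 d N) x) 2 volume

theorem abs_entry_le (M : Matrix (Fin d) (Fin d) ℝ) (j k : Fin d) : |M j k| ≤ ‖M‖ := by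
  have h1 := Matrix.l2_opNorm_mulVec M (stdVec k)
  have h2 : (WithLp.toLp 2 (M *ᵥ (stdVec k : Space d).ofLp) : Space d) j = M j k := by
    simp
  have h3 := abs_coord_le (WithLp.toLp 2 (M *ᵥ (stdVec k : Space d).ofLp) : Space d) j
  rw [h2] at h3
  refine h3.trans (h1.trans ?_)
  simp

theorem MemL2Loc.aestronglyMeasurable_entry {B : Space d → Matrix (Fin d) (Fin d) ℝ}
    (hB : MemL2Loc B) (j k : Fin d) : AEStronglyMeasurable (fun x => B x j k) volume :=
  (hB.locallyIntegrable_entry j k).aestronglyMeasurable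

theorem FieldMulH1.memLp {x₀ : Space d} {B : Space d → Matrix (Fin d) (Fin d) ℝ}
    (h : FieldMulH1 x₀ B N) (hB : MemL2Loc B) {w : Space d → ℝ}
    (hw : AEStronglyMeasurable w volume) {C : ℝ} (hC : ∀ x, |w x| ≤ C * ‖x - x₀‖) (j k : Fin d)
    (ψ : SobolevH1 d N) :
    MemLp (fun x => ((w x * B x j k : ℝ) : ℂ) • (ψ : SpinorL2 d N) x) 2 volume := by
  refine (h ψ).of_le_mul (c := C) ?_ (Eventually.of_forall fun x => ?_)
  · exact (Complex.continuous_ofReal.comp_aestronglyMeasurable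
      (hw.mul (hB.aestronglyMeasurable_entry j k))).smul (Lp.aestronglyMeasurable _)
  · rw [norm_smul, norm_smul, Complex.norm_real, Real.norm_eq_abs, Real.norm_eq_abs, abs_mul,
      abs_of_nonneg (by positivity : 0 ≤ ‖x - x₀‖ * ‖B x‖), ← mul_assoc, ← mul_assoc]
    have h1 := hC x
    have h2 := abs_entry_le (B x) j k
    have h3 : 0 ≤ C * ‖x - x₀‖ := (abs_nonneg _).trans h1
    gcongr

theorem norm_inner_clm_le (S : Spinor N →L[ℂ] Spinor N) (a b : Spinor N) :
    ‖(inner ℂ a (S b) : ℂ)‖ ≤ ‖S‖ * (‖a‖ * ‖b‖) := by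
  calc ‖(inner ℂ a (S b) : ℂ)‖ ≤ ‖a‖ * ‖S b‖ := norm_inner_le_norm _ _
    _ ≤ ‖a‖ * (‖S‖ * ‖b‖) := by gcongr; exact S.le_opNorm b
    _ = _ := by ring

theorem MemLp.integrable_norm_mul_norm {f g : Space d → Spinor N} (hf : MemLp f 2 volume)
    (hg : MemLp g 2 volume) : Integrable (fun x => ‖f x‖ * ‖g x‖) volume :=
  hf.norm.integrable_mul hg.norm

variable {A : Space d → Space d} {B : Space d → Matrix (Fin d) (Fin d) ℝ} {x₀ : Space d}

theorem IsCutoffSeq.ae_tendsto {η : ℕ → Space d → ℝ} (hη : IsCutoffSeq x₀ η) (hd : 3 ≤ d) :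
    ∀ᵐ x : Space d, Tendsto (fun n => η n x) atTop (𝓝 1) ∧
      ∀ j, Tendsto (fun n => fderiv ℝ (η n) x (stdVec j)) atTop (𝓝 0) := by
  filter_upwards [ae_ne_point (by omega) x₀] with x hx
  constructor
  · refine tendsto_const_nhds.congr' ?_
    filter_upwards [hη.eventually_eq_one x hx] with n hn
    exact hn.eq_of_nhds.symm
  · intro j
    refine tendsto_const_nhds.congr' ?_
    filter_upwards [hη.eventually_eq_one x hx] with n hn
    rw [hn.fderiv_eq]
    simp

/-- Each cutoff vanishes near `x₀`, so `η_n B` is dominated by a multiple of `|x - x₀| |B|`, the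
quantity controlled by assumption. -/
theorem IsCutoffSeq.exists_abs_le {η : ℕ → Space d → ℝ} (hη : IsCutoffSeq x₀ η) (n : ℕ) :
    ∃ C, ∀ x, |η n x| ≤ C * ‖x - x₀‖ := by
  have h := hη.notMem_tsupport n
  obtain ⟨ε, hε, hball⟩ := Metric.isOpen_iff.1 (isClosed_tsupport (η n)).isOpen_compl x₀ h
  refine ⟨ε⁻¹, fun x => ?_⟩
  by_cases hx : ‖x - x₀‖ < ε
  · have : x ∉ tsupport (η n) := hball (by rwa [Metric.mem_ball, dist_eq_norm])
    rw [image_eq_zero_of_notMem_tsupport this, abs_zero]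
    positivity
  · refine (hη.abs_le_one n x).trans ?_
    rw [inv_mul_eq_div, le_div_iff₀ hε]
    linarith [not_lt.1 hx]

/-- The density `|B||ψ|²` factors into `|ψ|/|x - x₀|` and `|x - x₀||B||ψ|`, both in `L²`: the first
by Hardy, the second by assumption. -/
theorem FieldMulH1.integrable_entry (hBm : FieldMulH1 x₀ B N) (hmul : MulH1 A N)
    (hB : MemL2Loc B) (hd : 3 ≤ d) (S : Spinor N →L[ℂ] Spinor N) (j k : Fin d)
    (ψ : SobolevH1 d N) :
    Integrable (fun x => (B x j k : ℂ) *
      inner ℂ ((ψ : SpinorL2 d N) x) (S ((ψ : SpinorL2 d N) x))) volume := by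
  have m0 := Lp.memLp (ψ : SpinorL2 d N)
  have mY := memLp_hardyQuot hmul x₀ hd ψ
  refine ((MemLp.integrable_norm_mul_norm mY (hBm ψ)).const_mul ‖S‖).mono' ?_ ?_
  · exact (Complex.continuous_ofReal.comp_aestronglyMeasurable
      (hB.aestronglyMeasurable_entry j k)).mul
      (MemLp.integrable_spinor_inner m0 ((IsBddField.const S).memLp m0)).1
  · filter_upwards [ae_ne_point (by omega) x₀] with x hx
    have hr : 0 < ‖x - x₀‖ := by simpa [sub_eq_zero] using hx
    rw [norm_mul, Complex.norm_real, hardyQuot, norm_smul, norm_smul, norm_inv, norm_norm,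
      norm_mul, norm_norm, norm_norm]
    calc |B x j k| * ‖(inner ℂ ((ψ : SpinorL2 d N) x) (S ((ψ : SpinorL2 d N) x)) : ℂ)‖
        ≤ ‖B x‖ * (‖S‖ * (‖(ψ : SpinorL2 d N) x‖ * ‖(ψ : SpinorL2 d N) x‖)) :=
          mul_le_mul (abs_entry_le _ _ _) (norm_inner_clm_le _ _ _) (norm_nonneg _)
            (norm_nonneg _)
      _ = _ := by field_simp

/-- The commutator identity `[∇_j, ∇_k] = -i B_jk` in quadratic form. -/
theorem integral_commutator_eq (hd : 3 ≤ d) (hA : MemL2Loc A) (hmul : MulH1 A N)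
    (hB : MemL2Loc B) (hAB : IsMagneticField A B) (hBm : FieldMulH1 x₀ B N)
    (S : Spinor N →L[ℂ] Spinor N) (j k : Fin d) (ψ : SobolevH1 d N) :
    (∫ x, inner ℂ (magPartial A ψ j x) (S (magPartial A ψ k x)))
      - (∫ x, inner ℂ (magPartial A ψ k x) (S (magPartial A ψ j x)))
    = Complex.I * ∫ x, (B x j k : ℂ) *
          inner ℂ ((ψ : SpinorL2 d N) x) (S ((ψ : SpinorL2 d N) x)) := by
  set η := cutoff x₀
  have hη : IsCutoffSeq x₀ η := isCutoffSeq_cutoff x₀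
  have hae := hη.ae_tendsto hd
  have mD := fun i => hmul.memLp_magPartial ψ i
  have m0 := Lp.memLp (ψ : SpinorL2 d N)
  have mY := memLp_hardyQuot hmul x₀ hd ψ
  have hηm : ∀ n, AEStronglyMeasurable (fun x => (η n x : ℂ)) volume := fun n =>
    (Complex.continuous_ofReal.comp (hη.contDiff n).continuous).aestronglyMeasurable
  have iDD : ∀ a b, Integrable fun x => (inner ℂ (magPartial A ψ a x) (S (magPartial A ψ b x)) : ℂ) :=
    fun a b => MemLp.integrable_spinor_inner (mD a) ((IsBddField.const S).memLp (mD b))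
  have t1 : ∀ a b, Tendsto (fun n => ∫ x, (η n x : ℂ) *
      inner ℂ (magPartial A ψ a x) (S (magPartial A ψ b x))) atTop
      (𝓝 (∫ x, inner ℂ (magPartial A ψ a x) (S (magPartial A ψ b x)))) := by
    intro a b
    refine tendsto_integral_of_dominated_convergence _ (fun n => (hηm n).mul (iDD a b).1)
      (iDD a b).norm (fun n => Eventually.of_forall fun x => ?_) ?_
    · rw [norm_mul, Complex.norm_real]
      exact mul_le_of_le_one_left (norm_nonneg _) (hη.abs_le_one n x)
    · filter_upwards [hae] with x hx
      have := ((Complex.continuous_ofReal.tendsto _).comp hx.1).mul_const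
        (inner ℂ (magPartial A ψ a x) (S (magPartial A ψ b x)))
      simpa using this
  have i3 := hBm.integrable_entry hmul hB hd S j k ψ
  have t3 : Tendsto (fun n => ∫ x, ((η n x * B x j k : ℝ) : ℂ) *
      inner ℂ ((ψ : SpinorL2 d N) x) (S ((ψ : SpinorL2 d N) x))) atTop
      (𝓝 (∫ x, (B x j k : ℂ) * inner ℂ ((ψ : SpinorL2 d N) x) (S ((ψ : SpinorL2 d N) x)))) := by
    have e : ∀ n x, ((η n x * B x j k : ℝ) : ℂ) *
        inner ℂ ((ψ : SpinorL2 d N) x) (S ((ψ : SpinorL2 d N) x))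
        = (η n x : ℂ) * ((B x j k : ℂ) *
          inner ℂ ((ψ : SpinorL2 d N) x) (S ((ψ : SpinorL2 d N) x))) := by
      intro n x; push_cast; ring
    simp_rw [e]
    refine tendsto_integral_of_dominated_convergence _ (fun n => (hηm n).mul i3.1)
      i3.norm (fun n => Eventually.of_forall fun x => ?_) ?_
    · rw [norm_mul, Complex.norm_real]
      exact mul_le_of_le_one_left (norm_nonneg _) (hη.abs_le_one n x)
    · filter_upwards [hae] with x hx
      have := ((Complex.continuous_ofReal.tendsto _).comp hx.1).mul_const
        ((B x j k : ℂ) * inner ℂ ((ψ : SpinorL2 d N) x) (S ((ψ : SpinorL2 d N) x)))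
      simpa using this
  obtain ⟨C, hC⟩ := hη.bdd_deriv
  -- The cutoff errors: they vanish eventually at each `x ≠ x₀`, and `|∇η_n| ≤ C/|x - x₀|` gives the
  -- majorant `|ψ|/|x - x₀| · |∇_A ψ|`.
  have t4 : ∀ a b, Tendsto (fun n => ∫ x, (fderiv ℝ (η n) x (stdVec a) : ℂ) *
      inner ℂ ((ψ : SpinorL2 d N) x) (S (magPartial A ψ b x))) atTop (𝓝 0) := by
    intro a b
    rw [show (0 : ℂ) = ∫ _ : Space d, (0 : ℂ) by simp]
    refine tendsto_integral_of_dominated_convergence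
      (fun x => C * ‖S‖ * (‖hardyQuot x₀ ψ x‖ * ‖magPartial A ψ b x‖)) (fun n => ?_)
      ((MemLp.integrable_norm_mul_norm mY (mD b)).const_mul _) (fun n => ?_) ?_
    · exact ((Complex.continuous_ofReal.comp
        (continuous_partial a (hη.contDiff n))).aestronglyMeasurable).mul
        (MemLp.integrable_spinor_inner m0 ((IsBddField.const S).memLp (mD b))).1
    · filter_upwards [ae_ne_point (by omega) x₀] with x hx
      have hr : 0 < ‖x - x₀‖ := by simpa [sub_eq_zero] using hx
      rw [norm_mul, Complex.norm_real, hardyQuot, norm_smul, norm_inv, norm_norm]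
      have h1 := hC n x a
      calc |fderiv ℝ (η n) x (stdVec a)| *
            ‖(inner ℂ ((ψ : SpinorL2 d N) x) (S (magPartial A ψ b x)) : ℂ)‖
          ≤ |fderiv ℝ (η n) x (stdVec a)| *
            (‖S‖ * (‖(ψ : SpinorL2 d N) x‖ * ‖magPartial A ψ b x‖)) := by
            gcongr; exact norm_inner_clm_le _ _ _
        _ = ‖x - x₀‖ * |fderiv ℝ (η n) x (stdVec a)| * (‖S‖ * (‖x - x₀‖⁻¹ *
            ‖(ψ : SpinorL2 d N) x‖ * ‖magPartial A ψ b x‖)) := by field_simp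
        _ ≤ C * (‖S‖ * (‖x - x₀‖⁻¹ * ‖(ψ : SpinorL2 d N) x‖ * ‖magPartial A ψ b x‖)) := by
            gcongr
        _ = _ := by ring
    · filter_upwards [hae] with x hx
      have := ((Complex.continuous_ofReal.tendsto _).comp (hx.2 a)).mul_const
        (inner ℂ ((ψ : SpinorL2 d N) x) (S (magPartial A ψ b x)))
      simpa using this
  have hfin := fun n => integral_commutator hA hmul hB hAB (hη.contDiff n)
    (hη.hasCompactSupport n) S j k (fun ψ => by
      obtain ⟨C, hC⟩ := hη.exists_abs_le n
      exact hBm.memLp hB (hη.contDiff n).continuous.aestronglyMeasurable hC j k ψ) ψ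
  have h1 := (t1 j k).sub (t1 k j)
  have h2 := ((t3.const_mul Complex.I).sub (t4 j k)).add (t4 k j)
  have h3 := tendsto_nhds_unique (h1.congr hfin) h2
  simpa using h3

/-- The coordinates of the dilation field, cut off near `x₀` and infinity. -/
noncomputable def dilation (x₀ : Space d) (n : ℕ) (k : Fin d) (x : Space d) : ℝ :=
  (x - x₀) k * cutoff x₀ n x

theorem contDiff_dilation (x₀ : Space d) (n : ℕ) (k : Fin d) :
    ContDiff ℝ ∞ (dilation x₀ n k) :=
  ((coordCLM k).contDiff.comp (contDiff_id.sub contDiff_const)).mul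
    ((isCutoffSeq_cutoff x₀).contDiff n)

theorem fderiv_dilation (x₀ : Space d) (n : ℕ) (k j : Fin d) (x : Space d) :
    fderiv ℝ (dilation x₀ n k) x (stdVec j)
      = (if j = k then 1 else 0) * cutoff x₀ n x
        + (x - x₀) k * fderiv ℝ (cutoff x₀ n) x (stdVec j) := by
  have h1 : HasFDerivAt (fun x : Space d => (x - x₀) k) (coordCLM k) x :=
    (coordCLM k).hasFDerivAt.comp x ((hasFDerivAt_id x).sub_const x₀)
  have h2 := ((isCutoffSeq_cutoff x₀).contDiff n).differentiable (by simp) x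
  have h3 : HasFDerivAt (dilation x₀ n k) _ x := h1.mul h2.hasFDerivAt
  have e1 : (stdVec j : Space d) k = if j = k then 1 else 0 := by simp [eq_comm]
  rw [h3.fderiv]
  simp only [add_apply, smul_apply, coordCLM_apply, e1, smul_eq_mul]
  ring

theorem hasCompactSupport_dilation (x₀ : Space d) (n : ℕ) (k : Fin d) :
    HasCompactSupport (dilation x₀ n k) :=
  ((isCutoffSeq_cutoff x₀).hasCompactSupport n).mul_left

theorem abs_dilation_le (x₀ : Space d) (n : ℕ) (k : Fin d) (x : Space d) :
    |dilation x₀ n k x| ≤ 1 * ‖x - x₀‖ := by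
  rw [dilation, abs_mul, one_mul]
  exact (mul_le_of_le_one_right (abs_nonneg _) ((isCutoffSeq_cutoff x₀).abs_le_one n x)).trans
    (abs_coord_le _ _)

theorem dilation_eventuallyEq_zero (x₀ : Space d) (n : ℕ) (k : Fin d) :
    dilation x₀ n k =ᶠ[𝓝 x₀] 0 := by
  have := notMem_tsupport_iff_eventuallyEq.1 ((isCutoffSeq_cutoff x₀).notMem_tsupport n)
  filter_upwards [this] with x hx
  rw [dilation, hx, Pi.zero_apply, mul_zero]

theorem zero_real_smul_clm (T : Spinor N →L[ℂ] Spinor N) : (0 : ℝ) • T = 0 := by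
  ext1 v
  exact zero_smul ℝ (T v)

/-- The cutoff removes the singularity of `W` at `x₀`, so the product is `C¹` with compact support,
and hence an admissible field for the integration by parts. -/
theorem isBddC1Field_dilation_smul {W : Space d → Spinor N →L[ℂ] Spinor N}
    (hW : ContDiffOn ℝ 1 W {x₀}ᶜ) (n : ℕ) (k : Fin d) :
    IsBddC1Field fun x => dilation x₀ n k x • W x := by
  have hc : ContDiff ℝ 1 fun x => dilation x₀ n k x • W x := by
    rw [contDiff_iff_contDiffAt]
    intro x
    by_cases hx : x = x₀
    · subst hx
      refine (contDiffAt_const (c := (0 : Spinor N →L[ℂ] Spinor N))).congr_of_eventuallyEq ?_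
      filter_upwards [dilation_eventuallyEq_zero x n k] with y hy
      rw [hy, Pi.zero_apply]
      exact zero_real_smul_clm _
    · exact ((contDiff_dilation x₀ n k).of_le (by simp)).contDiffAt.smul
        (hW.contDiffAt (isOpen_compl_singleton.mem_nhds hx))
  have hs : HasCompactSupport fun x => dilation x₀ n k x • W x :=
    (hasCompactSupport_dilation x₀ n k).mono fun x hx => by
      rw [Function.mem_support] at hx ⊢
      exact fun h => hx (by rw [h]; exact zero_real_smul_clm _)
  refine ⟨hc, hc.continuous.bounded_above_of_compact_support hs, fun j => ?_⟩
  exact ((hc.continuous_fderiv one_ne_zero).clm_apply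
    continuous_const).bounded_above_of_compact_support (hs.fderiv_apply (𝕜 := ℝ) (stdVec j))

theorem fderiv_dilation_smul {W : Space d → Spinor N →L[ℂ] Spinor N}
    (hW : ContDiffOn ℝ 1 W {x₀}ᶜ) (n : ℕ) (k : Fin d) {x : Space d} (hx : x ≠ x₀) (v : Space d) :
    fderiv ℝ (fun x => dilation x₀ n k x • W x) x v
      = dilation x₀ n k x • fderiv ℝ W x v + (fderiv ℝ (dilation x₀ n k) x v) • W x := by
  have h1 := ((contDiff_dilation x₀ n k).differentiable (by simp) x).hasFDerivAt
  have h2 := ((hW.contDiffAt (isOpen_compl_singleton.mem_nhds hx)).differentiableAt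
    one_ne_zero).hasFDerivAt
  have h3 : HasFDerivAt (fun x => dilation x₀ n k x • W x) _ x := h1.smul h2
  rw [h3.fderiv]
  rfl

end Virial

/-! ### The virial identity for a cut off dilation field -/

section DilationVirial

open Topology

variable {d N : ℕ}
variable {A : Space d → Space d} {B : Space d → Matrix (Fin d) (Fin d) ℝ} {x₀ : Space d}

theorem Integrable.ofReal_mul_of_hasCompactSupport {f : Space d → ℂ} (hf : Integrable f volume)
    {w : Space d → ℝ} (hw : Continuous w) (hc : HasCompactSupport w) :
    Integrable (fun x => (w x : ℂ) * f x) volume := by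
  obtain ⟨C, hC⟩ := hw.bounded_above_of_compact_support hc
  exact hf.bdd_mul (Complex.continuous_ofReal.comp hw).aestronglyMeasurable
    (Eventually.of_forall fun x => by rw [Complex.norm_real]; exact hC x)

theorem inner_real_smul_right (c : ℝ) (a b : Spinor N) :
    (inner ℂ a (c • b) : ℂ) = c * inner ℂ a b := by
  rw [← Complex.coe_smul, inner_smul_right]

/-- The virial identity with the cut off dilation field, for solutions of `α·∇_A ψ = i W ψ`. -/
theorem virial_dilation (hA : MemL2Loc A) (hmul : MulH1 A N)
    (hB : MemL2Loc B) (hAB : IsMagneticField A B) (hBm : FieldMulH1 x₀ B N) (hd : 3 ≤ d)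
    {a : Fin d → Spinor N →L[ℂ] Spinor N}
    (ha : ∀ j u v, (inner ℂ (a j u) v : ℂ) = inner ℂ u (a j v))
    {W : Space d → Spinor N →L[ℂ] Spinor N} (hW : ContDiffOn ℝ 1 W {x₀}ᶜ)
    (hWs : ∀ᵐ x, ∀ u v, (inner ℂ (W x u) v : ℂ) = inner ℂ u (W x v))
    {ψ : SobolevH1 d N}
    (heq : ∀ᵐ x, ∑ j, a j (magPartial A ψ j x) = Complex.I • W x ((ψ : SpinorL2 d N) x))
    (k : Fin d) (n : ℕ) :
    ∫ x, (dilation x₀ n k x : ℂ) * inner ℂ ((ψ : SpinorL2 d N) x)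
        (fderiv ℝ W x (stdVec k) ((ψ : SpinorL2 d N) x))
      = -(∑ j, ∫ x, ((dilation x₀ n k x * B x k j : ℝ) : ℂ) *
          inner ℂ ((ψ : SpinorL2 d N) x) (a j ((ψ : SpinorL2 d N) x)))
        + Complex.I * ∑ j, ∫ x, (fderiv ℝ (dilation x₀ n k) x (stdVec j) : ℂ) *
          inner ℂ ((ψ : SpinorL2 d N) x) (a j (magPartial A ψ k x)) := by
  have hFc := contDiff_dilation x₀ n k
  have hFs := hasCompactSupport_dilation x₀ n k
  have hM := isBddC1Field_dilation_smul hW n k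
  have mD := fun i => hmul.memLp_magPartial ψ i
  have m0 := Lp.memLp (ψ : SpinorL2 d N)
  have iDD : ∀ p q j, Integrable fun x =>
      (dilation x₀ n k x : ℂ) * (inner ℂ (magPartial A ψ p x) (a j (magPartial A ψ q x)) : ℂ) := fun p q j =>
    Integrable.ofReal_mul_of_hasCompactSupport
      (MemLp.integrable_spinor_inner (mD p) ((IsBddField.const (a j)).memLp (mD q)))
      hFc.continuous hFs
  have iψD : ∀ q j i, Integrable fun x => (fderiv ℝ (dilation x₀ n k) x (stdVec i) : ℂ) *
      (inner ℂ ((ψ : SpinorL2 d N) x) (a j (magPartial A ψ q x)) : ℂ) := fun q j i =>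
    Integrable.ofReal_mul_of_hasCompactSupport
      (MemLp.integrable_spinor_inner m0 ((IsBddField.const (a j)).memLp (mD q)))
      (continuous_partial i hFc) (hFs.fderiv_apply (𝕜 := ℝ) (stdVec i))
  -- The commutator of `∇_k` and `∇_j` is tested with the weight `F = (x - x₀)_k η_n` and the matrix
  -- `a_j`. After summation over `j` the derivatives combine to `α·∇_A ψ`, for which the equation
  -- substitutes `i W ψ`; this avoids second derivatives of `ψ`.
  have hcomm := fun j => integral_commutator hA hmul hB hAB hFc hFs (a j) k j
    (hBm.memLp hB hFc.continuous.aestronglyMeasurable (abs_dilation_le x₀ n k) k j) ψ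
  have hsum := Finset.sum_congr (s₁ := Finset.univ) rfl fun j _ => hcomm j
  rw [Finset.sum_sub_distrib, Finset.sum_add_distrib, Finset.sum_sub_distrib, ← Finset.mul_sum,
    ← integral_finsetSum _ fun j _ => iDD k j j, ← integral_finsetSum _ fun j _ => iDD j k j,
    ← integral_finsetSum _ fun j _ => iψD j j k] at hsum
  have e1 : ∫ x, ∑ j, (dilation x₀ n k x : ℂ) * (inner ℂ (magPartial A ψ k x) (a j (magPartial A ψ j x)) : ℂ)
      = Complex.I * ∫ x, inner ℂ (magPartial A ψ k x) ((dilation x₀ n k x • W x) ((ψ : SpinorL2 d N) x)) := by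
    rw [← integral_const_mul]
    refine integral_congr_ae ?_
    filter_upwards [heq] with x hx
    rw [← Finset.mul_sum, ← inner_sum, hx, inner_smul_right]
    refine Eq.trans ?_ (congrArg _ (inner_real_smul_right (dilation x₀ n k x) (magPartial A ψ k x) (W x ((ψ : SpinorL2 d N) x))).symm)
    ring
  have e2 : ∫ x, ∑ j, (dilation x₀ n k x : ℂ) * (inner ℂ (magPartial A ψ j x) (a j (magPartial A ψ k x)) : ℂ)
      = -Complex.I * ∫ x, inner ℂ ((ψ : SpinorL2 d N) x) ((dilation x₀ n k x • W x) (magPartial A ψ k x)) := by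
    rw [← integral_const_mul]
    refine integral_congr_ae ?_
    filter_upwards [heq, hWs] with x hx hx'
    simp_rw [← ha]
    rw [← Finset.mul_sum, ← sum_inner, hx, inner_smul_left, hx', Complex.conj_I]
    refine Eq.trans ?_ (congrArg _ (inner_real_smul_right (dilation x₀ n k x) ((ψ : SpinorL2 d N) x) (W x (magPartial A ψ k x))).symm)
    ring
  -- This term cancels the one that the product rule for `∂_k (F W)` produces when the derivative
  -- falls on `F`.
  have e3 : ∫ x, ∑ j, (fderiv ℝ (dilation x₀ n k) x (stdVec k) : ℂ) *
      (inner ℂ ((ψ : SpinorL2 d N) x) (a j (magPartial A ψ j x)) : ℂ)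
      = Complex.I * ∫ x, (fderiv ℝ (dilation x₀ n k) x (stdVec k) : ℂ) *
        inner ℂ ((ψ : SpinorL2 d N) x) (W x ((ψ : SpinorL2 d N) x)) := by
    rw [← integral_const_mul]
    refine integral_congr_ae ?_
    filter_upwards [heq] with x hx
    rw [← Finset.mul_sum, ← inner_sum, hx, inner_smul_right]
    ring
  have hibp := integral_inner_field_magPartial hmul hM ψ k
  have iM := MemLp.integrable_spinor_inner m0 ((hM.isBddField_deriv k).memLp m0)
  have cW : ContinuousOn W {x₀}ᶜ := hW.continuousOn
  have hM2 : IsBddField fun x => (fderiv ℝ (dilation x₀ n k) x (stdVec k)) • W x := by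
    have hs : HasCompactSupport fun x => (fderiv ℝ (dilation x₀ n k) x (stdVec k)) • W x :=
      (hFs.fderiv_apply (𝕜 := ℝ) (stdVec k)).mono fun x hx => by
        rw [Function.mem_support] at hx ⊢
        exact fun h => hx (by rw [h]; exact zero_real_smul_clm _)
    have hc : Continuous fun x => (fderiv ℝ (dilation x₀ n k) x (stdVec k)) • W x := by
      rw [continuous_iff_continuousAt]
      intro x
      by_cases hx : x = x₀
      · subst hx
        refine (continuousAt_const (y := (0 : Spinor N →L[ℂ] Spinor N))).congr ?_
        filter_upwards [(dilation_eventuallyEq_zero x n k).fderiv (𝕜 := ℝ)] with y hy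
        rw [hy]
        simp only [Pi.zero_def, fderiv_fun_const, zero_apply]
        exact (zero_real_smul_clm _).symm
      · exact (continuous_partial k hFc).continuousAt.smul
          (cW.continuousAt (isOpen_compl_singleton.mem_nhds hx))
    exact ⟨hc.aestronglyMeasurable, hc.bounded_above_of_compact_support hs⟩
  have iM2 := MemLp.integrable_spinor_inner m0 (hM2.memLp m0)
  have e4 : ∫ x, (dilation x₀ n k x : ℂ) * inner ℂ ((ψ : SpinorL2 d N) x)
        (fderiv ℝ W x (stdVec k) ((ψ : SpinorL2 d N) x))
      = (∫ x, inner ℂ ((ψ : SpinorL2 d N) x)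
          (fderiv ℝ (fun x => dilation x₀ n k x • W x) x (stdVec k) ((ψ : SpinorL2 d N) x)))
        - ∫ x, (fderiv ℝ (dilation x₀ n k) x (stdVec k) : ℂ) *
          inner ℂ ((ψ : SpinorL2 d N) x) (W x ((ψ : SpinorL2 d N) x)) := by
    have e5 : ∫ x, (fderiv ℝ (dilation x₀ n k) x (stdVec k) : ℂ) *
          inner ℂ ((ψ : SpinorL2 d N) x) (W x ((ψ : SpinorL2 d N) x))
        = ∫ x, inner ℂ ((ψ : SpinorL2 d N) x)
          (((fderiv ℝ (dilation x₀ n k) x (stdVec k)) • W x) ((ψ : SpinorL2 d N) x)) :=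
      integral_congr_ae (Eventually.of_forall fun x => (inner_real_smul_right _ _ _).symm)
    rw [e5, ← integral_sub iM iM2]
    refine integral_congr_ae ?_
    filter_upwards [ae_ne_point (by omega) x₀] with x hx
    rw [← inner_sub_right, fderiv_dilation_smul hW n k hx, ← inner_real_smul_right]
    congr 1
    rw [add_apply, add_sub_cancel_right]
    rfl
  rw [e1, e2, e3] at hsum
  rw [e4]
  linear_combination hibp + Complex.I * hsum
    - ((∫ x, inner ℂ (magPartial A ψ k x) ((dilation x₀ n k x • W x) ((ψ : SpinorL2 d N) x)))
      + (∫ x, inner ℂ ((ψ : SpinorL2 d N) x) ((dilation x₀ n k x • W x) (magPartial A ψ k x)))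
      - (∑ j, ∫ x, ((dilation x₀ n k x * B x k j : ℝ) : ℂ) *
          inner ℂ ((ψ : SpinorL2 d N) x) (a j ((ψ : SpinorL2 d N) x)))
      + ∫ x, (fderiv ℝ (dilation x₀ n k) x (stdVec k) : ℂ) *
        inner ℂ ((ψ : SpinorL2 d N) x) (W x ((ψ : SpinorL2 d N) x))) * Complex.I_sq

end DilationVirial

/-! ### Removal of the cutoff in the virial identity -/

section VirialLimit

open Topology

variable {d N : ℕ}
variable {A : Space d → Space d} {B : Space d → Matrix (Fin d) (Fin d) ℝ} {x₀ : Space d}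

theorem aestronglyMeasurable_of_continuousOn_compl_singleton {F : Type*} [NormedAddCommGroup F]
    (hd : 1 ≤ d) {f : Space d → F} (hf : ContinuousOn f {x₀}ᶜ) :
    AEStronglyMeasurable f volume := by
  have h : AEStronglyMeasurable f (volume.restrict {x₀}ᶜ) :=
    hf.aestronglyMeasurable isOpen_compl_singleton.measurableSet
  have hr : (volume : Measure (Space d)).restrict {x₀}ᶜ = volume :=
    Measure.restrict_eq_self_of_ae_mem (ae_ne_point hd x₀)
  rwa [hr] at h

theorem exists_abs_fderiv_dilation_le (x₀ : Space d) :
    ∃ C, ∀ n k j x, |fderiv ℝ (dilation x₀ n k) x (stdVec j)| ≤ C := by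
  obtain ⟨C, hC⟩ := (isCutoffSeq_cutoff x₀).bdd_deriv
  refine ⟨1 + C, fun n k j x => ?_⟩
  rw [fderiv_dilation]
  refine (abs_add_le _ _).trans (add_le_add ?_ ?_)
  · rw [abs_mul]
    refine mul_le_one₀ ?_ (abs_nonneg _) ((isCutoffSeq_cutoff x₀).abs_le_one n x)
    split_ifs <;> simp
  · rw [abs_mul]
    exact (mul_le_mul_of_nonneg_right (abs_coord_le _ _) (abs_nonneg _)).trans (hC n x j)

/-- The virial identity, in the coordinate direction `k`, for solutions of `α·∇_A ψ = i W ψ`. -/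
theorem virial_coord (hA : MemL2Loc A) (hmul : MulH1 A N)
    (hB : MemL2Loc B) (hAB : IsMagneticField A B) (hBm : FieldMulH1 x₀ B N) (hd : 3 ≤ d)
    {a : Fin d → Spinor N →L[ℂ] Spinor N}
    (ha : ∀ j u v, (inner ℂ (a j u) v : ℂ) = inner ℂ u (a j v))
    {W : Space d → Spinor N →L[ℂ] Spinor N} (hW : ContDiffOn ℝ 1 W {x₀}ᶜ)
    (hWs : ∀ᵐ x, ∀ u v, (inner ℂ (W x u) v : ℂ) = inner ℂ u (W x v))
    {ψ : SobolevH1 d N}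
    (heq : ∀ᵐ x, ∑ j, a j (magPartial A ψ j x) = Complex.I • W x ((ψ : SpinorL2 d N) x))
    (k : Fin d)
    (hint : Integrable (fun x => ‖x - x₀‖ * ‖fderiv ℝ W x (stdVec k)‖ *
      ‖(ψ : SpinorL2 d N) x‖ ^ 2) volume) :
    ∫ x, ((x - x₀) k : ℂ) * inner ℂ ((ψ : SpinorL2 d N) x)
        (fderiv ℝ W x (stdVec k) ((ψ : SpinorL2 d N) x))
      = -(∑ j, ∫ x, (((x - x₀) k * B x k j : ℝ) : ℂ) *
          inner ℂ ((ψ : SpinorL2 d N) x) (a j ((ψ : SpinorL2 d N) x)))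
        + Complex.I * ∫ x, inner ℂ ((ψ : SpinorL2 d N) x) (a k (magPartial A ψ k x)) := by
  have hη := isCutoffSeq_cutoff x₀
  have hae := hη.ae_tendsto hd
  have mD := fun i => hmul.memLp_magPartial ψ i
  have m0 := Lp.memLp (ψ : SpinorL2 d N)
  have hF : ∀ x, Tendsto (fun n => cutoff x₀ n x) atTop (𝓝 1) →
      Tendsto (fun n => dilation x₀ n k x) atTop (𝓝 ((x - x₀) k)) := fun x hx => by
    simpa [dilation] using hx.const_mul ((x - x₀) k)
  have hFm : ∀ n, AEStronglyMeasurable (fun x => (dilation x₀ n k x : ℂ)) volume := fun n =>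
    (Complex.continuous_ofReal.comp (contDiff_dilation x₀ n k).continuous).aestronglyMeasurable
  have hWm : AEStronglyMeasurable (fun x => fderiv ℝ W x (stdVec k)) volume :=
    aestronglyMeasurable_of_continuousOn_compl_singleton (by omega)
      ((hW.continuousOn_fderiv_of_isOpen isOpen_compl_singleton le_rfl).clm_apply
        continuousOn_const)
  have iD : ∀ q j, Integrable fun x =>
      (inner ℂ ((ψ : SpinorL2 d N) x) (a j (magPartial A ψ q x)) : ℂ) := fun q j =>
    MemLp.integrable_spinor_inner m0 ((IsBddField.const (a j)).memLp (mD q))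
  have t1 : Tendsto (fun n => ∫ x, (dilation x₀ n k x : ℂ) * inner ℂ ((ψ : SpinorL2 d N) x)
        (fderiv ℝ W x (stdVec k) ((ψ : SpinorL2 d N) x))) atTop
      (𝓝 (∫ x, ((x - x₀) k : ℂ) * inner ℂ ((ψ : SpinorL2 d N) x)
        (fderiv ℝ W x (stdVec k) ((ψ : SpinorL2 d N) x)))) := by
    refine tendsto_integral_of_dominated_convergence _ (fun n => (hFm n).mul
      (m0.1.inner (AEStronglyMeasurable.field_apply hWm m0.1))) hint
      (fun n => Eventually.of_forall fun x => ?_) ?_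
    · rw [norm_mul, Complex.norm_real, Real.norm_eq_abs, mul_assoc]
      have h1 := abs_dilation_le x₀ n k x
      rw [one_mul] at h1
      refine mul_le_mul h1 ((norm_inner_clm_le _ _ _).trans_eq (by rw [sq])) (norm_nonneg _)
        (norm_nonneg _)
    · filter_upwards [hae] with x hx
      exact (((Complex.continuous_ofReal.tendsto _).comp (hF x hx.1)).mul_const _)
  have t2 : ∀ j, Tendsto (fun n => ∫ x, ((dilation x₀ n k x * B x k j : ℝ) : ℂ) *
          inner ℂ ((ψ : SpinorL2 d N) x) (a j ((ψ : SpinorL2 d N) x))) atTop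
      (𝓝 (∫ x, (((x - x₀) k * B x k j : ℝ) : ℂ) *
          inner ℂ ((ψ : SpinorL2 d N) x) (a j ((ψ : SpinorL2 d N) x)))) := by
    intro j
    have hBe := hB.aestronglyMeasurable_entry k j
    have hdom : Integrable (fun x => ‖a j‖ * (‖(‖x - x₀‖ * ‖B x‖) • (ψ : SpinorL2 d N) x‖ *
        ‖(ψ : SpinorL2 d N) x‖)) volume :=
      (MemLp.integrable_norm_mul_norm (hBm ψ) m0).const_mul _
    refine tendsto_integral_of_dominated_convergence _ (fun n => ?_) hdom
      (fun n => Eventually.of_forall fun x => ?_) ?_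
    · exact (Complex.continuous_ofReal.comp_aestronglyMeasurable
        ((contDiff_dilation x₀ n k).continuous.aestronglyMeasurable.mul hBe)).mul
        (m0.1.inner ((IsBddField.const (a j)).memLp m0).1)
    · rw [norm_mul, Complex.norm_real, Real.norm_eq_abs, abs_mul, norm_smul, norm_mul, norm_norm,
        norm_norm]
      have h1 := abs_dilation_le x₀ n k x
      rw [one_mul] at h1
      calc _ ≤ (‖x - x₀‖ * ‖B x‖) *
            (‖a j‖ * (‖(ψ : SpinorL2 d N) x‖ * ‖(ψ : SpinorL2 d N) x‖)) := by
            gcongr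
            · exact abs_entry_le _ _ _
            · exact norm_inner_clm_le _ _ _
        _ = _ := by ring
    · filter_upwards [hae] with x hx
      exact (((Complex.continuous_ofReal.tendsto _).comp ((hF x hx.1).mul_const _)).mul_const _)
  -- The derivative `∂_j F_k = δ_jk η_n + (x - x₀)_k ∂_j η_n` is bounded uniformly in `n` and tends
  -- to `δ_jk`, so only the diagonal term survives.
  have t3 : ∀ j, Tendsto (fun n => ∫ x, (fderiv ℝ (dilation x₀ n k) x (stdVec j) : ℂ) *
          inner ℂ ((ψ : SpinorL2 d N) x) (a j (magPartial A ψ k x))) atTop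
      (𝓝 (∫ x, ((if j = k then 1 else 0 : ℝ) : ℂ) *
          inner ℂ ((ψ : SpinorL2 d N) x) (a j (magPartial A ψ k x)))) := by
    intro j
    obtain ⟨C, hC⟩ := exists_abs_fderiv_dilation_le x₀
    refine tendsto_integral_of_dominated_convergence _ (fun n => ?_) ((iD k j).norm.const_mul C)
      (fun n => Eventually.of_forall fun x => ?_) ?_
    · exact (Complex.continuous_ofReal.comp
        (continuous_partial j (contDiff_dilation x₀ n k))).aestronglyMeasurable.mul (iD k j).1
    · rw [norm_mul, Complex.norm_real, Real.norm_eq_abs]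
      gcongr
      exact hC n k j x
    · filter_upwards [hae] with x hx
      refine ((Complex.continuous_ofReal.tendsto _).comp ?_).mul_const _
      simp_rw [fderiv_dilation]
      simpa using (hx.1.const_mul (if j = k then (1 : ℝ) else 0)).add
        ((hx.2 j).const_mul ((x - x₀) k))
  have h := (t1.congr fun n => virial_dilation hA hmul hB hAB hBm hd ha hW hWs heq k n)
  have h' := tendsto_nhds_unique h ((tendsto_finsetSum _ fun j _ => t2 j).neg.add
    ((tendsto_finsetSum _ fun j _ => t3 j).const_mul Complex.I))
  rw [h']
  congr 2
  rw [Finset.sum_eq_single k]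
  · simp
  · intro j _ hj
    simp [hj]
  · simp

end VirialLimit

/-! ### The rank of a skew operator -/

section SkewAdjoint

variable {E : Type*} [NormedAddCommGroup E] [InnerProductSpace ℝ E] [FiniteDimensional ℝ E]

/-- In an orthonormal basis `Mᵀ = -M`, hence `det M = (-1)ⁿ det M`; a nonzero determinant forces `n`
to be even. -/
theorem even_finrank_of_skew_of_ker_eq_bot {T : E →ₗ[ℝ] E}
    (hT : ∀ x y, inner ℝ (T x) y = -inner ℝ x (T y)) (hk : LinearMap.ker T = ⊥) :
    Even (Module.finrank ℝ E) := by
  set b := stdOrthonormalBasis ℝ E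
  set M := LinearMap.toMatrix b.toBasis b.toBasis T with hM
  have hMe : ∀ i j, M i j = inner ℝ (b i) (T (b j)) := fun i j => by
    rw [hM, LinearMap.toMatrix_apply, OrthonormalBasis.coe_toBasis,
      OrthonormalBasis.coe_toBasis_repr_apply, OrthonormalBasis.repr_apply_apply]
  have hMt : M.transpose = -M := by
    ext i j
    rw [Matrix.transpose_apply, Matrix.neg_apply, hMe, hMe, ← hT, real_inner_comm]
  have hdet : M.det ≠ 0 := by
    rw [hM, LinearMap.det_toMatrix]
    have := (LinearMap.isUnit_iff_ker_eq_bot T).2 hk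
    exact (LinearMap.isUnit_iff_isUnit_det T |>.1 this).ne_zero
  have h := congrArg Matrix.det hMt
  rw [Matrix.det_transpose, Matrix.det_neg, Fintype.card_fin] at h
  rcases Nat.even_or_odd (Module.finrank ℝ E) with he | ho
  · exact he
  · rw [ho.neg_one_pow] at h
    exact absurd (by linarith) hdet

/-- The range of a skew operator is orthogonal to its kernel, so `T` restricts to an injective skew
operator on `(ker T)ᗮ`. The dimension of this space is the rank of `T`. -/
theorem even_finrank_ker_orthogonal_of_skew {T : E →ₗ[ℝ] E}
    (hT : ∀ x y, inner ℝ (T x) y = -inner ℝ x (T y)) :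
    Even (Module.finrank ℝ (LinearMap.ker T)ᗮ) := by
  have hmem : ∀ x ∈ (LinearMap.ker T)ᗮ, T x ∈ (LinearMap.ker T)ᗮ := fun x _ => by
    rw [Submodule.mem_orthogonal']
    intro u hu
    rw [hT, LinearMap.mem_ker.1 hu, inner_zero_right, neg_zero]
  refine even_finrank_of_skew_of_ker_eq_bot (T := T.restrict hmem) (fun x y => ?_) ?_
  · exact hT x y
  · rw [LinearMap.ker_eq_bot']
    intro x hx
    have h1 : T x = 0 := congrArg Subtype.val hx
    have h2 := (Submodule.mem_orthogonal _ _).1 x.2 x (LinearMap.mem_ker.2 h1)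
    exact Subtype.ext (inner_self_eq_zero.1 h2)

theorem finrank_ker_orthogonal_add_one_le_of_odd {T : E →ₗ[ℝ] E}
    (hT : ∀ x y, inner ℝ (T x) y = -inner ℝ x (T y)) (hodd : Odd (Module.finrank ℝ E)) :
    Module.finrank ℝ (LinearMap.ker T)ᗮ + 1 ≤ Module.finrank ℝ E := by
  obtain ⟨p, hp⟩ := even_finrank_ker_orthogonal_of_skew hT
  obtain ⟨q, hq⟩ := hodd
  have := Submodule.finrank_le (LinearMap.ker T)ᗮ
  omega

/-- The rank is even and smaller than the even dimension, so by parity one kernel vector lowers it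
by two. This gain drives the even dimensional estimate. -/
theorem finrank_ker_orthogonal_add_two_le_of_even {T : E →ₗ[ℝ] E}
    (hT : ∀ x y, inner ℝ (T x) y = -inner ℝ x (T y)) (heven : Even (Module.finrank ℝ E))
    {e : E} (he : e ≠ 0) (hTe : T e = 0) :
    Module.finrank ℝ (LinearMap.ker T)ᗮ + 2 ≤ Module.finrank ℝ E := by
  obtain ⟨p, hp⟩ := even_finrank_ker_orthogonal_of_skew hT
  obtain ⟨q, hq⟩ := heven
  have h := Submodule.finrank_add_finrank_orthogonal (LinearMap.ker T)
  have hpos : 0 < Module.finrank ℝ (LinearMap.ker T) := by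
    rw [Module.finrank_pos_iff_exists_ne_zero]
    exact ⟨⟨e, hTe⟩, fun hc => he (congrArg Subtype.val hc)⟩
  omega

end SkewAdjoint

/-! ### Clifford multiplication and contractions of skew operators -/

section Clifford

variable {d N : ℕ}

/-- Symmetric operators satisfying the anticommutation relations `a_j a_k + a_k a_j = 2 δ_jk`. -/
structure IsCliffordFamily (a : Fin d → Spinor N →L[ℂ] Spinor N) : Prop where
  symm : ∀ j u v, (inner ℂ (a j u) v : ℂ) = inner ℂ u (a j v)
  anticomm : ∀ j k u, a j (a k u) + a k (a j u) = (if j = k then (2 : ℂ) else 0) • u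

/-- Clifford multiplication by the vector `v`. -/
noncomputable def clifford (a : Fin d → Spinor N →L[ℂ] Spinor N) (v : Space d) :
    Spinor N →L[ℂ] Spinor N := ∑ j, (v j : ℂ) • a j

variable {a : Fin d → Spinor N →L[ℂ] Spinor N}

theorem clifford_apply (v : Space d) (u : Spinor N) :
    clifford a v u = ∑ j, (v j : ℂ) • a j u := by
  simp [clifford, sum_apply]

theorem clifford_add (v w : Space d) (u : Spinor N) :
    clifford a (v + w) u = clifford a v u + clifford a w u := by
  simp [clifford_apply, add_smul, Finset.sum_add_distrib]

theorem clifford_smul (c : ℝ) (v : Space d) (u : Spinor N) :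
    clifford a (c • v) u = (c : ℂ) • clifford a v u := by
  simp [clifford_apply, mul_smul, Finset.smul_sum]

theorem clifford_neg (v : Space d) (u : Spinor N) : clifford a (-v) u = -clifford a v u := by
  simp [clifford_apply]

theorem clifford_sum {ι : Type*} (s : Finset ι) (f : ι → Space d) (u : Spinor N) :
    clifford a (∑ i ∈ s, f i) u = ∑ i ∈ s, clifford a (f i) u := by
  classical
  induction s using Finset.induction_on with
  | empty => simp [clifford_apply]
  | insert i s hi ih => rw [Finset.sum_insert hi, Finset.sum_insert hi, clifford_add, ih]

theorem clifford_stdVec (j : Fin d) (u : Spinor N) : clifford a (stdVec j) u = a j u := by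
  rw [clifford_apply, Finset.sum_eq_single j]
  · simp
  · intro k _ hk
    simp [hk]
  · simp

theorem IsCliffordFamily.inner_clifford (ha : IsCliffordFamily a) (v : Space d) (u w : Spinor N) :
    (inner ℂ (clifford a v u) w : ℂ) = inner ℂ u (clifford a v w) := by
  rw [clifford_apply, clifford_apply, sum_inner, inner_sum]
  refine Finset.sum_congr rfl fun j _ => ?_
  rw [inner_smul_left, inner_smul_right, ha.symm, Complex.conj_ofReal]

theorem IsCliffordFamily.clifford_anticomm (ha : IsCliffordFamily a) (v w : Space d)
    (u : Spinor N) : clifford a v (clifford a w u) + clifford a w (clifford a v u)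
      = ((2 * inner ℝ v w : ℝ) : ℂ) • u := by
  simp only [clifford_apply, map_sum, map_smul, Finset.smul_sum]
  rw [Finset.sum_comm, ← Finset.sum_add_distrib]
  have h : ∀ i j, (w j : ℂ) • (v i : ℂ) • a i (a j u) + (v i : ℂ) • (w j : ℂ) • a j (a i u)
      = ((v i : ℂ) * w j * if i = j then 2 else 0) • u := fun i j => by
    rw [smul_comm (w j : ℂ), ← smul_add, ← smul_add, ha.anticomm, smul_smul, smul_smul, mul_assoc]
  simp_rw [← Finset.sum_add_distrib, h, ← Finset.sum_smul]
  congr 1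
  simp only [mul_ite, mul_zero, Finset.sum_ite_eq, Finset.mem_univ, if_true]
  rw [EuclideanSpace.inner_eq_star_dotProduct]
  simp only [dotProduct, Complex.ofReal_mul, Complex.ofReal_sum, Finset.mul_sum]
  refine Finset.sum_congr rfl fun i _ => ?_
  simp
  ring

theorem IsCliffordFamily.clifford_sq (ha : IsCliffordFamily a) (v : Space d) (u : Spinor N) :
    clifford a v (clifford a v u) = ((‖v‖ ^ 2 : ℝ) : ℂ) • u := by
  have h := ha.clifford_anticomm v v u
  rw [real_inner_self_eq_norm_sq, ← two_smul ℂ] at h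
  have h2 := congrArg (fun z => (2⁻¹ : ℂ) • z) h
  simpa [smul_smul] using h2

/-- Clifford multiplication by `v` is symmetric with square `|v|²`, so it is `|v|` times an
isometry. -/
theorem IsCliffordFamily.norm_clifford (ha : IsCliffordFamily a) (v : Space d) (u : Spinor N) :
    ‖clifford a v u‖ = ‖v‖ * ‖u‖ := by
  rw [← sq_eq_sq₀ (norm_nonneg _) (by positivity), ← inner_self_eq_norm_sq (𝕜 := ℂ),
    ha.inner_clifford, ha.clifford_sq, inner_smul_right, inner_self_eq_norm_sq_to_K]
  rw [mul_pow, ← RCLike.ofReal_pow]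
  exact (congrArg Complex.re (Complex.ofReal_mul _ _)).symm.trans (Complex.ofReal_re _)

theorem IsCliffordFamily.norm_apply (ha : IsCliffordFamily a) (j : Fin d) (u : Spinor N) :
    ‖a j u‖ = ‖u‖ := by
  rw [← clifford_stdVec, ha.norm_clifford]
  simp

/-- The Clifford contraction `∑ a_j (T e_j)` of an operator `T`. -/
noncomputable def cliffordTrace (a : Fin d → Spinor N →L[ℂ] Spinor N) (T : Space d → Space d)
    (u : Spinor N) : Spinor N := ∑ j, a j (clifford a (T (stdVec j)) u)

theorem inner_stdVec_right (v : Space d) (j : Fin d) : inner ℝ v (stdVec j : Space d) = v j := by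
  rw [EuclideanSpace.inner_eq_star_dotProduct]
  simp

/-- The contraction does not depend on the orthonormal basis and ignores the kernel of `T`. The
number of terms to estimate is therefore the rank of `T` and not `d`. -/
theorem cliffordTrace_eq_sum {T : Space d →ₗ[ℝ] Space d} {n : ℕ}
    (g : OrthonormalBasis (Fin n) ℝ (LinearMap.ker T)ᗮ) (u : Spinor N) :
    cliffordTrace a T u = ∑ i, clifford a (g i) (clifford a (T (g i)) u) := by
  have hT : ∀ j : Fin d, T (stdVec j) = ∑ i, ((g i : Space d) j) • T (g i) := by
    intro j
    have h1 := g.sum_repr' ((LinearMap.ker T)ᗮ.orthogonalProjectionOnto (stdVec j))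
    have h2 : T (stdVec j) = T ((LinearMap.ker T)ᗮ.orthogonalProjectionOnto (stdVec j)) := by
      rw [← sub_eq_zero, ← map_sub, ← LinearMap.mem_ker]
      have := Submodule.sub_starProjection_mem_orthogonal (K := (LinearMap.ker T)ᗮ) (stdVec j)
      rwa [Submodule.orthogonal_orthogonal] at this
    rw [h2, ← h1, Submodule.coe_sum, map_sum]
    refine Finset.sum_congr rfl fun i _ => ?_
    rw [Submodule.coe_smul, map_smul, Submodule.inner_orthogonalProjectionOnto_eq_of_mem_left,
      inner_stdVec_right]
  simp_rw [cliffordTrace, hT, clifford_sum, clifford_smul, map_sum, map_smul]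
  rw [Finset.sum_comm]
  exact Finset.sum_congr rfl fun i _ => (clifford_apply _ _).symm

theorem IsCliffordFamily.norm_cliffordTrace_le (ha : IsCliffordFamily a)
    {T : Space d →ₗ[ℝ] Space d} {c : ℝ} (hc : ∀ x, ‖T x‖ ≤ c * ‖x‖) (u : Spinor N) :
    ‖cliffordTrace a T u‖ ≤ Module.finrank ℝ (LinearMap.ker T)ᗮ * c * ‖u‖ := by
  set g := stdOrthonormalBasis ℝ (LinearMap.ker T)ᗮ
  rw [cliffordTrace_eq_sum g]
  refine (norm_sum_le _ _).trans ?_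
  have h : ∀ i, ‖clifford a (g i) (clifford a (T (g i)) u)‖ ≤ c * ‖u‖ := fun i => by
    have h1 : ‖(g i : Space d)‖ = 1 := g.orthonormal.1 i
    have h2 := hc (g i)
    rw [h1, mul_one] at h2
    rw [ha.norm_clifford, ha.norm_clifford, h1, one_mul]
    gcongr
  refine (Finset.sum_le_sum fun i _ => h i).trans_eq ?_
  rw [Finset.sum_const, Finset.card_univ, Fintype.card_fin, nsmul_eq_mul, mul_assoc]

theorem IsCliffordFamily.norm_cliffordTrace_le_of_odd (ha : IsCliffordFamily a) (hd : Odd d)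
    {T : Space d →ₗ[ℝ] Space d} (hT : ∀ x y, inner ℝ (T x) y = -inner ℝ x (T y))
    {c : ℝ} (hc0 : 0 ≤ c) (hc : ∀ x, ‖T x‖ ≤ c * ‖x‖) (u : Spinor N) :
    ‖cliffordTrace a T u‖ ≤ (d - 1) * c * ‖u‖ := by
  refine (ha.norm_cliffordTrace_le hc u).trans ?_
  have h := finrank_ker_orthogonal_add_one_le_of_odd hT (by simpa using hd)
  rw [finrank_euclideanSpace_fin] at h
  have h' : ((Module.finrank ℝ (LinearMap.ker T)ᗮ : ℕ) : ℝ) + 1 ≤ d := by exact_mod_cast h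
  gcongr
  linarith

/-- In even dimension the Clifford contraction of a skew operator is controlled by `d - 2`
directions, after subtracting the part coming from a given direction `e`. -/
theorem IsCliffordFamily.norm_cliffordTrace_sub_le_of_even (ha : IsCliffordFamily a)
    (hd : Even d) {T : Space d →ₗ[ℝ] Space d}
    (hT : ∀ x y, inner ℝ (T x) y = -inner ℝ x (T y))
    {c : ℝ} (hc0 : 0 ≤ c) (hc : ∀ x, ‖T x‖ ≤ c * ‖x‖) {e : Space d} (he : ‖e‖ = 1)
    (u : Spinor N) :
    ‖cliffordTrace a T u - (2 : ℂ) • clifford a e (clifford a (T e) u)‖ ≤ (d - 2) * c * ‖u‖ := by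
  have hee : inner ℝ e e = (1 : ℝ) := by rw [real_inner_self_eq_norm_sq, he, one_pow]
  have hTe : inner ℝ (T e) e = (0 : ℝ) := by
    have := hT e e
    rw [real_inner_comm] at this ⊢
    linarith
  -- With `P` the projection onto `e`, this is the compression `(1 - P) T (1 - P)`, since `⟨e, T e⟩
  -- = 0` and `⟨e, T x⟩ = -⟨T e, x⟩`. It is skew, annihilates `e` and inherits the norm bound of
  -- `T`.
  set R : Space d →ₗ[ℝ] Space d :=
    T - (innerₛₗ ℝ e).smulRight (T e) + (innerₛₗ ℝ (T e)).smulRight e with hR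
  have hRx : ∀ x, R x = T x - inner ℝ e x • T e + inner ℝ (T e) x • e := fun x => rfl
  have hRs : ∀ x y, inner ℝ (R x) y = -inner ℝ x (R y) := by
    intro x y
    simp only [hRx, inner_add_left, inner_sub_left, inner_add_right, inner_sub_right,
      real_inner_smul_left, real_inner_smul_right, hT x y]
    rw [real_inner_comm x (T e), real_inner_comm x e]
    ring
  have hRe : R e = 0 := by rw [hRx, hee, hTe, one_smul, zero_smul, sub_self, zero_add]
  have hRc : ∀ x, ‖R x‖ ≤ c * ‖x‖ := by
    intro x
    set z := x - inner ℝ e x • e with hz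
    have hRz : R x = T z - inner ℝ e (T z) • e := by
      rw [hRx, hz, map_sub, map_smul, inner_sub_right, real_inner_smul_right,
        real_inner_comm (T e) e, hTe, mul_zero, sub_zero, hT e x]
      module
    have hproj : ∀ w : Space d, ‖w - inner ℝ e w • e‖ ≤ ‖w‖ := fun w => by
      rw [← sq_le_sq₀ (norm_nonneg _) (norm_nonneg _), norm_sub_sq_real, real_inner_smul_right,
        norm_smul, he, real_inner_comm, mul_one, Real.norm_eq_abs, sq_abs]
      nlinarith [sq_nonneg (inner ℝ e w : ℝ)]
    rw [hRz]
    exact (hproj _).trans ((hc z).trans (mul_le_mul_of_nonneg_left (hproj x) hc0))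
  -- The two rank one corrections contribute equally, because Clifford multiplications by the
  -- orthogonal vectors `e` and `T e` anticommute; this is the origin of the factor 2.
  have hkey : cliffordTrace a T u - (2 : ℂ) • clifford a e (clifford a (T e) u)
      = cliffordTrace a R u := by
    have h1 : ∀ j : Fin d, inner ℝ e (stdVec j : Space d) = e j := inner_stdVec_right e
    have h2 : ∀ j : Fin d, inner ℝ (T e) (stdVec j : Space d) = T e j := inner_stdVec_right (T e)
    have h3 : cliffordTrace a R u = cliffordTrace a T u - clifford a e (clifford a (T e) u)
        + clifford a (T e) (clifford a e u) := by
      simp only [cliffordTrace, hRx, h1, h2]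
      rw [clifford_apply e, clifford_apply (T e) (clifford a e u), ← Finset.sum_sub_distrib,
        ← Finset.sum_add_distrib]
      refine Finset.sum_congr rfl fun j _ => ?_
      rw [clifford_add, sub_eq_add_neg, clifford_add, clifford_neg, clifford_smul, clifford_smul,
        map_add, map_add, map_neg, map_smul, map_smul, ← sub_eq_add_neg]
    have h4 := ha.clifford_anticomm e (T e) u
    rw [real_inner_comm, hTe, mul_zero, Complex.ofReal_zero, zero_smul] at h4
    rw [h3, eq_neg_of_add_eq_zero_right h4, two_smul]
    abel
  rw [hkey]
  refine (ha.norm_cliffordTrace_le hRc u).trans ?_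
  have h := finrank_ker_orthogonal_add_two_le_of_even hRs (by simpa using hd)
    (e := e) (by rintro rfl; simp at he) hRe
  rw [finrank_euclideanSpace_fin] at h
  have h' : ((Module.finrank ℝ (LinearMap.ker R)ᗮ : ℕ) : ℝ) + 2 ≤ d := by exact_mod_cast h
  gcongr
  linarith

end Clifford

/-! ### The square of the magnetic Dirac operator and the full virial identity -/

section KineticIdentity

variable {d N : ℕ}
variable {A : Space d → Space d} {B : Space d → Matrix (Fin d) (Fin d) ℝ} {x₀ : Space d}
variable {a : Fin d → Spinor N →L[ℂ] Spinor N}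

/-- `α·∇_A ψ`. -/
noncomputable def cliffordGrad (a : Fin d → Spinor N →L[ℂ] Spinor N) (A : Space d → Space d)
    (ψ : SobolevH1 d N) (x : Space d) : Spinor N := ∑ j, a j (magPartial A ψ j x)

theorem MulH1.memLp_cliffordGrad (hmul : MulH1 A N) (a : Fin d → Spinor N →L[ℂ] Spinor N)
    (ψ : SobolevH1 d N) : MemLp (cliffordGrad a A ψ) 2 volume :=
  memLp_finsetSum _ fun j _ => (IsBddField.const (a j)).memLp (hmul.memLp_magPartial ψ j)

/-- The magnetic field as the linear map `v ↦ (∑_k v_k B_kj)_j`. -/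
noncomputable def fieldMap (M : Matrix (Fin d) (Fin d) ℝ) : Space d →ₗ[ℝ] Space d :=
  Matrix.toEuclideanLin M.transpose

theorem fieldMap_apply (M : Matrix (Fin d) (Fin d) ℝ) (v : Space d) (j : Fin d) :
    fieldMap M v j = ∑ k, v k * M k j := by
  simp [fieldMap, Matrix.toLpLin_apply, Matrix.mulVec, dotProduct, mul_comm]

theorem fieldMap_stdVec (M : Matrix (Fin d) (Fin d) ℝ) (j k : Fin d) :
    fieldMap M (stdVec j) k = M j k := by
  simp [fieldMap_apply]

theorem norm_fieldMap_le (M : Matrix (Fin d) (Fin d) ℝ) (v : Space d) :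
    ‖fieldMap M v‖ ≤ ‖M‖ * ‖v‖ := by
  have h : ‖M.transpose‖ = ‖M‖ := by
    have := Matrix.l2_opNorm_conjTranspose M
    rwa [Matrix.conjTranspose_eq_transpose_of_trivial] at this
  rw [← h]
  exact Matrix.l2_opNorm_mulVec M.transpose v

theorem fieldMap_skew {M : Matrix (Fin d) (Fin d) ℝ} (hM : ∀ j k, M j k = -M k j)
    (v w : Space d) : inner ℝ (fieldMap M v) w = -inner ℝ v (fieldMap M w) := by
  rw [EuclideanSpace.inner_eq_star_dotProduct, EuclideanSpace.inner_eq_star_dotProduct]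
  simp only [dotProduct, Pi.star_apply, star_trivial, fieldMap_apply]
  simp only [Finset.mul_sum, Finset.sum_mul]
  rw [Finset.sum_comm, ← Finset.sum_neg_distrib]
  refine Finset.sum_congr rfl fun i _ => ?_
  rw [← Finset.sum_neg_distrib]
  refine Finset.sum_congr rfl fun j _ => ?_
  rw [hM i j]
  ring

theorem inner_cliffordTrace_fieldMap (M : Matrix (Fin d) (Fin d) ℝ) (u w : Spinor N) :
    (inner ℂ u (cliffordTrace a (fieldMap M) w) : ℂ)
      = ∑ j, ∑ k, (M j k : ℂ) * inner ℂ u ((a j ∘L a k) w) := by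
  simp only [cliffordTrace, clifford_apply, fieldMap_stdVec, map_sum, map_smul, inner_sum,
    inner_smul_right, ContinuousLinearMap.comp_apply]

theorem FieldMulH1.integral_inner_cliffordTrace (hBm : FieldMulH1 x₀ B N) (hmul : MulH1 A N)
    (hB : MemL2Loc B) (hd : 3 ≤ d) (a : Fin d → Spinor N →L[ℂ] Spinor N) (ψ : SobolevH1 d N) :
    Integrable (fun x => (inner ℂ ((ψ : SpinorL2 d N) x)
      (cliffordTrace a (fieldMap (B x)) ((ψ : SpinorL2 d N) x)) : ℂ)) volume ∧
    ∫ x, inner ℂ ((ψ : SpinorL2 d N) x)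
      (cliffordTrace a (fieldMap (B x)) ((ψ : SpinorL2 d N) x))
      = ∑ j, ∑ k, ∫ x, (B x j k : ℂ) *
        inner ℂ ((ψ : SpinorL2 d N) x) ((a j ∘L a k) ((ψ : SpinorL2 d N) x)) := by
  have h := fun j k => hBm.integrable_entry hmul hB hd (a j ∘L a k) j k ψ
  simp_rw [inner_cliffordTrace_fieldMap]
  refine ⟨integrable_finsetSum _ fun j _ => integrable_finsetSum _ fun k _ => h j k, ?_⟩
  rw [integral_finsetSum _ fun j _ => integrable_finsetSum _ fun k _ => h j k]
  exact Finset.sum_congr rfl fun j _ => integral_finsetSum _ fun k _ => h j k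

/-- The square of the magnetic Dirac operator, in quadratic form. -/
theorem integral_inner_cliffordGrad (ha : IsCliffordFamily a) (hd : 3 ≤ d) (hA : MemL2Loc A)
    (hmul : MulH1 A N) (hB : MemL2Loc B) (hAB : IsMagneticField A B) (hBm : FieldMulH1 x₀ B N)
    (ψ : SobolevH1 d N) :
    2 * ∫ x, (inner ℂ (cliffordGrad a A ψ x) (cliffordGrad a A ψ x) : ℂ)
      = 2 * (gradSq A ψ : ℂ) + Complex.I * ∫ x, inner ℂ ((ψ : SpinorL2 d N) x)
        (cliffordTrace a (fieldMap (B x)) ((ψ : SpinorL2 d N) x)) := by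
  have mD := fun i => hmul.memLp_magPartial ψ i
  set X : Fin d → Fin d → ℂ := fun j k =>
    ∫ x, inner ℂ (magPartial A ψ j x) ((a j ∘L a k) (magPartial A ψ k x)) with hX
  have iX : ∀ j k, Integrable fun x =>
      (inner ℂ (magPartial A ψ j x) ((a j ∘L a k) (magPartial A ψ k x)) : ℂ) := fun j k =>
    MemLp.integrable_spinor_inner (mD j) ((IsBddField.const (a j ∘L a k)).memLp (mD k))
  have h1 : ∫ x, (inner ℂ (cliffordGrad a A ψ x) (cliffordGrad a A ψ x) : ℂ)
      = ∑ j, ∑ k, X j k := by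
    have e : ∀ x, (inner ℂ (cliffordGrad a A ψ x) (cliffordGrad a A ψ x) : ℂ)
        = ∑ j, ∑ k, inner ℂ (magPartial A ψ j x) ((a j ∘L a k) (magPartial A ψ k x)) := by
      intro x
      simp only [cliffordGrad, sum_inner, inner_sum, ContinuousLinearMap.comp_apply]
      rw [Finset.sum_comm]
      exact Finset.sum_congr rfl fun j _ => Finset.sum_congr rfl fun k _ => ha.symm _ _ _
    simp_rw [e]
    rw [integral_finsetSum _ fun j _ => integrable_finsetSum _ fun k _ => iX j k]
    exact Finset.sum_congr rfl fun j _ => integral_finsetSum _ fun k _ => iX j k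
  -- The relation `a_j a_k = 2δ_jk - a_k a_j` turns the exchanged pairing into `-X k j` plus a
  -- diagonal term, so that the commutator identity yields the symmetric sum `X j k + X k j`.
  have h2 : ∀ j k, ∫ x, inner ℂ (magPartial A ψ k x) ((a j ∘L a k) (magPartial A ψ j x))
      = (if j = k then 2 * ((∫ x, ‖magPartial A ψ j x‖ ^ 2 : ℝ) : ℂ) else 0) - X k j := by
    intro j k
    have e : ∀ x, (inner ℂ (magPartial A ψ k x) ((a j ∘L a k) (magPartial A ψ j x)) : ℂ)
        = (if j = k then 2 * ((‖magPartial A ψ j x‖ ^ 2 : ℝ) : ℂ) else 0)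
          - inner ℂ (magPartial A ψ k x) ((a k ∘L a j) (magPartial A ψ j x)) := by
      intro x
      rw [ContinuousLinearMap.comp_apply, ContinuousLinearMap.comp_apply, eq_sub_iff_add_eq,
        ← inner_add_right, ha.anticomm, inner_smul_right]
      split_ifs with hjk
      · subst hjk
        rw [inner_self_eq_norm_sq_to_K, ← RCLike.ofReal_pow]
        rfl
      · rw [zero_mul]
    simp_rw [e]
    have i1 : Integrable (fun x => if j = k then 2 * ((‖magPartial A ψ j x‖ ^ 2 : ℝ) : ℂ)
        else 0) volume := by
      split_ifs
      · exact (MemLp.integrable_norm_sq (mD j)).ofReal.const_mul 2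
      · exact integrable_zero _ _ _
    rw [integral_sub i1 (iX k j)]
    congr 1
    split_ifs
    · rw [integral_const_mul, integral_complex_ofReal]
    · simp
  have h3 : ∀ j k, X j k + X k j
      = (if j = k then 2 * ((∫ x, ‖magPartial A ψ j x‖ ^ 2 : ℝ) : ℂ) else 0)
        + Complex.I * ∫ x, (B x j k : ℂ) *
          inner ℂ ((ψ : SpinorL2 d N) x) ((a j ∘L a k) ((ψ : SpinorL2 d N) x)) := by
    intro j k
    have := integral_commutator_eq hd hA hmul hB hAB hBm (a j ∘L a k) j k ψ
    rw [h2 j k] at this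
    linear_combination this
  have h4 := Finset.sum_congr (s₁ := Finset.univ) rfl fun j _ =>
    Finset.sum_congr (s₁ := Finset.univ) rfl fun k _ => h3 j k
  simp only [Finset.sum_add_distrib, Finset.sum_ite_eq, Finset.mem_univ, if_true,
    ← Finset.mul_sum] at h4
  rw [Finset.sum_comm (f := fun j k => X k j), ← Complex.ofReal_sum] at h4
  change _ = 2 * (gradSq A ψ : ℂ) + _ at h4
  rw [h1, (hBm.integral_inner_cliffordTrace hmul hB hd a ψ).2]
  linear_combination h4

/-- The virial identity for solutions of `α·∇_A ψ = i W ψ`. -/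
theorem virial_identity (ha : IsCliffordFamily a) (hd : 3 ≤ d) (hA : MemL2Loc A)
    (hmul : MulH1 A N) (hB : MemL2Loc B) (hAB : IsMagneticField A B) (hBm : FieldMulH1 x₀ B N)
    {W : Space d → Spinor N →L[ℂ] Spinor N} (hW : ContDiffOn ℝ 1 W {x₀}ᶜ)
    (hWs : ∀ᵐ x, ∀ u v, (inner ℂ (W x u) v : ℂ) = inner ℂ u (W x v))
    {ψ : SobolevH1 d N}
    (heq : ∀ᵐ x, cliffordGrad a A ψ x = Complex.I • W x ((ψ : SpinorL2 d N) x))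
    (hint : ∀ k, MemLp (fun x => (x - x₀) k • fderiv ℝ W x (stdVec k) ((ψ : SpinorL2 d N) x))
      2 volume)
    (hint' : ∀ k, Integrable (fun x => ‖x - x₀‖ * ‖fderiv ℝ W x (stdVec k)‖ *
      ‖(ψ : SpinorL2 d N) x‖ ^ 2) volume) :
    ∫ x, inner ℂ ((ψ : SpinorL2 d N) x)
        (∑ k, (x - x₀) k • fderiv ℝ W x (stdVec k) ((ψ : SpinorL2 d N) x))
      = -(∫ x, inner ℂ ((ψ : SpinorL2 d N) x)
          (clifford a (fieldMap (B x) (x - x₀)) ((ψ : SpinorL2 d N) x)))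
        + Complex.I * ∫ x, inner ℂ ((ψ : SpinorL2 d N) x) (cliffordGrad a A ψ x) := by
  have m0 := Lp.memLp (ψ : SpinorL2 d N)
  have mD := fun i => hmul.memLp_magPartial ψ i
  have hv := Finset.sum_congr (s₁ := Finset.univ) rfl fun k _ =>
    virial_coord hA hmul hB hAB hBm hd ha.symm hW hWs heq k (hint' k)
  have i1 : ∀ k, Integrable fun x => (inner ℂ ((ψ : SpinorL2 d N) x)
      ((x - x₀) k • fderiv ℝ W x (stdVec k) ((ψ : SpinorL2 d N) x)) : ℂ) := fun k =>
    MemLp.integrable_spinor_inner m0 (hint k)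
  have i2 : ∀ j k, Integrable fun x => (((x - x₀) k * B x k j : ℝ) : ℂ) *
      (inner ℂ ((ψ : SpinorL2 d N) x) (a j ((ψ : SpinorL2 d N) x)) : ℂ) := fun j k => by
    have hc : Continuous fun x : Space d => (x - x₀) k :=
      (coordCLM k).continuous.comp (continuous_id.sub continuous_const)
    have hm := hBm.memLp (N := N) hB hc.aestronglyMeasurable (C := 1)
      (fun x => by rw [one_mul]; exact abs_coord_le _ _) k j ψ
    refine (MemLp.integrable_spinor_inner m0 ((IsBddField.const (a j)).memLp hm)).congr ?_
    refine Eventually.of_forall fun x => ?_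
    simp only [map_smul, inner_smul_right]
  have i3 : ∀ k, Integrable fun x =>
      (inner ℂ ((ψ : SpinorL2 d N) x) (a k (magPartial A ψ k x)) : ℂ) := fun k =>
    MemLp.integrable_spinor_inner m0 ((IsBddField.const (a k)).memLp (mD k))
  rw [Finset.sum_add_distrib, ← Finset.mul_sum, Finset.sum_neg_distrib,
    ← integral_finsetSum _ fun k _ => i3 k, Finset.sum_comm] at hv
  have e1 : ∫ x, inner ℂ ((ψ : SpinorL2 d N) x)
        (∑ k, (x - x₀) k • fderiv ℝ W x (stdVec k) ((ψ : SpinorL2 d N) x))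
      = ∑ k, ∫ x, ((x - x₀) k : ℂ) * inner ℂ ((ψ : SpinorL2 d N) x)
        (fderiv ℝ W x (stdVec k) ((ψ : SpinorL2 d N) x)) := by
    simp_rw [inner_sum]
    rw [integral_finsetSum _ fun k _ => i1 k]
    exact Finset.sum_congr rfl fun k _ => integral_congr_ae
      (Eventually.of_forall fun x => inner_real_smul_right _ _ _)
  have e2 : ∫ x, inner ℂ ((ψ : SpinorL2 d N) x)
          (clifford a (fieldMap (B x) (x - x₀)) ((ψ : SpinorL2 d N) x))
      = ∑ j, ∑ k, ∫ x, (((x - x₀) k * B x k j : ℝ) : ℂ) *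
          inner ℂ ((ψ : SpinorL2 d N) x) (a j ((ψ : SpinorL2 d N) x)) := by
    simp_rw [clifford_apply, fieldMap_apply, inner_sum, inner_smul_right, Complex.ofReal_sum,
      Finset.sum_mul]
    rw [integral_finsetSum _ fun j _ => integrable_finsetSum _ fun k _ => i2 j k]
    exact Finset.sum_congr rfl fun j _ => integral_finsetSum _ fun k _ => i2 j k
  rw [e1, e2, hv]
  simp_rw [cliffordGrad, inner_sum]

end KineticIdentity

/-! ### Norms and pairings in `L²` -/

section L2Norms

variable {d N : ℕ}

theorem MemLp.norm_toLp_sq {f : Space d → Spinor N} (hf : MemLp f 2 volume) :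
    ‖hf.toLp f‖ ^ 2 = ∫ x, ‖f x‖ ^ 2 := by
  have h := MemLp.lintegral_enorm_sq hf
  rw [lintegral_enorm_sq_eq] at h
  rw [Lp.norm_toLp, ← ENNReal.toReal_pow, h, ENNReal.toReal_ofReal]
  exact integral_nonneg fun x => by positivity

theorem MemLp.norm_toLp_le {f : Space d → Spinor N} (hf : MemLp f 2 volume) {C : ℝ} (hC : 0 ≤ C)
    (h : ∫ x, ‖f x‖ ^ 2 ≤ C ^ 2) : ‖hf.toLp f‖ ≤ C := by
  rw [← MemLp.norm_toLp_sq hf] at h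
  exact (sq_le_sq₀ (norm_nonneg _) hC).1 h

theorem MemLp.norm_toLp_le_of_norm_le {f g : Space d → Spinor N} (hf : MemLp f 2 volume)
    (hg : MemLp g 2 volume) (h : ∀ᵐ x, ‖f x‖ ≤ ‖g x‖) : ‖hf.toLp f‖ ≤ ‖hg.toLp g‖ := by
  rw [Lp.norm_toLp, Lp.norm_toLp]
  exact ENNReal.toReal_mono hg.2.ne (eLpNorm_mono_ae h)

theorem MemLp.integral_norm_mul_norm_le {f g : Space d → Spinor N} (hf : MemLp f 2 volume)
    (hg : MemLp g 2 volume) : ∫ x, ‖f x‖ * ‖g x‖ ≤ ‖hf.toLp f‖ * ‖hg.toLp g‖ := by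
  have h := real_inner_le_norm (hf.norm.toLp fun x => ‖f x‖) (hg.norm.toLp fun x => ‖g x‖)
  rw [L2.inner_def, Lp.norm_toLp, Lp.norm_toLp, eLpNorm_norm, eLpNorm_norm, ← Lp.norm_toLp f hf,
    ← Lp.norm_toLp g hg] at h
  refine Eq.trans_le (integral_congr_ae ?_) h
  filter_upwards [hf.norm.coeFn_toLp, hg.norm.coeFn_toLp] with x hx hx'
  rw [hx, hx']
  exact mul_comm _ _

theorem MemLp.norm_integral_inner_le {f g : Space d → Spinor N} (hf : MemLp f 2 volume)
    (hg : MemLp g 2 volume) :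
    ‖(∫ x, inner ℂ (f x) (g x) : ℂ)‖ ≤ ‖hf.toLp f‖ * ‖hg.toLp g‖ := by
  rw [integral_inner_eq hf hg]
  exact norm_inner_le_norm _ _

end L2Norms

/-! ### The field term, the radial Clifford term and the Hardy defect -/

section SpinEstimate

variable {d N : ℕ}
variable {A : Space d → Space d} {B : Space d → Matrix (Fin d) (Fin d) ℝ} {x₀ : Space d}
variable {a : Fin d → Spinor N →L[ℂ] Spinor N}

/-- The field term `α·(Bᵀ(x - x₀)) ψ` of the virial identity. -/
noncomputable def cliffordField (a : Fin d → Spinor N →L[ℂ] Spinor N)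
    (B : Space d → Matrix (Fin d) (Fin d) ℝ) (x₀ : Space d) (ψ : SobolevH1 d N) (x : Space d) :
    Spinor N := clifford a (fieldMap (B x) (x - x₀)) ((ψ : SpinorL2 d N) x)

theorem FieldMulH1.memLp_cliffordField (hBm : FieldMulH1 x₀ B N) (hB : MemL2Loc B)
    (a : Fin d → Spinor N →L[ℂ] Spinor N) (ψ : SobolevH1 d N) :
    MemLp (cliffordField a B x₀ ψ) 2 volume := by
  have hc : ∀ k : Fin d, Continuous fun x : Space d => (x - x₀) k := fun k =>
    (coordCLM k).continuous.comp (continuous_id.sub continuous_const)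
  have hm := fun k j => hBm.memLp (N := N) hB (hc k).aestronglyMeasurable (C := 1)
      (fun x => by rw [one_mul]; exact abs_coord_le _ _) k j ψ
  have h := memLp_finsetSum Finset.univ fun j _ => memLp_finsetSum Finset.univ fun k _ =>
    (IsBddField.const (a j)).memLp (hm k j)
  refine h.ae_eq (Eventually.of_forall fun x => ?_)
  simp only [cliffordField, clifford_apply, fieldMap_apply, Complex.ofReal_sum, map_smul,
    Finset.sum_smul]

theorem IsCliffordFamily.norm_cliffordField_le (ha : IsCliffordFamily a) (ψ : SobolevH1 d N)
    (x : Space d) :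
    ‖cliffordField a B x₀ ψ x‖ ≤ ‖(‖x - x₀‖ * ‖B x‖) • (ψ : SpinorL2 d N) x‖ := by
  rw [cliffordField, ha.norm_clifford, norm_smul, norm_mul, norm_norm, norm_norm,
    mul_comm ‖x - x₀‖]
  gcongr
  exact norm_fieldMap_le _ _

/-- The radial Clifford multiplication `α·x̂ (ψ/|x|)`. -/
noncomputable def cliffordRadial (a : Fin d → Spinor N →L[ℂ] Spinor N) (x₀ : Space d)
    (ψ : SobolevH1 d N) (x : Space d) : Spinor N :=
  clifford a (‖x - x₀‖⁻¹ • (x - x₀)) (hardyQuot x₀ ψ x)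

theorem norm_inv_smul_sub {x : Space d} (hx : x ≠ x₀) : ‖‖x - x₀‖⁻¹ • (x - x₀)‖ = 1 := by
  rw [norm_smul, norm_inv, norm_norm]
  exact inv_mul_cancel₀ (norm_ne_zero_iff.2 (sub_ne_zero.2 hx))

theorem abs_radial_coord_le (x : Space d) (j : Fin d) : |‖x - x₀‖⁻¹ * (x - x₀) j| ≤ 1 := by
  rw [abs_mul, abs_inv, abs_norm]
  exact (mul_le_mul_of_nonneg_left (abs_coord_le _ _) (by positivity)).trans
    (inv_mul_le_one)

theorem measurable_radial_coord (j : Fin d) :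
    Measurable fun x : Space d => ‖x - x₀‖⁻¹ * (x - x₀) j :=
  ((measurable_id.sub_const x₀).norm.inv).mul
    ((coordCLM j).continuous.measurable.comp (measurable_id.sub_const x₀))

theorem memLp_cliffordRadial (hmul : MulH1 A N) (hd : 3 ≤ d)
    (a : Fin d → Spinor N →L[ℂ] Spinor N) (ψ : SobolevH1 d N) :
    MemLp (cliffordRadial a x₀ ψ) 2 volume := by
  have h := memLp_finsetSum Finset.univ fun j _ => (IsBddField.const (a j)).memLp
    (MemLp.smul (r := 2) (memLp_hardyQuot hmul x₀ hd ψ) (memLp_top_of_bound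
      (measurable_radial_coord (x₀ := x₀) j).aestronglyMeasurable 1
      (Eventually.of_forall fun x => abs_radial_coord_le x j)))
  refine h.ae_eq (Eventually.of_forall fun x => ?_)
  simp only [cliffordRadial, clifford_apply, PiLp.smul_apply, smul_eq_mul]
  refine Finset.sum_congr rfl fun j _ => ?_
  rw [Pi.smul_apply', ← Complex.coe_smul, map_smul]

theorem IsCliffordFamily.norm_cliffordRadial (ha : IsCliffordFamily a) (ψ : SobolevH1 d N)
    {x : Space d} (hx : x ≠ x₀) : ‖cliffordRadial a x₀ ψ x‖ = ‖hardyQuot x₀ ψ x‖ := by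
  rw [cliffordRadial, ha.norm_clifford, norm_inv_smul_sub hx, one_mul]

theorem sum_radial_coord_sq {x : Space d} (hx : x ≠ x₀) :
    ∑ j, (‖x - x₀‖⁻¹ * (x - x₀) j) ^ 2 = 1 := by
  have h := EuclideanSpace.norm_sq_eq (‖x - x₀‖⁻¹ • (x - x₀))
  rw [norm_inv_smul_sub hx, one_pow] at h
  rw [h]
  exact Finset.sum_congr rfl fun j _ => by
    rw [PiLp.smul_apply, smul_eq_mul, Real.norm_eq_abs, sq_abs]

/-- The radial part of `α·∇_A ψ` exhausts the Hardy defect. -/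
theorem IsCliffordFamily.norm_cliffordGrad_add_radial_sq_le (ha : IsCliffordFamily a)
    (hmul : MulH1 A N) (hd : 3 ≤ d) (ψ : SobolevH1 d N) :
    ‖(hmul.memLp_cliffordGrad a ψ).toLp _ + ((((d : ℝ) - 2) / 2 : ℝ) : ℂ) •
      (memLp_cliffordRadial (x₀ := x₀) hmul hd a ψ).toLp _‖ ^ 2
      ≤ d * (gradSq A ψ - (((d : ℝ) - 2) / 2) ^ 2 * ∫ x, ‖hardyQuot x₀ ψ x‖ ^ 2) := by
  set κ : ℝ := ((d : ℝ) - 2) / 2 with hκ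
  have mD := fun i => hmul.memLp_magPartial ψ i
  have mY := memLp_hardyQuot hmul x₀ hd ψ
  have mp := hmul.memLp_cliffordGrad a ψ
  have me := memLp_cliffordRadial (x₀ := x₀) hmul hd a ψ
  have iD := fun j => MemLp.integrable_norm_sq (mD j)
  have iY := MemLp.integrable_norm_sq mY
  have iC : ∀ j, Integrable fun x => ‖x - x₀‖⁻¹ * (x - x₀) j *
      (inner ℂ (hardyQuot x₀ ψ x) (magPartial A ψ j x)).re := fun j =>
    (MemLp.integrable_spinor_inner mY (mD j)).re.bdd_mul
      (measurable_radial_coord j).aestronglyMeasurable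
      (Eventually.of_forall fun x => abs_radial_coord_le x j)
  have hsum : mp.toLp _ + (κ : ℂ) • me.toLp _ = (mp.add (me.const_smul (κ : ℂ))).toLp _ := rfl
  rw [hsum, MemLp.norm_toLp_sq]
  have hpt : ∀ᵐ x, ‖(cliffordGrad a A ψ + (κ : ℂ) • cliffordRadial a x₀ ψ) x‖ ^ 2
      ≤ d * ((∑ j, (‖magPartial A ψ j x‖ ^ 2 + 2 * κ * (‖x - x₀‖⁻¹ * (x - x₀) j *
        (inner ℂ (hardyQuot x₀ ψ x) (magPartial A ψ j x)).re)))
        + κ ^ 2 * ‖hardyQuot x₀ ψ x‖ ^ 2) := by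
    filter_upwards [ae_ne_point (by omega) x₀] with x hx
    -- The sum is `∑_j a_j (∇_j ψ + κ x̂_j ψ/|x - x₀|)`. Each `a_j` is an isometry, and
    -- Cauchy–Schwarz over the `d` summands costs the factor `d`.
    have e1 : (cliffordGrad a A ψ + (κ : ℂ) • cliffordRadial a x₀ ψ) x
        = ∑ j, a j (magPartial A ψ j x + (κ * (‖x - x₀‖⁻¹ * (x - x₀) j)) • hardyQuot x₀ ψ x) := by
      simp only [Pi.add_apply, Pi.smul_apply, cliffordGrad, cliffordRadial, clifford_apply,
        map_add, Finset.sum_add_distrib, Finset.smul_sum, PiLp.smul_apply, smul_eq_mul]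
      congr 1
      refine Finset.sum_congr rfl fun j _ => ?_
      rw [← Complex.coe_smul, map_smul, smul_smul, ← Complex.ofReal_mul]
    rw [e1]
    have h1 := norm_sum_le Finset.univ fun j =>
      a j (magPartial A ψ j x + (κ * (‖x - x₀‖⁻¹ * (x - x₀) j)) • hardyQuot x₀ ψ x)
    simp_rw [ha.norm_apply] at h1
    have h2 := sq_sum_le_card_mul_sum_sq (s := (Finset.univ : Finset (Fin d))) (f := fun j =>
      ‖magPartial A ψ j x + (κ * (‖x - x₀‖⁻¹ * (x - x₀) j)) • hardyQuot x₀ ψ x‖)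
    rw [Finset.card_univ, Fintype.card_fin] at h2
    refine ((sq_le_sq₀ (norm_nonneg _) (Finset.sum_nonneg fun _ _ => norm_nonneg _)).2 h1).trans
      (h2.trans_eq ?_)
    congr 1
    simp_rw [norm_add_smul_sq, mul_pow κ]
    rw [Finset.sum_add_distrib, ← Finset.sum_mul, ← Finset.mul_sum, sum_radial_coord_sq hx, mul_one]
    congr 1
    exact Finset.sum_congr rfl fun j _ => by ring
  have iS := integrable_finsetSum Finset.univ fun j _ => (iD j).fun_add ((iC j).const_mul (2 * κ))
  refine (integral_mono_ae (MemLp.integrable_norm_sq (mp.add (me.const_smul (κ : ℂ))))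
    ((iS.fun_add (iY.const_mul (κ ^ 2))).const_mul d) hpt).trans_eq ?_
  rw [integral_const_mul, integral_add iS (iY.const_mul (κ ^ 2)), integral_finsetSum _ fun j _ =>
    (iD j).fun_add ((iC j).const_mul (2 * κ)), integral_const_mul]
  congr 1
  have e2 : ∀ j, ∫ x, (‖magPartial A ψ j x‖ ^ 2 + 2 * κ * (‖x - x₀‖⁻¹ * (x - x₀) j *
        (inner ℂ (hardyQuot x₀ ψ x) (magPartial A ψ j x)).re))
      = (∫ x, ‖magPartial A ψ j x‖ ^ 2) + 2 * κ * ∫ x, ‖x - x₀‖⁻¹ * (x - x₀) j *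
        (inner ℂ (hardyQuot x₀ ψ x) (magPartial A ψ j x)).re := fun j => by
    rw [integral_add (iD j) ((iC j).const_mul (2 * κ)), integral_const_mul]
  simp_rw [e2]
  -- The Hardy identity evaluates the cross term as `-2κ²‖ψ/|x - x₀|‖²`, so completing the square
  -- leaves exactly the defect in the Hardy inequality.
  rw [Finset.sum_add_distrib, ← Finset.mul_sum, hardy_identity hmul x₀ hd ψ, ← hκ, ← gradSq]
  ring

end SpinEstimate

/-! ### The sharp bound for the magnetic terms -/

section SpinBound

variable {d N : ℕ}
variable {A : Space d → Space d} {B : Space d → Matrix (Fin d) (Fin d) ℝ} {x₀ : Space d}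
variable {a : Fin d → Spinor N →L[ℂ] Spinor N}

theorem norm_mul_norm_hardyQuot {x : Space d} (hx : x ≠ x₀) (ψ : SobolevH1 d N) :
    ‖hardyQuot x₀ ψ x‖ * ‖(‖x - x₀‖ * ‖B x‖) • (ψ : SpinorL2 d N) x‖
      = ‖B x‖ * ‖(ψ : SpinorL2 d N) x‖ * ‖(ψ : SpinorL2 d N) x‖ := by
  have hr : ‖x - x₀‖ ≠ 0 := norm_ne_zero_iff.2 (sub_ne_zero.2 hx)
  rw [hardyQuot, norm_smul, norm_smul, norm_inv, norm_norm, norm_mul, norm_norm, norm_norm]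
  field_simp

/-- In odd dimension `B(x)` has a kernel, so at most `d - 1` directions contribute; `|B||ψ|²` is
then split into `|ψ|/|x - x₀|` and `|x - x₀||B||ψ|`. -/
theorem IsCliffordFamily.norm_integral_cliffordTrace_le (ha : IsCliffordFamily a) (hodd : Odd d)
    (hd : 3 ≤ d) (hmul : MulH1 A N) (hBm : FieldMulH1 x₀ B N)
    (hskew : ∀ᵐ x, ∀ j k, B x j k = -B x k j) (ψ : SobolevH1 d N) :
    ‖(∫ x, inner ℂ ((ψ : SpinorL2 d N) x)
        (cliffordTrace a (fieldMap (B x)) ((ψ : SpinorL2 d N) x)) : ℂ)‖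
      ≤ ((d : ℝ) - 1) * (‖(memLp_hardyQuot hmul x₀ hd ψ).toLp _‖ * ‖(hBm ψ).toLp _‖) := by
  have mY := memLp_hardyQuot hmul x₀ hd ψ
  have hd1 : (0 : ℝ) ≤ (d : ℝ) - 1 := by
    have : (3 : ℝ) ≤ d := by exact_mod_cast hd
    linarith
  refine (norm_integral_le_of_norm_le ((MemLp.integrable_norm_mul_norm mY (hBm ψ)).const_mul
    ((d : ℝ) - 1)) ?_).trans ?_
  · filter_upwards [ae_ne_point (by omega) x₀, hskew] with x hx hsx
    rw [norm_mul_norm_hardyQuot hx]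
    refine (norm_inner_le_norm _ _).trans ?_
    have h := ha.norm_cliffordTrace_le_of_odd hodd (fieldMap_skew hsx) (norm_nonneg (B x))
      (norm_fieldMap_le (B x)) ((ψ : SpinorL2 d N) x)
    calc _ ≤ ‖(ψ : SpinorL2 d N) x‖ * (((d : ℝ) - 1) * ‖B x‖ * ‖(ψ : SpinorL2 d N) x‖) := by
          gcongr
      _ = _ := by ring
  · rw [integral_const_mul]
    exact mul_le_mul_of_nonneg_left (MemLp.integral_norm_mul_norm_le mY (hBm ψ)) hd1

/-- In even dimension the kernel of `B(x)` may be trivial. Splitting off the radial direction leaves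
`d - 2` directions. The radial part is a pairing with the field term of the virial identity, so the
two can be estimated together. -/
theorem IsCliffordFamily.norm_integral_cliffordTrace_sub_le (ha : IsCliffordFamily a)
    (heven : Even d) (hd : 3 ≤ d) (hmul : MulH1 A N) (hB : MemL2Loc B) (hBm : FieldMulH1 x₀ B N)
    (hskew : ∀ᵐ x, ∀ j k, B x j k = -B x k j) (ψ : SobolevH1 d N) :
    ‖(∫ x, inner ℂ ((ψ : SpinorL2 d N) x)
        (cliffordTrace a (fieldMap (B x)) ((ψ : SpinorL2 d N) x)))
        - 2 * ∫ x, (inner ℂ (cliffordRadial a x₀ ψ x) (cliffordField a B x₀ ψ x) : ℂ)‖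
      ≤ ((d : ℝ) - 2) * (‖(memLp_hardyQuot hmul x₀ hd ψ).toLp _‖ * ‖(hBm ψ).toLp _‖) := by
  have mY := memLp_hardyQuot hmul x₀ hd ψ
  have hd1 : (0 : ℝ) ≤ (d : ℝ) - 2 := by
    have : (3 : ℝ) ≤ d := by exact_mod_cast hd
    linarith
  have i1 := (hBm.integral_inner_cliffordTrace hmul hB hd a ψ).1
  have i2 := MemLp.integrable_spinor_inner (memLp_cliffordRadial (x₀ := x₀) hmul hd a ψ)
    (hBm.memLp_cliffordField hB a ψ)
  rw [← integral_const_mul, ← integral_sub i1 (i2.const_mul 2)]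
  refine (norm_integral_le_of_norm_le ((MemLp.integrable_norm_mul_norm mY (hBm ψ)).const_mul
    ((d : ℝ) - 2)) ?_).trans ?_
  · filter_upwards [ae_ne_point (by omega) x₀, hskew] with x hx hsx
    rw [norm_mul_norm_hardyQuot hx]
    have hr : ‖x - x₀‖ ≠ 0 := norm_ne_zero_iff.2 (sub_ne_zero.2 hx)
    have hrC : ((‖x - x₀‖ : ℝ) : ℂ) ≠ 0 := Complex.ofReal_ne_zero.2 hr
    obtain ⟨e, he⟩ : ∃ e, e = ‖x - x₀‖⁻¹ • (x - x₀) := ⟨_, rfl⟩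
    have hxe : fieldMap (B x) (x - x₀) = ‖x - x₀‖ • fieldMap (B x) e := by
      rw [← map_smul, he, smul_inv_smul₀ hr]
    -- The factor `1/|x - x₀|` in the radial term cancels the factor `|x - x₀|` in the field term.
    have e1 : (inner ℂ (cliffordRadial a x₀ ψ x) (cliffordField a B x₀ ψ x) : ℂ)
        = inner ℂ ((ψ : SpinorL2 d N) x)
          (clifford a e (clifford a (fieldMap (B x) e) ((ψ : SpinorL2 d N) x))) := by
      rw [cliffordRadial, ← he, ha.inner_clifford, cliffordField, hxe,
        clifford_smul, map_smul, inner_smul_right, hardyQuot, ← Complex.coe_smul,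
        inner_smul_left, Complex.conj_ofReal, Complex.ofReal_inv, mul_inv_cancel_left₀ hrC]
    rw [e1, ← inner_smul_right, ← inner_sub_right]
    refine (norm_inner_le_norm _ _).trans ?_
    have h := ha.norm_cliffordTrace_sub_le_of_even heven (fieldMap_skew hsx) (norm_nonneg (B x))
      (norm_fieldMap_le (B x)) (he ▸ norm_inv_smul_sub hx) ((ψ : SpinorL2 d N) x)
    calc _ ≤ ‖(ψ : SpinorL2 d N) x‖ * (((d : ℝ) - 2) * ‖B x‖ * ‖(ψ : SpinorL2 d N) x‖) := by
          gcongr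
      _ = _ := by ring
  · rw [integral_const_mul]
    exact mul_le_mul_of_nonneg_left (MemLp.integral_norm_mul_norm_le mY (hBm ψ)) hd1

/-- The elementary inequality behind the even dimensional spin estimate. -/
theorem add_lt_of_sq_le {G P Z n h : ℝ} (hG : 0 < G) (hZ : Z ≤ G) (hh0 : 0 < h)
    (hh : h ≤ 1) (hP0 : 0 ≤ P) (hP : P < G)
    (hn : n ^ 2 ≤ P ^ 2 + (h ^ 2 - 2 * h) * Z ^ 2 + (1 + h) * (G ^ 2 - Z ^ 2) + 2 * h * Z ^ 2) :
    Z + n < (2 + h / 2) * G := by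
  have hP2 : P ^ 2 < G ^ 2 := by nlinarith
  have ha : 0 < 2 + h - h ^ 2 := by nlinarith
  -- The expression equals `h (8 - 3h - 3h² - h³)`, which is nonnegative for `0 ≤ h ≤ 1`.
  have hdisc : 0 ≤ 4 * (2 + h - h ^ 2) * (2 + h + h ^ 2 / 4) - (4 + h) ^ 2 := by
    nlinarith [mul_nonneg hh0.le (sub_nonneg.2 hh), pow_pos hh0 2, pow_pos hh0 3,
      mul_nonneg (pow_pos hh0 2).le (sub_nonneg.2 hh),
      mul_nonneg (pow_pos hh0 3).le (sub_nonneg.2 hh)]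
  -- This quadratic form in `G` and `Z` is `((2 + h/2) G - Z)²` minus the bound for `n²` with `P`
  -- replaced by `G`. It is nonnegative by completing the square in `Z`.
  have hq : 0 ≤ (2 + h + h ^ 2 / 4) * G ^ 2 - (4 + h) * (Z * G) + (2 + h - h ^ 2) * Z ^ 2 := by
    have : 0 ≤ 4 * (2 + h - h ^ 2) *
        ((2 + h + h ^ 2 / 4) * G ^ 2 - (4 + h) * (Z * G) + (2 + h - h ^ 2) * Z ^ 2) := by
      have e : 4 * (2 + h - h ^ 2) *
        ((2 + h + h ^ 2 / 4) * G ^ 2 - (4 + h) * (Z * G) + (2 + h - h ^ 2) * Z ^ 2)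
        = (2 * (2 + h - h ^ 2) * Z - (4 + h) * G) ^ 2
          + (4 * (2 + h - h ^ 2) * (2 + h + h ^ 2 / 4) - (4 + h) ^ 2) * G ^ 2 := by ring
      rw [e]
      positivity
    exact nonneg_of_mul_nonneg_right this (by positivity)
  have hlt : n ^ 2 < ((2 + h / 2) * G - Z) ^ 2 := by nlinarith
  have hpos : 0 < (2 + h / 2) * G - Z := by nlinarith
  linarith [abs_lt_of_sq_lt_sq hlt hpos.le, (abs_lt.1 (abs_lt_of_sq_lt_sq hlt hpos.le)).2]

/-- With `h = 2/(d-2)`, the triangle inequality and Hardy would only give `(2 + h) G`. The missing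
`h/2` comes from a trade-off. If `Z = (d-2)/2 ‖ψ/|x - x₀|‖` is close to `G`, the Hardy defect is
small, so `p` nearly points in the direction `-e` and `p + e` is short; otherwise `Z` itself is
small. -/
theorem IsCliffordFamily.norm_cliffordGrad_add_radial_lt (ha : IsCliffordFamily a)
    (hmul : MulH1 A N) (hd : 4 ≤ d) (ψ : SobolevH1 d N) {G : ℝ} (hG : 0 ≤ G)
    (hG2 : gradSq A ψ = G ^ 2)
    (hP : ‖(hmul.memLp_cliffordGrad a ψ).toLp _‖ < G) :
    ((d : ℝ) - 2) / 2 * ‖(memLp_hardyQuot hmul x₀ (by omega) ψ).toLp _‖ +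
      ‖(hmul.memLp_cliffordGrad a ψ).toLp _ +
        (memLp_cliffordRadial (x₀ := x₀) hmul (by omega) a ψ).toLp _‖
      < (2 + 1 / ((d : ℝ) - 2)) * G := by
  have hd3 : 3 ≤ d := by omega
  have hdr : (4 : ℝ) ≤ d := by exact_mod_cast hd
  have mY := memLp_hardyQuot hmul x₀ hd3 ψ
  have mp := hmul.memLp_cliffordGrad a ψ
  have me := memLp_cliffordRadial (x₀ := x₀) hmul hd3 a ψ
  have hmain := ha.norm_cliffordGrad_add_radial_sq_le (x₀ := x₀) hmul hd3 ψ
  have hhardy := hardy_inequality hmul x₀ hd3 ψ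
  rw [← MemLp.norm_toLp_sq mY, hG2] at hmain hhardy
  have heY : ‖me.toLp _‖ = ‖mY.toLp _‖ := by
    refine le_antisymm (MemLp.norm_toLp_le_of_norm_le me mY ?_)
      (MemLp.norm_toLp_le_of_norm_le mY me ?_) <;>
    filter_upwards [ae_ne_point (by omega) x₀] with x hx
    · exact (ha.norm_cliffordRadial ψ hx).le
    · exact (ha.norm_cliffordRadial ψ hx).ge
  set p := mp.toLp _
  set e := me.toLp _
  set Y := ‖mY.toLp _‖
  set κ : ℝ := ((d : ℝ) - 2) / 2 with hκ
  have hκ1 : 1 ≤ κ := by rw [hκ]; linarith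
  have hY0 : 0 ≤ Y := norm_nonneg _
  set h : ℝ := κ⁻¹ with hh
  have hκh : κ * h = 1 := mul_inv_cancel₀ (by linarith)
  have hh0 : 0 < h := by positivity
  have hh1 : h ≤ 1 := inv_le_one_of_one_le₀ hκ1
  set Z := κ * Y with hZ
  have hYZ : Y = h * Z := by rw [hZ]; linear_combination (-Y) * hκh
  have hZ0 : 0 ≤ Z := by positivity
  have hZG : Z ≤ G := by
    rw [← sq_le_sq₀ hZ0 hG, hZ, mul_pow]
    exact hhardy
  have e1 : (1 : ℝ) / (d - 2) = h / 2 := by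
    rw [hh, hκ]; field_simp
  rw [e1]
  refine add_lt_of_sq_le (by linarith [norm_nonneg p]) hZG hh0 hh1 (norm_nonneg p) hP ?_
  have hre : (inner ℂ p e : ℂ).re = (inner ℂ (p + (κ : ℂ) • e) e : ℂ).re - κ * Y ^ 2 := by
    rw [inner_add_left, inner_smul_left, Complex.conj_ofReal, inner_self_eq_norm_sq_to_K, heY,
      ← RCLike.ofReal_pow]
    change _ = (_ + (κ : ℂ) * ((Y ^ 2 : ℝ) : ℂ)).re - _
    rw [Complex.add_re, ← Complex.ofReal_mul, Complex.ofReal_re]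
    ring
  have hcs : (inner ℂ (p + (κ : ℂ) • e) e : ℂ).re ≤ ‖p + (κ : ℂ) • e‖ * Y := by
    rw [← heY]
    exact (Complex.re_le_norm _).trans (norm_inner_le_norm _ _)
  have hexp := norm_add_sq (𝕜 := ℂ) p e
  change _ = _ + 2 * (inner ℂ p e : ℂ).re + _ at hexp
  rw [hexp, hre, heY]
  have hdh : (d : ℝ) * h = 2 + 2 * h := by
    have : (d : ℝ) = 2 + 2 * κ := by rw [hκ]; ring
    rw [this]; linear_combination 2 * hκh
  set τ := ‖p + (κ : ℂ) • e‖
  have hτ : h / 2 * τ ^ 2 ≤ (1 + h) * (G ^ 2 - Z ^ 2) := by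
    have := mul_le_mul_of_nonneg_left hmain (by positivity : 0 ≤ h / 2)
    refine this.trans_eq ?_
    rw [hZ]
    linear_combination (G ^ 2 - κ ^ 2 * Y ^ 2) / 2 * hdh
  -- Weighted arithmetic–geometric mean with `Y = hZ`, the weight `h/2` on `τ²` being the one for
  -- which `d h = 2 + 2h` turns the Hardy defect into `(1 + h)(G² - Z²)`.
  have ham : 2 * (τ * Y) ≤ h / 2 * τ ^ 2 + 2 * h * Z ^ 2 := by
    have h1 : 0 ≤ h * (τ - 2 * Z) ^ 2 := by positivity
    rw [hYZ]
    nlinarith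
  have hk : κ * Y ^ 2 = h * Z ^ 2 := by
    rw [hYZ]; linear_combination h * Z ^ 2 * hκh
  have hk2 : Y ^ 2 = h ^ 2 * Z ^ 2 := by rw [hYZ]; ring
  nlinarith

/-- The bound for the magnetic terms: the spin coupling and the field term of the virial
identity. -/
theorem IsCliffordFamily.spin_estimate (ha : IsCliffordFamily a)
    (hmul : MulH1 A N) (hd : 3 ≤ d) (hB : MemL2Loc B) (hBm : FieldMulH1 x₀ B N)
    (hskew : ∀ᵐ x, ∀ j k, B x j k = -B x k j) (ψ : SobolevH1 d N) {G ε : ℝ} (hG : 0 ≤ G)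
    (hG2 : gradSq A ψ = G ^ 2) (hε : ‖(hBm ψ).toLp _‖ ≤ ε * G) :
    ∃ q, -(Complex.I / 2 * ∫ x, inner ℂ ((ψ : SpinorL2 d N) x)
        (cliffordTrace a (fieldMap (B x)) ((ψ : SpinorL2 d N) x))).re
      + (-Complex.I * ∫ x, (inner ℂ (cliffordGrad a A ψ x) (cliffordField a B x₀ ψ x) : ℂ)).re
      ≤ ε * G * q ∧
      (‖(hmul.memLp_cliffordGrad a ψ).toLp _‖ < G → q < (2 + 1 / ((d : ℝ) - 2)) * G) := by
  have hdr : (3 : ℝ) ≤ d := by exact_mod_cast hd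
  have mY := memLp_hardyQuot hmul x₀ hd ψ
  have mp := hmul.memLp_cliffordGrad a ψ
  have me := memLp_cliffordRadial (x₀ := x₀) hmul hd a ψ
  have mb := hBm.memLp_cliffordField hB a ψ
  have hb : ‖mb.toLp _‖ ≤ ε * G := (MemLp.norm_toLp_le_of_norm_le mb (hBm ψ)
    (Eventually.of_forall fun x => ha.norm_cliffordField_le ψ x)).trans hε
  have hεG : 0 ≤ ε * G := (norm_nonneg _).trans hε
  have hYG : ((d : ℝ) - 2) / 2 * ‖mY.toLp _‖ ≤ G := by
    have hh := hardy_inequality hmul x₀ hd ψ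
    rw [← MemLp.norm_toLp_sq mY, hG2, ← mul_pow] at hh
    exact (sq_le_sq₀ (mul_nonneg (by linarith) (norm_nonneg _)) hG).1 hh
  set S := ∫ x, (inner ℂ ((ψ : SpinorL2 d N) x)
        (cliffordTrace a (fieldMap (B x)) ((ψ : SpinorL2 d N) x)) : ℂ)
  have hre : ∀ z : ℂ, -(Complex.I / 2 * z).re ≤ ‖z‖ / 2 := fun z => by
    have h1 := (neg_le_abs _).trans (Complex.abs_re_le_norm (Complex.I / 2 * z))
    rw [norm_mul, norm_div, Complex.norm_I, Complex.norm_ofNat] at h1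
    linarith
  have hre' : ∀ z : ℂ, (-Complex.I * z).re ≤ ‖z‖ := fun z => by
    have h1 := Complex.re_le_norm (-Complex.I * z)
    rwa [norm_mul, norm_neg, Complex.norm_I, one_mul] at h1
  rcases Nat.even_or_odd d with heven | hodd
  · have hd4 : 4 ≤ d := by
      obtain ⟨k, hk⟩ := heven
      omega
    refine ⟨_, ?_, ha.norm_cliffordGrad_add_radial_lt (x₀ := x₀) hmul hd4 ψ hG hG2⟩
    have h1 := ha.norm_integral_cliffordTrace_sub_le heven hd hmul hB hBm hskew ψ
    rw [integral_inner_eq me mb] at h1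
    rw [integral_inner_eq mp mb]
    -- The radial part of the spin coupling is moved to the field term, replacing `p` by `p + e`
    -- there.
    have e : -(Complex.I / 2 * S).re + (-Complex.I * inner ℂ (mp.toLp _) (mb.toLp _)).re
        = -(Complex.I / 2 * (S - 2 * inner ℂ (me.toLp _) (mb.toLp _))).re
          + (-Complex.I * inner ℂ (mp.toLp _ + me.toLp _) (mb.toLp _)).re := by
      rw [inner_add_left, ← Complex.neg_re, ← Complex.neg_re, ← Complex.add_re, ← Complex.add_re]
      congr 1
      ring
    rw [e]
    have h2 := (hre _).trans (div_le_div_of_nonneg_right h1 zero_le_two)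
    have h3 := (hre' _).trans (norm_inner_le_norm (𝕜 := ℂ) (mp.toLp _ + me.toLp _) (mb.toLp _))
    have h4 : ((d : ℝ) - 2) * (‖mY.toLp _‖ * ‖(hBm ψ).toLp _‖)
        ≤ ((d : ℝ) - 2) * (‖mY.toLp _‖ * (ε * G)) := by
      have : (0 : ℝ) ≤ d - 2 := by linarith
      gcongr
    have h5 : ‖mp.toLp _ + me.toLp _‖ * ‖mb.toLp _‖ ≤ ‖mp.toLp _ + me.toLp _‖ * (ε * G) := by
      gcongr
    linarith
  -- In odd dimension Hardy turns half of `d - 1` into `(d-1)/(d-2) = 1 + 1/(d-2)`; the remaining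
  -- `1` comes from `‖p‖ < G`.
  · refine ⟨(1 + 1 / ((d : ℝ) - 2)) * G + ‖mp.toLp _‖, ?_, fun h => by linarith⟩
    have h1 := (hre _).trans (div_le_div_of_nonneg_right
      (ha.norm_integral_cliffordTrace_le hodd hd hmul hBm hskew ψ) zero_le_two)
    have h3 := (hre' _).trans (MemLp.norm_integral_inner_le mp mb)
    have h4 : ((d : ℝ) - 1) * (‖mY.toLp _‖ * ‖(hBm ψ).toLp _‖)
        ≤ 2 * ((1 + 1 / ((d : ℝ) - 2)) * G) * (ε * G) := by
      have h0 : (0 : ℝ) < d - 2 := by linarith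
      have e : (d : ℝ) - 1 = 2 * (1 + 1 / ((d : ℝ) - 2)) * (((d : ℝ) - 2) / 2) := by
        field_simp; ring
      rw [e, ← mul_assoc, mul_assoc _ (((d : ℝ) - 2) / 2), ← mul_assoc 2]
      gcongr
    have h5 : ‖mp.toLp _‖ * ‖mb.toLp _‖ ≤ ‖mp.toLp _‖ * (ε * G) := by gcongr
    nlinarith

end SpinBound

/-! ### Dirac matrices acting on spinors -/

section MatrixAction

variable {d N : ℕ}

theorem inner_matAct {M : Matrix (Fin N) (Fin N) ℂ} (hM : M.IsHermitian) (u v : Spinor N) :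
    (inner ℂ (matAct M u) v : ℂ) = inner ℂ u (matAct M v) := by
  have h : ContinuousLinearMap.adjoint (matAct M) = matAct M := by
    have := map_star (Matrix.toEuclideanCLM (n := Fin N) (𝕜 := ℂ)) M
    rw [Matrix.star_eq_conjTranspose, hM.eq] at this
    exact this.symm
  rw [← ContinuousLinearMap.adjoint_inner_right, h]

theorem norm_matAct (M : Matrix (Fin N) (Fin N) ℂ) : ‖matAct M‖ = ‖M‖ := rfl

theorem matAct_mul (M M' : Matrix (Fin N) (Fin N) ℂ) (u : Spinor N) :
    matAct (M * M') u = matAct M (matAct M' u) := by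
  rw [matAct, map_mul]; rfl

theorem matAct_add (M M' : Matrix (Fin N) (Fin N) ℂ) (u : Spinor N) :
    matAct (M + M') u = matAct M u + matAct M' u := by
  rw [matAct, map_add]; rfl

/-- The action of matrices on spinors, as a real continuous linear map. -/
noncomputable def matActL (N : ℕ) :
    Matrix (Fin N) (Fin N) ℂ →L[ℝ] (Spinor N →L[ℂ] Spinor N) :=
  LinearMap.mkContinuous
    { toFun := fun M => matAct M
      map_add' := fun M M' => map_add _ M M'
      map_smul' := fun c M => by
        ext1 v
        have h : matAct ((c : ℂ) • M) v = (c : ℂ) • matAct M v := by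
          rw [matAct, map_smul]; rfl
        rw [Complex.coe_smul] at h
        exact h } 1 fun M => by rw [one_mul]; exact (norm_matAct M).le

variable {α : Fin d → Matrix (Fin N) (Fin N) ℂ} {β : Matrix (Fin N) (Fin N) ℂ}

theorem IsDiracMatrices.isCliffordFamily (h : IsDiracMatrices α β) :
    IsCliffordFamily fun j => matAct (α j) where
  symm j u v := inner_matAct (h.hermitian_alpha j) u v
  anticomm j k u := by
    rw [← matAct_mul, ← matAct_mul, ← matAct_add, h.alpha_alpha]
    split_ifs
    · have : (2 : Matrix (Fin N) (Fin N) ℂ) = (2 : ℂ) • 1 := by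
        rw [two_smul, one_add_one_eq_two]
      rw [this, matAct, map_smul, map_one]; rfl
    · rw [matAct, map_zero, zero_smul]; rfl

theorem IsDiracMatrices.matAct_alpha_beta (h : IsDiracMatrices α β) (j : Fin d) (u : Spinor N) :
    matAct (α j) (matAct β u) = -matAct β (matAct (α j) u) := by
  rw [eq_neg_iff_add_eq_zero, ← matAct_mul, ← matAct_mul, ← matAct_add, h.alpha_beta, matAct,
    map_zero]
  rfl

theorem IsDiracMatrices.norm_matAct_beta (h : IsDiracMatrices α β) (u : Spinor N) :
    ‖matAct β u‖ = ‖u‖ := by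
  rw [← sq_eq_sq₀ (norm_nonneg _) (norm_nonneg _), ← inner_self_eq_norm_sq (𝕜 := ℂ),
    inner_matAct h.hermitian_beta, ← matAct_mul, h.beta_beta, matAct, map_one]
  exact inner_self_eq_norm_sq u

/-- The symmetric operators `β` and `α·v` anticommute, so their product is skew-adjoint. -/
theorem IsDiracMatrices.inner_beta_clifford_re (h : IsDiracMatrices α β) (v : Space d)
    (u : Spinor N) :
    (inner ℂ (matAct β u) (clifford (fun j => matAct (α j)) v u) : ℂ).re = 0 := by
  have h1 : clifford (fun j => matAct (α j)) v (matAct β u)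
      = -matAct β (clifford (fun j => matAct (α j)) v u) := by
    simp only [clifford_apply, map_sum, map_smul, h.matAct_alpha_beta, smul_neg,
      Finset.sum_neg_distrib]
  have h2 : (inner ℂ (matAct β u) (clifford (fun j => matAct (α j)) v u) : ℂ)
      = -inner ℂ (clifford (fun j => matAct (α j)) v u) (matAct β u) := by
    rw [← h.isCliffordFamily.inner_clifford, h1, inner_neg_left, inner_matAct h.hermitian_beta]
  have h3 := congrArg Complex.re h2
  have h4 := inner_re_symm (𝕜 := ℂ) (matAct β u) (clifford (fun j => matAct (α j)) v u)
  change Complex.re _ = Complex.re _ at h4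
  rw [Complex.neg_re, ← h4] at h3
  linarith

end MatrixAction

/-! ### Consequences of the assumptions on `A` and `B` -/

section DiracAssumptions

variable {d N : ℕ}
variable {A : Space d → Space d} {B : Space d → Matrix (Fin d) (Fin d) ℝ} {x₀ : Space d}
variable {α : Fin d → Matrix (Fin N) (Fin N) ℂ} {β : Matrix (Fin N) (Fin N) ℂ}

/-- If the magnetic Dirac operator is defined on all of `H¹`, then `A ψ ∈ L²` for `ψ ∈ H¹`. -/
theorem IsDiracMatrices.mulH1 (h : IsDiracMatrices α β) (hA : MemL2Loc A) {m : ℝ}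
    (hdom : (diracOp α β m A (fun _ => 0)).domain = SobolevH1 d N) : MulH1 A N := by
  intro ψ j
  have hψ : (ψ : SpinorL2 d N) ∈ diracDomain α β m A (fun _ => 0) := by
    have : (ψ : SpinorL2 d N) ∈ (diracOp α β m A (fun _ => 0)).domain := by
      rw [hdom]; exact ψ.2
    exact this
  obtain ⟨h1, h2⟩ := hψ
  have m0 := Lp.memLp (ψ : SpinorL2 d N)
  have hw := memLp_finsetSum Finset.univ fun j _ =>
    (IsBddField.const (matAct (α j))).memLp (Lp.memLp (weakPartial j ψ))
  have hβ := (IsBddField.const (matAct β)).memLp m0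
  -- Subtracting the weak derivatives and the mass term from the square integrable Dirac expression
  -- isolates `α·A ψ`. Since `|α·A ψ| = |A||ψ|`, no cancellation among the components of `A` can
  -- occur.
  have hc : MemLp (fun x => clifford (fun j => matAct (α j)) (A x) ((ψ : SpinorL2 d N) x)) 2
      volume := by
    refine (((hw.const_smul (-Complex.I)).add (hβ.const_smul (m : ℂ))).sub h2).ae_eq
      (Eventually.of_forall fun x => ?_)
    have h3 : matAct (0 : Matrix (Fin N) (Fin N) ℂ) ((ψ : SpinorL2 d N) x) = 0 := by
      rw [matAct, map_zero]; rfl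
    have hI : ∀ z : ℂ, ∀ u : Spinor N, Complex.I • (Complex.I * z) • u = -(z • u) := fun z u => by
      rw [smul_smul, ← mul_assoc, Complex.I_mul_I, neg_one_mul, neg_smul]
    simp only [Pi.sub_apply, Pi.add_apply, Pi.neg_apply, Pi.smul_apply, diracExpr, h3, add_zero, magPartial,
      map_sub, map_smul, Finset.sum_sub_distrib, clifford_apply, smul_sub, neg_smul,
      Finset.smul_sum, hI, Finset.sum_neg_distrib]
    abel
  have hAm := hA.locallyIntegrable.aestronglyMeasurable
  refine hc.of_le ?_ (Eventually.of_forall fun x => ?_)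
  · exact ((Complex.continuous_ofReal.comp (coordCLM j).continuous).comp_aestronglyMeasurable
      hAm).smul m0.1
  · rw [h.isCliffordFamily.norm_clifford, norm_smul, Complex.norm_real, Real.norm_eq_abs]
    gcongr
    exact abs_coord_le _ _

/-- Exchanging `j` and `k` reverses the sign of the distributional definition, and test functions
determine a locally integrable function almost everywhere. -/
theorem IsMagneticField.ae_skew (hAB : IsMagneticField A B) (hB : MemL2Loc B) :
    ∀ᵐ x, ∀ j k, B x j k = -B x k j := by
  simp_rw [ae_all_iff]
  intro j k
  refine ae_eq_of_integral_contDiff_smul_eq (hB.locallyIntegrable_entry j k)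
    (hB.locallyIntegrable_entry k j).neg fun φ hφ hc => ?_
  simp only [smul_eq_mul, mul_neg, integral_neg]
  rw [hAB j k φ hφ hc, hAB k j φ hφ hc, ← integral_neg]
  exact integral_congr_ae (Eventually.of_forall fun x => by ring)

theorem weightedMass_sq {w : Space d → ℝ} (ψ : SobolevH1 d N) :
    weightedMass (fun x => w x ^ 2) ψ = ∫⁻ x, ‖w x • (ψ : SpinorL2 d N) x‖ₑ ^ 2 := by
  refine lintegral_congr fun x => ?_
  rw [enorm_smul, mul_pow, Real.enorm_eq_ofReal_abs, ← ENNReal.ofReal_pow (abs_nonneg _), sq_abs]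

theorem memLp_smul_of_weightedMass_le (hmul : MulH1 A N) {w : Space d → ℝ}
    (hw : AEStronglyMeasurable w volume) {ε : ℝ} (ψ : SobolevH1 d N)
    (h : weightedMass (fun x => w x ^ 2) ψ ≤ ENNReal.ofReal (ε ^ 2) * magEnergy A ψ) :
    ∃ hm : MemLp (fun x => w x • (ψ : SpinorL2 d N) x) 2 volume,
      ‖hm.toLp _‖ ^ 2 ≤ ε ^ 2 * gradSq A ψ := by
  rw [weightedMass_sq, magEnergy_eq hmul, ← ENNReal.ofReal_mul (sq_nonneg _)] at h
  have hm := memLp_two_of_lintegral_le (hw.smul (Lp.aestronglyMeasurable _)) h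
  refine ⟨hm, ?_⟩
  rw [MemLp.norm_toLp_sq]
  exact integral_norm_sq_le hm (mul_nonneg (sq_nonneg _) (gradSq_nonneg A ψ)) h

theorem aestronglyMeasurable_norm_sub (x₀ : Space d) :
    AEStronglyMeasurable (fun x : Space d => ‖x - x₀‖) volume :=
  (continuous_id.sub continuous_const).norm.aestronglyMeasurable

end DiracAssumptions

/-! ### The potential away from its singularity -/

section Potential

open Topology

variable {d N : ℕ} {x₀ : Space d} {V : Space d → Matrix (Fin N) (Fin N) ℂ}

theorem continuousOn_partial_of_contDiffOn (hV : ContDiffOn ℝ ∞ V {x₀}ᶜ) (k : Fin d) :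
    ContinuousOn (fun x => fderiv ℝ V x (stdVec k)) {x₀}ᶜ :=
  (hV.continuousOn_fderiv_of_isOpen isOpen_compl_singleton (by simp)).clm_apply continuousOn_const

theorem aestronglyMeasurable_gradNorm (hd : 1 ≤ d) (hV : ContDiffOn ℝ ∞ V {x₀}ᶜ) :
    AEStronglyMeasurable (gradNorm V) volume := by
  refine aestronglyMeasurable_of_continuousOn_compl_singleton (x₀ := x₀) hd ?_
  exact (continuousOn_finsetSum _ fun k _ =>
    (continuousOn_partial_of_contDiffOn hV k).norm.pow 2).sqrt

theorem norm_partial_le_gradNorm (V : Space d → Matrix (Fin N) (Fin N) ℂ) (x : Space d)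
    (k : Fin d) : ‖fderiv ℝ V x (stdVec k)‖ ≤ gradNorm V x :=
  Real.le_sqrt_of_sq_le (Finset.single_le_sum (f := fun k => ‖fderiv ℝ V x (stdVec k)‖ ^ 2)
    (fun _ _ => sq_nonneg _) (Finset.mem_univ k))

theorem gradNorm_nonneg (V : Space d → Matrix (Fin N) (Fin N) ℂ) (x : Space d) :
    0 ≤ gradNorm V x := Real.sqrt_nonneg _

theorem differentiableAt_of_contDiffOn (hV : ContDiffOn ℝ ∞ V {x₀}ᶜ) {x : Space d}
    (hx : x ≠ x₀) : DifferentiableAt ℝ V x :=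
  (hV.contDiffAt (isOpen_compl_singleton.mem_nhds hx)).differentiableAt (by simp)

/-- Continuity off `x₀` and density of a set of full measure upgrade the almost everywhere statement
to a pointwise one, which can then be differentiated. -/
theorem isHermitian_of_ae (hV : ContDiffOn ℝ ∞ V {x₀}ᶜ)
    (hherm : ∀ᵐ x, (V x).IsHermitian) {x : Space d} (hx : x ≠ x₀) : (V x).IsHermitian := by
  by_contra hcon
  have hc : ContinuousAt (fun y => (V y).conjTranspose - V y) x :=
    ((continuous_star.continuousAt (x := V x)).comp
      (differentiableAt_of_contDiffOn hV hx).continuousAt).sub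
      (differentiableAt_of_contDiffOn hV hx).continuousAt
  have hne := hc.eventually_ne (sub_ne_zero.2 hcon)
  obtain ⟨y, hy, hy'⟩ := (Measure.dense_of_ae hherm).inter_nhds_nonempty hne
  exact hy' (sub_eq_zero.2 hy)

theorem partial_isHermitian (hV : ContDiffOn ℝ ∞ V {x₀}ᶜ)
    (hherm : ∀ᵐ x, (V x).IsHermitian) {x : Space d} (hx : x ≠ x₀) (k : Fin d) :
    (fderiv ℝ V x (stdVec k)).IsHermitian := by
  have hD := (differentiableAt_of_contDiffOn hV hx).hasFDerivAt
  have h1 : HasFDerivAt (fun y => star (V y)) _ x := hD.star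
  have h2 : (fun y => star (V y)) =ᶠ[𝓝 x] V := by
    filter_upwards [isOpen_compl_singleton.mem_nhds hx] with y hy
    exact (isHermitian_of_ae hV hherm hy).eq
  have h3 := h2.fderiv_eq (𝕜 := ℝ)
  rw [h1.fderiv] at h3
  exact congrArg (fun L => L (stdVec k)) h3

theorem partial_anticomm (β : Matrix (Fin N) (Fin N) ℂ) (hV : ContDiffOn ℝ ∞ V {x₀}ᶜ)
    (hβ : ∀ x, x ≠ x₀ → β * V x + V x * β = 0) {x : Space d} (hx : x ≠ x₀) (k : Fin d) :
    β * fderiv ℝ V x (stdVec k) + fderiv ℝ V x (stdVec k) * β = 0 := by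
  have hD := (differentiableAt_of_contDiffOn hV hx).hasFDerivAt
  have h1 : HasFDerivAt (fun y => β * V y + V y * β) _ x := (hD.const_mul β).add (hD.mul_const' β)
  have h2 : (fun y => β * V y + V y * β) =ᶠ[𝓝 x] fun _ => 0 := by
    filter_upwards [isOpen_compl_singleton.mem_nhds hx] with y hy
    exact hβ y hy
  have h3 := h2.fderiv_eq (𝕜 := ℝ)
  rw [h1.fderiv] at h3
  have h4 := congrArg (fun L => L (stdVec k)) h3
  simpa using h4

/-- The term `(x - x₀)·∇V ψ`. -/
noncomputable def radialDeriv (V : Space d → Matrix (Fin N) (Fin N) ℂ) (x₀ : Space d)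
    (ψ : SobolevH1 d N) (x : Space d) : Spinor N :=
  ∑ k, (x - x₀) k • matAct (fderiv ℝ V x (stdVec k)) ((ψ : SpinorL2 d N) x)

theorem norm_radialDeriv_le (V : Space d → Matrix (Fin N) (Fin N) ℂ) (x₀ : Space d)
    (ψ : SobolevH1 d N) (x : Space d) :
    ‖radialDeriv V x₀ ψ x‖ ≤ ‖(‖x - x₀‖ * gradNorm V x) • (ψ : SpinorL2 d N) x‖ := by
  rw [norm_smul, norm_mul, norm_norm, Real.norm_eq_abs, abs_of_nonneg (gradNorm_nonneg V x)]
  calc ‖radialDeriv V x₀ ψ x‖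
      ≤ ∑ k, |(x - x₀) k| * ‖fderiv ℝ V x (stdVec k)‖ * ‖(ψ : SpinorL2 d N) x‖ := by
        refine (norm_sum_le _ _).trans (Finset.sum_le_sum fun k _ => ?_)
        rw [norm_smul, Real.norm_eq_abs, mul_assoc]
        gcongr
        exact (matAct _).le_opNorm _
    _ = (∑ k, |(x - x₀) k| * ‖fderiv ℝ V x (stdVec k)‖) * ‖(ψ : SpinorL2 d N) x‖ := by
        rw [Finset.sum_mul]
    _ ≤ _ := by
        gcongr
        refine (Real.sum_mul_le_sqrt_mul_sqrt _ _ _).trans_eq ?_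
        rw [EuclideanSpace.norm_eq, gradNorm]
        rfl

theorem aestronglyMeasurable_partial_apply (hd : 1 ≤ d) (hV : ContDiffOn ℝ ∞ V {x₀}ᶜ) (k : Fin d)
    (ψ : SobolevH1 d N) : AEStronglyMeasurable
      (fun x => (x - x₀) k • matAct (fderiv ℝ V x (stdVec k)) ((ψ : SpinorL2 d N) x)) volume := by
  have h1 : AEStronglyMeasurable (fun x => matActL N (fderiv ℝ V x (stdVec k))) volume :=
    (matActL N).continuous.comp_aestronglyMeasurable
      (aestronglyMeasurable_of_continuousOn_compl_singleton hd
        (continuousOn_partial_of_contDiffOn hV k))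
  have hc : Continuous fun x : Space d => (x - x₀) k :=
    (coordCLM k).continuous.comp (continuous_id.sub continuous_const)
  exact hc.aestronglyMeasurable.smul
    (AEStronglyMeasurable.field_apply h1 (Lp.aestronglyMeasurable _))

theorem memLp_partial_apply (hd : 1 ≤ d) (hV : ContDiffOn ℝ ∞ V {x₀}ᶜ) {ψ : SobolevH1 d N}
    (hm : MemLp (fun x => (‖x - x₀‖ * gradNorm V x) • (ψ : SpinorL2 d N) x) 2 volume) (k : Fin d) :
    MemLp (fun x => (x - x₀) k • matAct (fderiv ℝ V x (stdVec k)) ((ψ : SpinorL2 d N) x)) 2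
      volume := by
  refine hm.of_le (aestronglyMeasurable_partial_apply hd hV k ψ)
    (Eventually.of_forall fun x => ?_)
  rw [norm_smul, norm_smul, norm_mul, norm_norm, Real.norm_eq_abs, Real.norm_eq_abs,
    abs_of_nonneg (gradNorm_nonneg V x), mul_assoc]
  have h1 := abs_coord_le (x - x₀) k
  have h2 := norm_partial_le_gradNorm V x k
  gcongr
  exact ((matAct _).le_opNorm _).trans (by rw [norm_matAct]; gcongr)

end Potential

/-! ### The smallness condition -/

section Numerics

/-- Here `P = ‖p‖`, `h = 2/(d-2)`, `M` is the mass term, `t` the field term and `s` the spin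
coupling. Dividing by `P²` or `G²`, whichever is larger, would make a sum of coefficients at least
1. The smallness condition permits equality, so the borderline case needs the extra information that
`M ≤ 0` for `ε₂ = 0` and that the bound for `q` is strict. -/
theorem smallness_contradiction {h m G P M t s q ε₁ ε₂ ε₃ ε₄ : ℝ} (hh : 0 < h) (hm : 0 ≤ m)
    (hG : 0 < G) (hP : 0 ≤ P) (hε₁ : 0 ≤ ε₁) (hε₂ : 0 ≤ ε₂) (hε₃ : 0 ≤ ε₃)
    (hsmall : (2 + h / 2) * ε₁ + h * (ε₂ * ε₃) + m * ε₄ ^ 2 + (4 + 2 * h) * ε₃ + (2 + h) * ε₂ ≤ 1)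
    (hkin : P ^ 2 = G ^ 2 + s)
    (henergy : P ^ 2 ≤ ε₂ * G * P + h * (ε₂ * ε₃) * G ^ 2 + M + t + h * (ε₃ * ε₁) * G ^ 2
      + h * ε₃ * G * P)
    (hM : M ≤ m * ε₄ ^ 2 * G ^ 2) (hM0 : ε₂ = 0 → M ≤ 0) (ht : t ≤ ε₁ * G * P)
    (hspin : -s + t ≤ ε₁ * G * q) (hq : P < G → q < (2 + h / 2) * G) : False := by
  have h23 : 0 ≤ h * (ε₂ * ε₃) := by positivity
  have h4 : 0 ≤ m * ε₄ ^ 2 := by positivity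
  have hhε₁ := mul_nonneg hh.le hε₁
  have hhε₂ := mul_nonneg hh.le hε₂
  have hhε₃ := mul_nonneg hh.le hε₃
  have he1 : ε₁ ≤ 1 / 2 := by linarith
  -- The product `ε₃ε₁` is absent from the smallness condition; it is absorbed by the generous
  -- coefficient of `ε₃`.
  have h31 : h * (ε₃ * ε₁) ≤ h / 2 * ε₃ := by nlinarith [mul_nonneg hh.le hε₃]
  have h31' : 0 ≤ h * (ε₃ * ε₁) := by positivity
  rcases le_or_gt G P with hGP | hPG
  · have hP0 : 0 < P := hG.trans_le hGP
    have hGG : G ^ 2 ≤ P ^ 2 := by gcongr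
    have hGPP : G * P ≤ P ^ 2 := by nlinarith
    have hle : P ^ 2 ≤ (ε₂ + h * (ε₂ * ε₃) + ε₁ + h * (ε₃ * ε₁) + h * ε₃) * P ^ 2 + M := by
      have k1 := mul_le_mul_of_nonneg_left hGPP hε₂
      have k2 := mul_le_mul_of_nonneg_left hGG h23
      have k3 := mul_le_mul_of_nonneg_left hGPP hε₁
      have k4 := mul_le_mul_of_nonneg_left hGG h31'
      have k5 := mul_le_mul_of_nonneg_left hGPP hhε₃
      linarith
    have hMP : M ≤ m * ε₄ ^ 2 * P ^ 2 := hM.trans (by gcongr)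
    have hc : 1 ≤ ε₂ + h * (ε₂ * ε₃) + m * ε₄ ^ 2 + ε₁ + h * (ε₃ * ε₁) + h * ε₃ := by
      refine le_of_mul_le_mul_right (?_ : 1 * P ^ 2 ≤ _ * P ^ 2) (by positivity)
      linarith
    -- The coefficients of `ε₁`, `ε₂`, `ε₃` in the smallness condition strictly exceed those in
    -- `hc`, so all three numbers vanish and `hle` reads `P² ≤ M ≤ 0`.
    have z1 : ε₁ = 0 := by linarith
    have z2 : ε₂ = 0 := by linarith
    have z3 : ε₃ = 0 := by linarith
    have := hM0 z2
    rw [z1, z2, z3] at hle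
    nlinarith [pow_pos hP0 2]
  · have hGG : 0 < G ^ 2 := by positivity
    have hGP : G * P ≤ G ^ 2 := by nlinarith
    have hq' := hq hPG
    have hle : G ^ 2 ≤ (ε₂ + h * (ε₂ * ε₃) + h * (ε₃ * ε₁) + h * ε₃) * G ^ 2 + M
        + ε₁ * G * q := by
      have k1 := mul_le_mul_of_nonneg_left hGP hε₂
      have k5 := mul_le_mul_of_nonneg_left hGP hhε₃
      linarith
    have hqle : ε₁ * G * q ≤ (2 + h / 2) * ε₁ * G ^ 2 := by
      have := mul_le_mul_of_nonneg_left hq'.le (mul_nonneg hε₁ hG.le)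
      linarith
    have hc : 1 ≤ ε₂ + h * (ε₂ * ε₃) + h * (ε₃ * ε₁) + h * ε₃ + m * ε₄ ^ 2
        + (2 + h / 2) * ε₁ := by
      refine le_of_mul_le_mul_right (?_ : 1 * G ^ 2 ≤ _ * G ^ 2) hGG
      linarith
    -- The coefficient of `ε₁` is now matched exactly, so only `ε₂` and `ε₃` are forced to vanish;
    -- the contradiction must come from `q < (2 + h/2) G`.
    have z2 : ε₂ = 0 := by linarith
    have z3 : ε₃ = 0 := by linarith
    have hM' := hM0 z2
    rw [z2, z3] at hle
    have hle' : G ^ 2 ≤ ε₁ * G * q := by linarith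
    have hε : 0 < ε₁ := by
      rcases hε₁.lt_or_eq with h | h
      · exact h
      · rw [← h] at hle'; linarith
    have hlt : ε₁ * G * q < (2 + h / 2) * ε₁ * G ^ 2 := by
      have := mul_lt_mul_of_pos_left hq' (mul_pos hε hG)
      linarith
    have h1 : (2 + h / 2) * ε₁ ≤ 1 := by linarith
    nlinarith

end Numerics

/-! ### The energy estimate in an abstract Hilbert space -/

section EnergyEstimate

variable {ℋ : Type*} [NormedAddCommGroup ℋ] [InnerProductSpace ℂ ℋ]

/-- The energy estimate obtained by inserting the eigenvalue equation `E ψ = φ + m w + u` into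
the virial identity. -/
theorem energy_estimate {ψ φ w u v b : ℋ} {E m : ℝ} (hE : (E : ℂ) • ψ = φ + (m : ℂ) • w + u)
    (hvir : (inner ℂ ψ v : ℂ).re = (inner ℂ ψ b : ℂ).re + (inner ℂ ψ φ : ℂ).re)
    (hφw : (inner ℂ φ w : ℂ).re = 0) (hwb : (inner ℂ w b : ℂ).re = 0) :
    ‖φ‖ ^ 2 ≤ ‖v‖ * ‖φ‖ + ‖u‖ * ‖v‖ + m * (inner ℂ w v : ℂ).re - (inner ℂ φ b : ℂ).re
      + ‖u‖ * ‖b‖ + ‖u‖ * ‖φ‖ := by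
  have hexp : ∀ z : ℋ, E * (inner ℂ ψ z : ℂ).re
      = (inner ℂ φ z : ℂ).re + m * (inner ℂ w z : ℂ).re + (inner ℂ u z : ℂ).re := by
    intro z
    have h := congrArg (fun y => (inner ℂ y z : ℂ).re) hE
    simp only [inner_add_left, inner_smul_left, Complex.conj_ofReal, Complex.add_re,
      Complex.re_ofReal_mul] at h
    exact h
  have hle : ∀ y z : ℋ, |(inner ℂ y z : ℂ).re| ≤ ‖y‖ * ‖z‖ := fun y z =>
    (Complex.abs_re_le_norm _).trans (norm_inner_le_norm _ _)
  have hφφ : (inner ℂ φ φ : ℂ).re = ‖φ‖ ^ 2 := inner_self_eq_norm_sq (𝕜 := ℂ) φ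
  have hwφ : (inner ℂ w φ : ℂ).re = 0 := (inner_re_symm (𝕜 := ℂ) w φ).trans hφw
  have h1 := hexp v
  have h2 := hexp b
  have h3 := hexp φ
  -- The virial identity is multiplied by `E`, and the equation is inserted in its three pairings,
  -- with `v`, `b` and `φ`.
  rw [hvir, mul_add] at h1
  rw [hwφ, hφφ] at h3
  rw [hwb] at h2
  have k1 := abs_le.1 (hle φ v)
  have k2 := abs_le.1 (hle u v)
  have k3 := abs_le.1 (hle u b)
  have k4 := abs_le.1 (hle u φ)
  linarith [mul_comm ‖v‖ ‖φ‖, k1.2, k2.2, k3.1, k4.1]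

/-- Energy estimate, virial identity and spin estimate are incompatible with the smallness
condition. -/
theorem false_of_virial_of_small {ψ p w u v b : ℋ} {S : ℂ} {E m h G q ε₁ ε₂ ε₃ ε₄ : ℝ}
    (hh : 0 < h) (hm : 0 ≤ m) (hG : 0 < G) (hε₁ : 0 ≤ ε₁) (hε₂ : 0 ≤ ε₂) (hε₃ : 0 ≤ ε₃)
    (hsmall : (2 + h / 2) * ε₁ + h * (ε₂ * ε₃) + m * ε₄ ^ 2 + (4 + 2 * h) * ε₃ + (2 + h) * ε₂ ≤ 1)
    (hE : -Complex.I • p + (m : ℂ) • w + u = (E : ℂ) • ψ)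
    (hvir : (inner ℂ ψ v : ℂ) = inner ℂ ψ b - Complex.I * inner ℂ ψ p)
    (hpw : (inner ℂ p w : ℂ).im = 0) (hwb : (inner ℂ w b : ℂ).re = 0)
    (hv : ‖v‖ ≤ ε₂ * G) (hu : ‖u‖ ≤ h * ε₃ * G) (hb : ‖b‖ ≤ ε₁ * G)
    (hmass : m * (inner ℂ w v : ℂ).re ≤ m * ε₄ ^ 2 * G ^ 2)
    (hkin : 2 * (inner ℂ p p : ℂ) = 2 * ((G ^ 2 : ℝ) : ℂ) + Complex.I * S)
    (hspin : -(Complex.I / 2 * S).re + (-Complex.I * inner ℂ p b).re ≤ ε₁ * G * q)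
    (hq : ‖p‖ < G → q < (2 + h / 2) * G) : False := by
  have hφ : ‖-Complex.I • p‖ = ‖p‖ := by rw [norm_smul, norm_neg, Complex.norm_I, one_mul]
  have hest := energy_estimate hE.symm (b := b) (v := v)
    (by
      rw [hvir, inner_smul_right, ← Complex.add_re]
      congr 1
      ring)
    (by
      rw [inner_smul_left]
      simpa using hpw) hwb
  rw [hφ] at hest
  have hkin' : ‖p‖ ^ 2 = G ^ 2 + (Complex.I / 2 * S).re := by
    rw [inner_self_eq_norm_sq_to_K] at hkin
    have h1 : ((‖p‖ ^ 2 : ℝ) : ℂ) = ((G ^ 2 : ℝ) : ℂ) + Complex.I / 2 * S := by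
      have h0 : (2 : ℂ) * ((‖p‖ ^ 2 : ℝ) : ℂ) = 2 * ((G ^ 2 : ℝ) : ℂ) + Complex.I * S := by
        rw [← hkin, Complex.ofReal_pow]; rfl
      linear_combination h0 / 2
    have h2 := congrArg Complex.re h1
    rwa [Complex.ofReal_re, Complex.add_re, Complex.ofReal_re] at h2
  have ht : -(inner ℂ (-Complex.I • p) b : ℂ).re = (-Complex.I * inner ℂ p b).re := by
    rw [inner_smul_left, ← Complex.neg_re]
    congr 1
    simp
  refine smallness_contradiction (t := -(inner ℂ (-Complex.I • p) b : ℂ).re) hh hm hG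
    (norm_nonneg p) hε₁ hε₂ hε₃ hsmall hkin' ?_ hmass ?_ ?_ (ht ▸ hspin) hq
  · have k1 : ‖v‖ * ‖p‖ ≤ ε₂ * G * ‖p‖ := by gcongr
    have k2 : ‖u‖ * ‖v‖ ≤ h * ε₃ * G * (ε₂ * G) := by gcongr
    have k3 : ‖u‖ * ‖b‖ ≤ h * ε₃ * G * (ε₁ * G) := by gcongr
    have k4 : ‖u‖ * ‖p‖ ≤ h * ε₃ * G * ‖p‖ := by gcongr
    linarith
  -- If `ε₂ = 0` then `v = 0`, so the mass term vanishes whatever `ε₄` is.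
  · intro hz
    rw [hz, zero_mul] at hv
    rw [norm_le_zero_iff.1 hv, inner_zero_right, Complex.zero_re, mul_zero]
  · have k := (neg_le_abs _).trans ((Complex.abs_re_le_norm _).trans
      (norm_inner_le_norm (𝕜 := ℂ) (-Complex.I • p) b))
    rw [hφ] at k
    refine k.trans ?_
    calc ‖p‖ * ‖b‖ ≤ ‖p‖ * (ε₁ * G) := by gcongr
      _ = _ := by ring

end EnergyEstimate

/-! ### Identities for eigenfunctions of the Dirac operator -/

section DiracEquation

open Topology

variable {d N : ℕ}
variable {A : Space d → Space d} {B : Space d → Matrix (Fin d) (Fin d) ℝ} {x₀ : Space d}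
variable {α : Fin d → Matrix (Fin N) (Fin N) ℂ} {β : Matrix (Fin N) (Fin N) ℂ}
variable {V : Space d → Matrix (Fin N) (Fin N) ℂ}

/-- The operator `α·∇_A` is skew-symmetric: the magnetic derivatives are skew-symmetric and commute
with the constant symmetric matrices. -/
theorem IsCliffordFamily.integral_inner_cliffordGrad_re {a : Fin d → Spinor N →L[ℂ] Spinor N}
    (ha : IsCliffordFamily a) (hmul : MulH1 A N) (ψ : SobolevH1 d N) :
    (∫ x, inner ℂ ((ψ : SpinorL2 d N) x) (cliffordGrad a A ψ x) : ℂ).re = 0 := by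
  have m0 := Lp.memLp (ψ : SpinorL2 d N)
  have mp := hmul.memLp_cliffordGrad a ψ
  have mD := fun i => hmul.memLp_magPartial ψ i
  have i1 : ∀ j, Integrable fun x =>
      (inner ℂ ((ψ : SpinorL2 d N) x) (a j (magPartial A ψ j x)) : ℂ) := fun j =>
    MemLp.integrable_spinor_inner m0 ((IsBddField.const (a j)).memLp (mD j))
  have i2 : ∀ j, Integrable fun x =>
      (inner ℂ (magPartial A ψ j x) (a j ((ψ : SpinorL2 d N) x)) : ℂ) := fun j =>
    MemLp.integrable_spinor_inner (mD j) ((IsBddField.const (a j)).memLp m0)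
  have h := Finset.sum_congr (s₁ := Finset.univ) rfl fun j _ =>
    integral_inner_const_magPartial hmul (a j) ψ j
  rw [Finset.sum_add_distrib, ← integral_finsetSum _ fun j _ => i1 j,
    ← integral_finsetSum _ fun j _ => i2 j, Finset.sum_const_zero] at h
  have e1 : ∫ x, ∑ j, (inner ℂ ((ψ : SpinorL2 d N) x) (a j (magPartial A ψ j x)) : ℂ)
      = inner ℂ (m0.toLp _) (mp.toLp _) := by
    rw [← integral_inner_eq]
    simp_rw [cliffordGrad, inner_sum]
  have e2 : ∫ x, ∑ j, (inner ℂ (magPartial A ψ j x) (a j ((ψ : SpinorL2 d N) x)) : ℂ)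
      = inner ℂ (mp.toLp _) (m0.toLp _) := by
    rw [← integral_inner_eq]
    simp_rw [cliffordGrad, sum_inner, ha.symm]
  rw [e1, e2] at h
  rw [integral_inner_eq m0 mp]
  have h1 := congrArg Complex.re h
  have h2 := inner_re_symm (𝕜 := ℂ) (m0.toLp _) (mp.toLp _)
  change Complex.re _ = Complex.re _ at h2
  rw [Complex.add_re, ← h2, Complex.zero_re] at h1
  linarith

/-- Integration by parts with the constant matrices `α_j β`, together with anticommutation, gives
`⟨p, βψ⟩ = ⟨βψ, p⟩`. This makes the kinetic and mass terms orthogonal in real part. -/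
theorem IsDiracMatrices.integral_inner_cliffordGrad_beta_im (h : IsDiracMatrices α β)
    (hmul : MulH1 A N) (ψ : SobolevH1 d N) :
    (∫ x, inner ℂ (cliffordGrad (fun j => matAct (α j)) A ψ x)
      (matAct β ((ψ : SpinorL2 d N) x)) : ℂ).im = 0 := by
  have m0 := Lp.memLp (ψ : SpinorL2 d N)
  have mw := (IsBddField.const (matAct β)).memLp m0
  have mp := hmul.memLp_cliffordGrad (fun j => matAct (α j)) ψ
  have mD := fun i => hmul.memLp_magPartial ψ i
  have i1 : ∀ j, Integrable fun x => (inner ℂ ((ψ : SpinorL2 d N) x)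
      ((matAct (α j) ∘L matAct β) (magPartial A ψ j x)) : ℂ) := fun j =>
    MemLp.integrable_spinor_inner m0 ((IsBddField.const _).memLp (mD j))
  have i2 : ∀ j, Integrable fun x => (inner ℂ (magPartial A ψ j x)
      ((matAct (α j) ∘L matAct β) ((ψ : SpinorL2 d N) x)) : ℂ) := fun j =>
    MemLp.integrable_spinor_inner (mD j) ((IsBddField.const _).memLp m0)
  have h0 := Finset.sum_congr (s₁ := Finset.univ) rfl fun j _ =>
    integral_inner_const_magPartial hmul (matAct (α j) ∘L matAct β) ψ j
  rw [Finset.sum_add_distrib, ← integral_finsetSum _ fun j _ => i1 j,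
    ← integral_finsetSum _ fun j _ => i2 j, Finset.sum_const_zero] at h0
  have e1 : ∫ x, ∑ j, (inner ℂ ((ψ : SpinorL2 d N) x)
      ((matAct (α j) ∘L matAct β) (magPartial A ψ j x)) : ℂ)
      = -inner ℂ (mw.toLp _) (mp.toLp _) := by
    rw [← integral_inner_eq, ← integral_neg]
    simp_rw [cliffordGrad, inner_sum, ContinuousLinearMap.comp_apply, h.matAct_alpha_beta,
      inner_neg_right, inner_matAct h.hermitian_beta, Finset.sum_neg_distrib]
  have e2 : ∫ x, ∑ j, (inner ℂ (magPartial A ψ j x)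
      ((matAct (α j) ∘L matAct β) ((ψ : SpinorL2 d N) x)) : ℂ)
      = inner ℂ (mp.toLp _) (mw.toLp _) := by
    rw [← integral_inner_eq]
    simp_rw [cliffordGrad, sum_inner, ContinuousLinearMap.comp_apply,
      inner_matAct (h.hermitian_alpha _)]
  rw [e1, e2] at h0
  rw [integral_inner_eq mp mw]
  have h1 := congrArg Complex.im h0
  have h2 := inner_im_symm (𝕜 := ℂ) (mw.toLp _) (mp.toLp _)
  change Complex.im _ = -Complex.im _ at h2
  rw [Complex.add_im, Complex.neg_im, h2, Complex.zero_im] at h1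
  linarith

theorem im_inner_eq_zero_of_symm {f g : Space d → Spinor N} (hf : MemLp f 2 volume)
    (hg : MemLp g 2 volume)
    (h : ∀ᵐ x, (inner ℂ (f x) (g x) : ℂ) = inner ℂ (g x) (f x)) :
    (inner ℂ (hf.toLp f) (hg.toLp g) : ℂ).im = 0 := by
  have h1 : (inner ℂ (hf.toLp f) (hg.toLp g) : ℂ) = inner ℂ (hg.toLp g) (hf.toLp f) := by
    rw [← integral_inner_eq, ← integral_inner_eq]
    exact integral_congr_ae h
  have h2 := inner_im_symm (𝕜 := ℂ) (hf.toLp f) (hg.toLp g)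
  change Complex.im _ = -Complex.im _ at h2
  rw [← h1] at h2
  linarith

theorem memLp_radialDeriv (hd : 1 ≤ d) (hV : ContDiffOn ℝ ∞ V {x₀}ᶜ) {ψ : SobolevH1 d N}
    (hm : MemLp (fun x => (‖x - x₀‖ * gradNorm V x) • (ψ : SpinorL2 d N) x) 2 volume) :
    MemLp (radialDeriv V x₀ ψ) 2 volume :=
  memLp_finsetSum _ fun k _ => memLp_partial_apply hd hV hm k

/-- The virial identity for an eigenfunction of the Dirac operator. -/
theorem IsDiracMatrices.virial_identity (h : IsDiracMatrices α β) (hd : 3 ≤ d) (hA : MemL2Loc A)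
    (hmul : MulH1 A N) (hB : MemL2Loc B) (hAB : IsMagneticField A B) (hBm : FieldMulH1 x₀ B N)
    (hV : ContDiffOn ℝ ∞ V {x₀}ᶜ) (hherm : ∀ᵐ x, (V x).IsHermitian) {m E : ℝ}
    {ψ : SobolevH1 d N}
    (hm : MemLp (fun x => (‖x - x₀‖ * gradNorm V x) • (ψ : SpinorL2 d N) x) 2 volume)
    (heig : ∀ᵐ x, diracExpr α β m A V ψ x = (E : ℂ) • (ψ : SpinorL2 d N) x) :
    ∫ x, inner ℂ ((ψ : SpinorL2 d N) x) (radialDeriv V x₀ ψ x)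
      = (∫ x, inner ℂ ((ψ : SpinorL2 d N) x)
          (cliffordField (fun j => matAct (α j)) B x₀ ψ x))
        - Complex.I * ∫ x, inner ℂ ((ψ : SpinorL2 d N) x)
          (cliffordGrad (fun j => matAct (α j)) A ψ x) := by
  set S : Spinor N →L[ℂ] Spinor N :=
    (E : ℂ) • ContinuousLinearMap.id ℂ (Spinor N) - (m : ℂ) • matAct β with hS
  -- The eigenvalue equation becomes `α·∇_A ψ = i W ψ` with `W = E - mβ - V`; only `-V` contributes
  -- to the derivative of `W`.
  set W : Space d → Spinor N →L[ℂ] Spinor N := fun x => S - matActL N (V x) with hWdef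
  have hWx : ∀ x u, W x u = (E : ℂ) • u - (m : ℂ) • matAct β u - matAct (V x) u := fun x u => rfl
  have hW : ContDiffOn ℝ 1 W {x₀}ᶜ :=
    contDiffOn_const.sub ((matActL N).contDiff.comp_contDiffOn (hV.of_le (by exact_mod_cast le_top)))
  have hWd : ∀ x, x ≠ x₀ → ∀ k, fderiv ℝ W x (stdVec k) = -matAct (fderiv ℝ V x (stdVec k)) := by
    intro x hx k
    have h1 : HasFDerivAt W _ x := ((matActL N).hasFDerivAt.comp x
      (differentiableAt_of_contDiffOn hV hx).hasFDerivAt).const_sub S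
    rw [h1.fderiv]
    rfl
  have hWs : ∀ᵐ x, ∀ u v, (inner ℂ (W x u) v : ℂ) = inner ℂ u (W x v) := by
    filter_upwards [hherm] with x hx u v
    simp only [hWx, inner_sub_left, inner_sub_right, inner_smul_left, inner_smul_right,
      Complex.conj_ofReal, inner_matAct hx, inner_matAct h.hermitian_beta]
  have heq : ∀ᵐ x, cliffordGrad (fun j => matAct (α j)) A ψ x
      = Complex.I • W x ((ψ : SpinorL2 d N) x) := by
    filter_upwards [heig] with x hx
    rw [hWx, ← hx, diracExpr, add_sub_right_comm, add_sub_cancel_right, add_sub_cancel_right,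
      smul_smul, mul_neg, Complex.I_mul_I, neg_neg, one_smul]
    rfl
  have hne := ae_ne_point (by omega : 1 ≤ d) x₀
  have hint : ∀ k, MemLp (fun x => (x - x₀) k • fderiv ℝ W x (stdVec k) ((ψ : SpinorL2 d N) x))
      2 volume := by
    intro k
    refine (memLp_partial_apply (by omega) hV hm k).neg.ae_eq ?_
    filter_upwards [hne] with x hx
    rw [hWd x hx, Pi.neg_apply, neg_apply, smul_neg]
  have hint' : ∀ k, Integrable (fun x => ‖x - x₀‖ * ‖fderiv ℝ W x (stdVec k)‖ *
      ‖(ψ : SpinorL2 d N) x‖ ^ 2) volume := by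
    intro k
    refine (MemLp.integrable_norm_mul_norm hm (Lp.memLp (ψ : SpinorL2 d N))).mono' ?_ ?_
    · have hWm : AEStronglyMeasurable (fun x => fderiv ℝ W x (stdVec k)) volume :=
        aestronglyMeasurable_of_continuousOn_compl_singleton (by omega)
          ((hW.continuousOn_fderiv_of_isOpen isOpen_compl_singleton le_rfl).clm_apply
            continuousOn_const)
      exact ((aestronglyMeasurable_norm_sub x₀).mul hWm.norm).mul
        ((Lp.aestronglyMeasurable _).norm.pow 2)
    · filter_upwards [hne] with x hx
      rw [hWd x hx, norm_neg, norm_matAct, Real.norm_of_nonneg (by positivity), norm_smul,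
        Real.norm_of_nonneg (mul_nonneg (norm_nonneg _) (gradNorm_nonneg V x)), sq, ← mul_assoc]
      gcongr
      exact norm_partial_le_gradNorm V x k
  have hvir := _root_.virial_identity h.isCliffordFamily hd hA hmul hB hAB hBm hW hWs heq hint hint'
  have e : ∫ x, inner ℂ ((ψ : SpinorL2 d N) x)
        (∑ k, (x - x₀) k • fderiv ℝ W x (stdVec k) ((ψ : SpinorL2 d N) x))
      = -∫ x, inner ℂ ((ψ : SpinorL2 d N) x) (radialDeriv V x₀ ψ x) := by
    rw [← integral_neg]
    refine integral_congr_ae ?_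
    filter_upwards [hne] with x hx
    simp only [hWd x hx, neg_apply, smul_neg, Finset.sum_neg_distrib, inner_neg_right]
    rfl
  rw [e] at hvir
  have hvir' := congrArg Neg.neg hvir
  rw [neg_neg] at hvir'
  rw [hvir']
  simp only [cliffordField]
  ring

/-- The contribution of the mass term to the virial identity. -/
theorem mass_term_le (h : IsDiracMatrices α β) (hd : 1 ≤ d) (hmul : MulH1 A N)
    (hV : ContDiffOn ℝ ∞ V {x₀}ᶜ) (hherm : ∀ᵐ x, (V x).IsHermitian) {m ε : ℝ} (hm : 0 ≤ m)
    {ψ : SobolevH1 d N}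
    (hm2 : MemLp (fun x => (‖x - x₀‖ * gradNorm V x) • (ψ : SpinorL2 d N) x) 2 volume)
    (hmass : (m ≠ 0 ∧ ∃ x, x ≠ x₀ ∧ β * V x + V x * β ≠ 0) →
      weightedMass (fun x => ‖x - x₀‖ * gradNorm V x) ψ ≤
        ENNReal.ofReal (ε ^ 2) * magEnergy A ψ) :
    m * (∫ x, inner ℂ (matAct β ((ψ : SpinorL2 d N) x)) (radialDeriv V x₀ ψ x) : ℂ).re
      ≤ m * ε ^ 2 * gradSq A ψ := by
  have m0 := Lp.memLp (ψ : SpinorL2 d N)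
  have mw := (IsBddField.const (matAct β)).memLp m0
  have mv := memLp_radialDeriv hd hV hm2
  have hR : 0 ≤ m * ε ^ 2 * gradSq A ψ :=
    mul_nonneg (mul_nonneg hm (sq_nonneg _)) (gradSq_nonneg A ψ)
  by_cases hcase : m ≠ 0 ∧ ∃ x, x ≠ x₀ ∧ β * V x + V x * β ≠ 0
  · have hw := hmass hcase
    have iw := MemLp.integrable_norm_mul_norm hm2 m0
    have e : ∀ x, ‖(‖x - x₀‖ * gradNorm V x) • (ψ : SpinorL2 d N) x‖ * ‖(ψ : SpinorL2 d N) x‖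
        = ‖x - x₀‖ * gradNorm V x * ‖(ψ : SpinorL2 d N) x‖ ^ 2 := fun x => by
      rw [norm_smul, norm_mul, norm_norm, Real.norm_eq_abs, abs_of_nonneg (gradNorm_nonneg V x)]
      ring
    have hle : ∫ x, ‖x - x₀‖ * gradNorm V x * ‖(ψ : SpinorL2 d N) x‖ ^ 2 ≤ ε ^ 2 * gradSq A ψ := by
      rw [magEnergy_eq hmul, ← ENNReal.ofReal_mul (sq_nonneg _)] at hw
      rw [← ENNReal.ofReal_le_ofReal_iff (mul_nonneg (sq_nonneg _) (gradSq_nonneg A ψ))]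
      refine Eq.trans_le ?_ hw
      simp_rw [e] at iw
      rw [ofReal_integral_eq_lintegral_ofReal iw (Eventually.of_forall fun x =>
        mul_nonneg (mul_nonneg (norm_nonneg _) (gradNorm_nonneg V x)) (sq_nonneg _))]
      refine lintegral_congr fun x => ?_
      rw [ENNReal.ofReal_mul (mul_nonneg (norm_nonneg _) (gradNorm_nonneg V x)),
        ENNReal.ofReal_pow (norm_nonneg _), ofReal_norm]
    rw [mul_assoc]
    refine mul_le_mul_of_nonneg_left (le_trans ?_ hle) hm
    refine (Complex.re_le_norm _).trans ?_
    simp_rw [← e]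
    refine norm_integral_le_of_norm_le iw (Eventually.of_forall fun x => ?_)
    refine (norm_inner_le_norm _ _).trans ?_
    rw [h.norm_matAct_beta, mul_comm]
    exact mul_le_mul_of_nonneg_right (norm_radialDeriv_le V x₀ ψ x) (norm_nonneg _)
  -- Without the bound involving `ε`, either `m = 0` or `β` anticommutes with `V` off `x₀`. In the
  -- second case `β` anticommutes with each Hermitian matrix `∂_k V`, so `β ∂_k V` is skew-adjoint
  -- and the real part vanishes.
  · rcases eq_or_ne m 0 with hm0 | hm0
    · rw [hm0, zero_mul, zero_mul, zero_mul]
    · have hanti : ∀ x, x ≠ x₀ → β * V x + V x * β = 0 := by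
        intro x hx
        by_contra hcon
        exact hcase ⟨hm0, x, hx, hcon⟩
      have hz : (∫ x, inner ℂ (matAct β ((ψ : SpinorL2 d N) x)) (radialDeriv V x₀ ψ x) : ℂ).re
          = 0 := by
        rw [← RCLike.re_eq_complex_re, ← integral_re (MemLp.integrable_spinor_inner mw mv)]
        refine integral_eq_zero_of_ae ?_
        filter_upwards [ae_ne_point hd x₀] with x hx
        rw [radialDeriv, inner_sum, map_sum]
        refine Finset.sum_eq_zero fun k _ => ?_
        set D := fderiv ℝ V x (stdVec k)
        have hD := partial_isHermitian hV hherm hx k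
        have hβD := partial_anticomm β hV hanti hx k
        set u := (ψ : SpinorL2 d N) x
        have h1 : (inner ℂ (matAct β u) (matAct D u) : ℂ)
            = -inner ℂ (matAct D u) (matAct β u) := by
          rw [inner_matAct h.hermitian_beta, ← matAct_mul, eq_neg_of_add_eq_zero_left hβD,
            inner_matAct hD, ← matAct_mul, ← inner_neg_right]
          congr 1
          rw [matAct, map_neg]; rfl
        have h2 := inner_re_symm (𝕜 := ℂ) (matAct β u) (matAct D u)
        have h3 := congrArg Complex.re h1
        change Complex.re _ = Complex.re _ at h2
        rw [Complex.neg_re, ← h2] at h3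
        rw [inner_real_smul_right]
        change ((((x - x₀) k : ℝ) : ℂ) * _).re = 0
        rw [Complex.re_ofReal_mul]
        have h4 : (inner ℂ (matAct β u) (matAct D u) : ℂ).re = 0 := by linarith
        rw [h4, mul_zero]
      rw [hz, mul_zero]
      exact hR

end DiracEquation

/-! ### Absence of eigenvalues -/

theorem corollary1p3 (d : ℕ) (hd : 3 ≤ d) (m : ℝ) (hm : 0 ≤ m)
    (α : Fin d → Matrix (Fin (spinorDim d)) (Fin (spinorDim d)) ℂ)
    (β : Matrix (Fin (spinorDim d)) (Fin (spinorDim d)) ℂ) (hαβ : IsDiracMatrices α β)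
    (A : Space d → Space d) (hA : MemL2Loc A)
    (B : Space d → Matrix (Fin d) (Fin d) ℝ) (hB : MemL2Loc B) (hAB : IsMagneticField A B)
    (hdom : (diracOp α β m A (fun _ => 0)).domain = SobolevH1 d (spinorDim d))
    (hsa : IsSelfAdjoint (diracOp α β m A (fun _ => 0)))
    (V : Space d → Matrix (Fin (spinorDim d)) (Fin (spinorDim d)) ℂ)
    (hVherm : ∀ᵐ x, (V x).IsHermitian)
    (hVbdd : IsDiracBounded α β m A V)
    (x₀ : Space d)
    (hVsmooth : ContDiffOn ℝ ∞ V {x₀}ᶜ)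
    (hVout : ∀ (c : Space d) (r : ℝ), x₀ ∈ Metric.ball c r →
      ∃ C : ℝ, ∀ x, x ∉ Metric.ball c r → ‖V x‖ ≤ C)
    (ε₁ ε₂ ε₃ ε₄ : ℝ) (hε₁ : 0 ≤ ε₁) (hε₂ : 0 ≤ ε₂) (hε₃ : 0 ≤ ε₃) (hε₄ : 0 ≤ ε₄)
    (hsmall : (4 * (d : ℝ) - 6) / ((d : ℝ) - 2) * ε₁ + 4 / ((d : ℝ) - 2) * (ε₂ * ε₃)
      + 2 * m * ε₄ ^ 2 + (8 * (d : ℝ) - 8) / ((d : ℝ) - 2) * ε₃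
      + (4 * (d : ℝ) - 4) / ((d : ℝ) - 2) * ε₂ ≤ 2)
    (hBsmall : ∀ ψ : SobolevH1 d (spinorDim d),
      weightedMass (fun x => ‖x - x₀‖ ^ 2 * ‖B x‖ ^ 2) ψ ≤
        ENNReal.ofReal (ε₁ ^ 2) * magEnergy A ψ)
    (hVgrad : ∀ ψ : SobolevH1 d (spinorDim d),
      weightedMass (fun x => ‖x - x₀‖ ^ 2 * gradNorm V x ^ 2) ψ ≤
        ENNReal.ofReal (ε₂ ^ 2) * magEnergy A ψ)
    (hVsup : ∀ x, ‖x - x₀‖ * ‖V x‖ ≤ ε₃)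
    (hVmass : (m ≠ 0 ∧ ∃ x, x ≠ x₀ ∧ β * V x + V x * β ≠ 0) →
      ∀ ψ : SobolevH1 d (spinorDim d),
        weightedMass (fun x => ‖x - x₀‖ * gradNorm V x) ψ ≤
          ENNReal.ofReal (ε₄ ^ 2) * magEnergy A ψ) :
    pointSpectrum (diracOp α β m A V) = ∅ := by
  have ha := hαβ.isCliffordFamily
  have hmul : MulH1 A (spinorDim d) := hαβ.mulH1 hA hdom
  have hd1 : 1 ≤ d := by omega
  have hdr : (3 : ℝ) ≤ d := by exact_mod_cast hd
  have hBw : ∀ ψ : SobolevH1 d (spinorDim d),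
      ∃ hm : MemLp (fun x => (‖x - x₀‖ * ‖B x‖) • (ψ : SpinorL2 d (spinorDim d)) x) 2 volume,
        ‖hm.toLp _‖ ^ 2 ≤ ε₁ ^ 2 * gradSq A ψ := fun ψ =>
    memLp_smul_of_weightedMass_le (w := fun x => ‖x - x₀‖ * ‖B x‖) (ε := ε₁) hmul
      ((aestronglyMeasurable_norm_sub x₀).mul hB.locallyIntegrable.aestronglyMeasurable.norm) ψ
      (by simpa only [mul_pow] using hBsmall ψ)
  have hBm : FieldMulH1 x₀ B (spinorDim d) := fun ψ => (hBw ψ).1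
  rw [Set.eq_empty_iff_forall_notMem]
  rintro μ ⟨⟨ψ₀, hψH, hψL⟩, hne, hμ⟩
  set ψ : SobolevH1 d (spinorDim d) := ⟨ψ₀, hψH⟩
  have m0 := Lp.memLp (ψ : SpinorL2 d (spinorDim d))
  obtain ⟨hVw, hVle⟩ := memLp_smul_of_weightedMass_le
    (w := fun x => ‖x - x₀‖ * gradNorm V x) (ε := ε₂) hmul
    ((aestronglyMeasurable_norm_sub x₀).mul (aestronglyMeasurable_gradNorm hd1 hVsmooth)) ψ
    (by simpa only [mul_pow] using hVgrad ψ)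
  have mY := memLp_hardyQuot hmul x₀ hd ψ
  have mp := hmul.memLp_cliffordGrad (fun j => matAct (α j)) ψ
  have mw := (IsBddField.const (matAct β)).memLp m0
  have mb := hBm.memLp_cliffordField hB (fun j => matAct (α j)) ψ
  have mv := memLp_radialDeriv hd1 hVsmooth hVw
  have hVψ : ∀ᵐ x, ‖matAct (V x) ((ψ : SpinorL2 d (spinorDim d)) x)‖
      ≤ ε₃ * ‖hardyQuot x₀ ψ x‖ := by
    filter_upwards [ae_ne_point hd1 x₀] with x hx
    have hr : 0 < ‖x - x₀‖ := norm_pos_iff.2 (sub_ne_zero.2 hx)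
    rw [hardyQuot, norm_smul, norm_inv, norm_norm, ← mul_assoc]
    refine ((matAct (V x)).le_opNorm _).trans (mul_le_mul_of_nonneg_right ?_ (norm_nonneg _))
    rw [norm_matAct, ← div_eq_mul_inv, le_div_iff₀ hr, mul_comm]
    exact hVsup x
  have mu : MemLp (fun x => matAct (V x) ((ψ : SpinorL2 d (spinorDim d)) x)) 2 volume :=
    mY.of_le_mul (AEStronglyMeasurable.field_apply
      ((matActL _).continuous.comp_aestronglyMeasurable
        (aestronglyMeasurable_of_continuousOn_compl_singleton hd1 hVsmooth.continuousOn)) m0.1) hVψ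
  have hL2 : -Complex.I • mp.toLp _ + (m : ℂ) • mw.toLp _ + mu.toLp _ = μ • m0.toLp _ := by
    rw [Lp.toLp_coeFn]
    exact hμ
  have hrep := ha.integral_inner_cliffordGrad_re hmul ψ
  rw [integral_inner_eq m0 mp] at hrep
  -- Pairing the equation with `ψ` shows that the eigenvalue is real: `⟨ψ, p⟩` is purely imaginary,
  -- and `β` and `V` are symmetric.
  have hμre : μ = (μ.re : ℂ) := by
    have hu := im_inner_eq_zero_of_symm m0 mu (by
      filter_upwards [hVherm] with x hx
      exact (inner_matAct hx _ _).symm)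
    have hw := im_inner_eq_zero_of_symm m0 mw (Eventually.of_forall fun x =>
      (inner_matAct hαβ.hermitian_beta _ _).symm)
    have h1 := congrArg (fun z => (inner ℂ (m0.toLp _) z : ℂ).im) hL2
    simp only [inner_add_right, inner_smul_right, Complex.add_im, Complex.im_ofReal_mul, hu, hw,
      mul_zero, add_zero, inner_self_eq_norm_sq_to_K] at h1
    have h2 : (-Complex.I * inner ℂ (m0.toLp _) (mp.toLp _)).im = 0 := by
      simpa using hrep
    have h3 : (μ * ((‖m0.toLp _‖ ^ 2 : ℝ) : ℂ)).im = 0 := by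
      rw [← h2, h1, Complex.ofReal_pow]; rfl
    rw [Complex.im_mul_ofReal] at h3
    have h4 : ‖m0.toLp _‖ ^ 2 ≠ 0 := by
      rw [Lp.toLp_coeFn]
      exact pow_ne_zero _ (norm_ne_zero_iff.2 hne)
    exact Complex.ext rfl ((mul_eq_zero.1 h3).resolve_right h4)
  have heig : ∀ᵐ x, diracExpr α β m A V ψ x
      = (μ.re : ℂ) • (ψ : SpinorL2 d (spinorDim d)) x := by
    have h1 : (hψL.toLp _ : SpinorL2 d (spinorDim d)) = μ • ψ₀ := hμ
    rw [hμre] at h1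
    have h2 := hψL.coeFn_toLp
    rw [h1] at h2
    filter_upwards [h2, Lp.coeFn_smul (μ.re : ℂ) ψ₀] with x hx hx'
    rw [← hx, hx']
    rfl
  have hvir := hαβ.virial_identity hd hA hmul hB hAB hBm hVsmooth hVherm hVw heig
  rw [integral_inner_eq m0 mv, integral_inner_eq m0 mb, integral_inner_eq m0 mp] at hvir
  have hβp := hαβ.integral_inner_cliffordGrad_beta_im hmul ψ
  rw [integral_inner_eq mp mw] at hβp
  have hβb : (inner ℂ (mw.toLp _) (mb.toLp _) : ℂ).re = 0 := by
    rw [← integral_inner_eq, ← RCLike.re_eq_complex_re,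
      ← integral_re (MemLp.integrable_spinor_inner mw mb)]
    exact integral_eq_zero_of_ae (Eventually.of_forall fun x =>
      hαβ.inner_beta_clifford_re _ _)
  set G := Real.sqrt (gradSq A ψ) with hGdef
  have hG0 : 0 ≤ G := Real.sqrt_nonneg _
  have hG2 : gradSq A ψ = G ^ 2 := (Real.sq_sqrt (gradSq_nonneg A ψ)).symm
  -- The constant of the Hardy inequality in the form `‖ψ/|x - x₀|‖ ≤ h G`; all coefficients of the
  -- smallness condition are affine in `h`.
  set h : ℝ := 2 / ((d : ℝ) - 2) with hh
  have hd2 : (0 : ℝ) < d - 2 := by linarith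
  have hh0 : 0 < h := by positivity
  have hY : ‖mY.toLp _‖ ≤ h * G := by
    refine MemLp.norm_toLp_le mY (by positivity) ?_
    have hhardy := hardy_inequality hmul x₀ hd ψ
    rw [hG2] at hhardy
    have e : (h * G) ^ 2 = h ^ 2 * G ^ 2 := mul_pow _ _ _
    have e2 : h ^ 2 * (((d : ℝ) - 2) / 2) ^ 2 = 1 := by rw [hh]; field_simp
    rw [e]
    calc ∫ x, ‖hardyQuot x₀ ψ x‖ ^ 2
        = h ^ 2 * ((((d : ℝ) - 2) / 2) ^ 2 * ∫ x, ‖hardyQuot x₀ ψ x‖ ^ 2) := by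
          rw [← mul_assoc, e2, one_mul]
      _ ≤ _ := by gcongr
  have hYpos : 0 < ‖mY.toLp _‖ := by
    rw [norm_pos_iff]
    intro hz
    apply hne
    rw [Lp.eq_zero_iff_ae_eq_zero]
    have h1 := Lp.eq_zero_iff_ae_eq_zero.1 hz
    filter_upwards [h1, mY.coeFn_toLp, ae_ne_point hd1 x₀] with x hx hx' hx0
    rw [hx'] at hx
    exact (smul_eq_zero.1 hx).resolve_left
      (inv_ne_zero (norm_ne_zero_iff.2 (sub_ne_zero.2 hx0)))
  -- By Hardy, `G = 0` would force `ψ/|x - x₀| = 0`, contrary to `ψ ≠ 0`.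
  have hGpos : 0 < G := by
    by_contra hcon
    have : G = 0 := le_antisymm (not_lt.1 hcon) hG0
    rw [this, mul_zero] at hY
    linarith
  have hsq : ∀ {x ε : ℝ}, 0 ≤ ε → 0 ≤ x → x ^ 2 ≤ ε ^ 2 * gradSq A ψ → x ≤ ε * G :=
    fun hε hx hle => by
      rw [hG2, ← mul_pow] at hle
      exact (sq_le_sq₀ hx (mul_nonneg hε hG0)).1 hle
  have hBn : ‖(hBm ψ).toLp _‖ ≤ ε₁ * G := hsq hε₁ (norm_nonneg _) (hBw ψ).2
  have hbn : ‖mb.toLp _‖ ≤ ε₁ * G := (MemLp.norm_toLp_le_of_norm_le mb (hBm ψ)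
    (Eventually.of_forall fun x => ha.norm_cliffordField_le ψ x)).trans hBn
  have hvn : ‖mv.toLp _‖ ≤ ε₂ * G := (MemLp.norm_toLp_le_of_norm_le mv hVw
    (Eventually.of_forall fun x => norm_radialDeriv_le V x₀ ψ x)).trans
    (hsq hε₂ (norm_nonneg _) hVle)
  have hun : ‖mu.toLp _‖ ≤ h * ε₃ * G := by
    refine (Lp.norm_le_mul_norm_of_ae_le_mul (f := mu.toLp _) (g := mY.toLp _) (c := ε₃) ?_).trans ?_
    · filter_upwards [mu.coeFn_toLp, mY.coeFn_toLp, hVψ] with x hx hx' hx''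
      rw [hx, hx']
      exact hx''
    · calc ε₃ * ‖mY.toLp _‖ ≤ ε₃ * (h * G) := by gcongr
        _ = _ := by ring
  obtain ⟨q, hspin, hq⟩ := ha.spin_estimate hmul hd hB hBm (hAB.ae_skew hB) ψ hG0 hG2 hBn
  have hkin := integral_inner_cliffordGrad ha hd hA hmul hB hAB hBm ψ
  have hmass := mass_term_le hαβ hd1 hmul hVsmooth hVherm hm hVw (fun hc => hVmass hc ψ)
  rw [integral_inner_eq mw mv, hG2] at hmass
  rw [integral_inner_eq mp mb] at hspin
  have e1 : 1 / ((d : ℝ) - 2) = h / 2 := by rw [hh]; field_simp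
  rw [e1] at hq
  -- Half of the smallness condition, rewritten with `1/(d-2) = h/2`.
  have hsmall' : (2 + h / 2) * ε₁ + h * (ε₂ * ε₃) + m * ε₄ ^ 2 + (4 + 2 * h) * ε₃
      + (2 + h) * ε₂ ≤ 1 := by
    have c1 : (4 * (d : ℝ) - 6) / (d - 2) = 4 + h := by rw [hh]; field_simp; ring
    have c2 : (4 : ℝ) / (d - 2) = 2 * h := by rw [hh]; field_simp; norm_num
    have c3 : (8 * (d : ℝ) - 8) / (d - 2) = 8 + 4 * h := by rw [hh]; field_simp; ring
    have c4 : (4 * (d : ℝ) - 4) / (d - 2) = 4 + 2 * h := by rw [hh]; field_simp; ring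
    rw [c1, c2, c3, c4] at hsmall
    linarith
  rw [integral_inner_eq mp mp, hG2] at hkin
  exact false_of_virial_of_small hh0 hm hGpos hε₁ hε₂ hε₃ hsmall' (hL2.trans (by rw [← hμre]))
    hvir hβp hβb hvn hun hbn hmass hkin hspin hq
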